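/- \textbf{Setting.} Work over $\mathbb C$ and fix integers $n,m\ge 0$. Let $V=\mathbb C^{2n|m}$ be the superspace with even basis $p_1,\dots,p_n,q_1,\dots,q_n$ and odd basis $x_1,\dots,x_m$, with the even symplectic form determined by $\langle p_i,q_j\rangle=-\langle q_j,p_i\rangle=\langle x_i,x_j\rangle=\delta_{ij}$ and zero on all other pairs of basis vectors. Let $\mathfrak{osp}_{2n|m}$ be the Lie superalgebra spanned by the homogeneous endomorphisms $\xi$ of $V$ with $\langle \xi a,b\rangle+(-1)^{|\xi||a|}\langle a,\xi b\rangle=0$ for all homogeneous $a,b\in V$. \textbf{The relative Chevalley--Eilenberg complex.} Let $S(V)$ be the free supercommutative algebra on $V$, with the Poisson bracket (left derivatives) $$\{a,b\}=\sum_{i=1}^n\Big(\frac{\partial a}{\partial p_i}\frac{\partial b}{\partial q_i}-\frac{\partial a}{\partial q_i}\frac{\partial b}{\partial p_i}\Big)-(-1)^{|a|}\sum_{i=1}^m\frac{\partial a}{\partial x_i}\frac{\partial b}{\partial x_i}.$$ Let $\mathfrak g_{2n|m}$ (resp. $\tilde{\mathfrak g}_{2n|m}$) be the Lie subalgebra of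 the elements all of whose terms have order at least two (resp. three); $\mathfrak{g}_{2n|m}=\mathfrak{osp}_{2n|m}\ltimes\tilde{\mathfrak g}_{2n|m}$, where $\mathfrak{osp}_{2n|m}$ acts by the Leibniz rule. Let $\Lambda(\tilde{\mathfrak g}_{2n|m})$ be the tensor algebra of $\tilde{\mathfrak g}_{2n|m}$ modulo the relations $g\otimes h=-(-1)^{|g||h|}h\otimes g$, with $$d(g_1\wedge\dots\wedge g_p)=\sum_{1\le i<j\le p}(-1)^{p(g)}\{g_i,g_j\}\wedge g_1\wedge\dots\widehat{g_i}\dots\widehat{g_j}\dots\wedge g_p,$$ $$p(g)=|g_i|(|g_1|+\dots+|g_{i-1}|)+|g_j|(|g_1|+\dots+|g_{j-1}|)+|g_i||g_j|+i+j-1 .$$ The relative Chevalley--Eilenberg complex $C_\bullet(\mathfrak g_{2n|m},\mathfrak{osp}_{2n|m})$ is the space of coinvariants $\Lambda(\tilde{\mathfrak g}_{2n|m})_{\mathfrak{osp}_{2n|m}}$ with the differential induced by $d$. \textbf{The graph complex.} A graph $\Gamma$ is a finite set of half-edges (taken from a fixed infinite set) with a partition into vertices, all of cardinality (valency) at least $3$,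 and a partition into two-element sets, the edges. An edge is a loop if both of its half-edges lie in the same vertex. An orientation is a linear ordering of the vertices together with an ordering of the two half-edges of every edge, modulo the changes for which the product of the sign of the permutation of the vertices and of a factor $-1$ for each reversed edge is $+1$; so every orientation $\omega$ has an opposite $-\omega$. The graph complex $\mathcal G$ is the complex vector space generated by the isomorphism classes of oriented graphs, modulo $(\Gamma,-\omega)=-(\Gamma,\omega)$. If $e=(h,h')$ is an edge that is not a loop and the orientation is represented by an ordering $(v,v',v_3,\dots,v_r)$ of the vertices with $h\in v$, $h'\in v'$, then $\Gamma/e$ has the vertices $(v\setminus\{h\})\cup(v'\setminus\{h'\}),v_3,\dots,v_r$, in this order, and the remaining edges with their orientations. The differential is $\partial\Gamma=\sum_e\Gamma/e$, the sum being over the edges of $\Gamma$ that are not loops (a graph with a loop is zero in $\mathcal G$). \textbf{The map $\Phi$.} A chord diagram is a partition $c$ of $\{1,\dots,2k\}$ into two-element sets; $\mathscr C(k)$ is the set of all of these, and $\hat c=(i_1,j_1),\dots,(i_k,j_k)$ denotes $c$ with each pair ordered so that $i_r<j_r$. Let $\beta_{\hat c}:V^{\otimes 2k}\to\mathbb C$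 be the linear map which permutes the tensor factors, with the Koszul sign, into the order $i_1,j_1,i_2,j_2,\dots,i_k,j_k$ and then applies $\langle-,-\rangle^{\otimes k}$. For $k_1+\dots+k_i=2k$ let $\Gamma_{k_1,\dots,k_i}(\hat c)$ be the oriented graph with half-edges $h_1,\dots,h_{2k}$, with vertices the consecutive blocks $\{h_1,\dots,h_{k_1}\},\{h_{k_1+1},\dots,h_{k_1+k_2}\},\dots$ in this order, and with oriented edges $(h_{i_r},h_{j_r})$, $1\le r\le k$. \textbf{Proposition.} For all $n,m\ge0$ there is exactly one linear map $$\Phi^{2n|m}:C_\bullet(\mathfrak g_{2n|m},\mathfrak{osp}_{2n|m})\to\mathcal G$$ such that, for all $i\ge0$, all $k_1,\dots,k_i\ge3$ and all $x_{pq}\in V$, $$\Phi^{2n|m}\big((x_{11}\cdots x_{1k_1})\wedge\dots\wedge(x_{i1}\cdots x_{ik_i})\big)=\sum_{c\in\mathscr C(k)}\beta_{\hat c}(x_{11}\otimes\cdots\otimes x_{ik_i})\,\Gamma_{k_1,\dots,k_i}(\hat c)$$ if $k_1+\dots+k_i=2k$ is even, and the left-hand side is $0$ if $k_1+\dots+k_i$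 is odd. This map is a map of complexes: $$\Phi^{2n|m}\circ d=\partial\circ\Phi^{2n|m}.$$ -/

import Mathlib

open scoped BigOperators

noncomputable section

namespace SuperGraph

/-- The sign `(-1) ^ a` attached to a parity `a`. -/
def ksign (a : ZMod 2) : ℂ := if a = 0 then 1 else -1

theorem ksign_mul_self (a : ZMod 2) : ksign a * ksign a = 1 := by
  unfold ksign; split_ifs <;> norm_num

/-! ### The superspace with coordinates `p_i`, `q_i` (even) and `x_i` (odd) -/

/-- The coordinates of the `2n|m`-dimensional superspace: `inl (inl i)` is `p_i`,
`inl (inr i)` is `q_i` and `inr i` is `x_i`. -/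
abbrev Coord (n m : ℕ) := (Fin n ⊕ Fin n) ⊕ Fin m

variable {n m : ℕ}

/-- The parity of a coordinate. -/
def par : Coord n m → ZMod 2
  | .inl _ => 0
  | .inr _ => 1

/-- The canonical symplectic form on the basis of coordinates. -/
def form : Coord n m → Coord n m → ℂ
  | .inl (.inl i), .inl (.inr j) => if i = j then 1 else 0
  | .inl (.inr i), .inl (.inl j) => if i = j then -1 else 0
  | .inr i, .inr j => if i = j then 1 else 0
  | _, _ => 0

/-! ### The Poisson algebra of Hamiltonians -/

/-- The supercommutation relations `a b = (-1)^{|a||b|} b a` on coordinates. -/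
inductive HamRel (n m : ℕ) :
    FreeAlgebra ℂ (Coord n m) → FreeAlgebra ℂ (Coord n m) → Prop
  | swap (a b : Coord n m) : HamRel n m (FreeAlgebra.ι ℂ a * FreeAlgebra.ι ℂ b)
      (ksign (par a * par b) • (FreeAlgebra.ι ℂ b * FreeAlgebra.ι ℂ a))

/-- The free supercommutative algebra `S(ℂ^{2n|m})`, underlying the Poisson algebra of
Hamiltonians. -/
def Ham (n m : ℕ) : Type := RingQuot (HamRel n m)

instance : Ring (Ham n m) := inferInstanceAs (Ring (RingQuot (HamRel n m)))

instance : Algebra ℂ (Ham n m) := inferInstanceAs (Algebra ℂ (RingQuot (HamRel n m)))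

/-- The quotient map from the free associative algebra on the coordinates. -/
def Ham.mk (n m : ℕ) : FreeAlgebra ℂ (Coord n m) →ₐ[ℂ] Ham n m :=
  RingQuot.mkAlgHom ℂ (HamRel n m)

theorem Ham.mk_rel {x y : FreeAlgebra ℂ (Coord n m)} (h : HamRel n m x y) :
    Ham.mk n m x = Ham.mk n m y :=
  RingQuot.mkAlgHom_rel ℂ h

/-- The universal property of the quotient. -/
def Ham.lift {A : Type*} [Ring A] [Algebra ℂ A] (f : FreeAlgebra ℂ (Coord n m) →ₐ[ℂ] A)
    (hf : ∀ ⦃x y⦄, HamRel n m x y → f x = f y) : Ham n m →ₐ[ℂ] A :=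
  RingQuot.liftAlgHom ℂ ⟨f, hf⟩

theorem Ham.lift_mk {A : Type*} [Ring A] [Algebra ℂ A] (f : FreeAlgebra ℂ (Coord n m) →ₐ[ℂ] A)
    (hf : ∀ ⦃x y⦄, HamRel n m x y → f x = f y) (x : FreeAlgebra ℂ (Coord n m)) :
    Ham.lift f hf (Ham.mk n m x) = f x :=
  RingQuot.liftAlgHom_mkAlgHom_apply ℂ f hf x

/-- A coordinate as an element of the algebra of Hamiltonians. -/
def gen (a : Coord n m) : Ham n m := Ham.mk n m (FreeAlgebra.ι ℂ a)

theorem gen_swap (a b : Coord n m) :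
    gen a * gen b = ksign (par a * par b) • (gen b * gen a) := by
  unfold gen
  rw [← map_mul, Ham.mk_rel (HamRel.swap a b), map_smul, map_mul]

/-- The monomial `a_1 a_2 ⋯ a_k` given by a word in the coordinates. -/
def mono (w : List (Coord n m)) : Ham n m := (w.map gen).prod

/-- The parity of a monomial. -/
def wpar (w : List (Coord n m)) : ZMod 2 := (w.map par).sum

/-- The parity involution, `f ↦ (-1)^{|f|} f` on homogeneous `f`. -/
def parityInv (n m : ℕ) : Ham n m →ₐ[ℂ] Ham n m :=
  Ham.lift (FreeAlgebra.lift ℂ (fun a => ksign (par a) • gen a)) <| by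
    rintro _ _ ⟨a, b⟩
    simp only [map_mul, map_smul, FreeAlgebra.lift_ι_apply, smul_mul_smul_comm]
    rw [gen_swap a b, smul_comm, mul_comm (ksign (par b))]

theorem parityInv_gen (a : Coord n m) : parityInv n m (gen a) = ksign (par a) • gen a := by
  rw [parityInv, gen, Ham.lift_mk, FreeAlgebra.lift_ι_apply, gen]

/-- The algebra map `f ↦ [[(-1)^{|z||f|} f, ∂f/∂z], [0, f]]`, whose multiplicativity is the
super Leibniz rule `∂(fg) = (∂f) g + (-1)^{|z||f|} f (∂g)` for the left derivative. -/
def pdHom (z : Coord n m) : Ham n m →ₐ[ℂ] Matrix (Fin 2) (Fin 2) (Ham n m) :=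
  Ham.lift (FreeAlgebra.lift ℂ (fun a =>
      !![ksign (par z * par a) • gen a, if a = z then 1 else 0; 0, gen a])) <| by
    rintro _ _ ⟨a, b⟩
    simp only [map_mul, map_smul, FreeAlgebra.lift_ι_apply, Matrix.mul_fin_two,
      Matrix.smul_of, Matrix.smul_cons, Matrix.smul_empty, smul_mul_smul_comm,
      mul_zero, zero_mul, add_zero, zero_add, smul_zero]
    congr 1
    have h2 := gen_swap a b
    have h1 : (ksign (par z * par a) • gen a) * (if b = z then (1 : Ham n m) else 0)
        + (if a = z then (1 : Ham n m) else 0) * gen b =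
        ksign (par a * par b) • ((ksign (par z * par b) • gen b) *
          (if a = z then (1 : Ham n m) else 0) + (if b = z then (1 : Ham n m) else 0) * gen a) := by
      by_cases ha : a = z <;> by_cases hb : b = z
      · subst ha; subst hb
        simp only [if_true, mul_one, one_mul, smul_add, smul_smul, ksign_mul_self, one_smul]
        exact add_comm _ _
      · subst ha
        simp [hb, smul_smul, ksign_mul_self]
      · subst hb
        simp [ha, mul_comm (par a)]
      · simp [ha, hb]
    rw [h1, h2, smul_smul, smul_smul, mul_comm (ksign (par a * par b)),
      mul_comm (ksign (par z * par a))]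

/-- The left partial derivative `∂/∂z`. -/
def pd (z : Coord n m) : Ham n m →ₗ[ℂ] Ham n m :=
  (Matrix.entryLinearMap ℂ (Ham n m) (0 : Fin 2) (1 : Fin 2)).comp (pdHom z).toLinearMap

theorem pdHom_gen (z a : Coord n m) : pdHom z (gen a) =
    !![ksign (par z * par a) • gen a, if a = z then 1 else 0; 0, gen a] := by
  rw [pdHom, gen, Ham.lift_mk, FreeAlgebra.lift_ι_apply, gen]

theorem pd_one (z : Coord n m) : pd z (1 : Ham n m) = 0 := by
  simp [pd]

theorem pdHom_mono_11 (z : Coord n m) (w : List (Coord n m)) :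
    pdHom z (mono w) 1 1 = mono w := by
  induction w with
  | nil => simp [mono]
  | cons a w ih =>
    have h : mono (a :: w) = gen a * mono w := by simp [mono]
    rw [h, map_mul, Matrix.mul_apply, Fin.sum_univ_two, ih, pdHom_gen]
    simp

theorem pd_cons (z a : Coord n m) (w : List (Coord n m)) :
    pd z (mono (a :: w)) = (if a = z then mono w else 0) +
      ksign (par z * par a) • (gen a * pd z (mono w)) := by
  have h : mono (a :: w) = gen a * mono w := by simp [mono]
  have h2 := pdHom_mono_11 z w
  simp only [pd, LinearMap.comp_apply, AlgHom.toLinearMap_apply, Matrix.entryLinearMap_apply]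
  rw [h, map_mul, Matrix.mul_apply, Fin.sum_univ_two, h2, pdHom_gen]
  simp [add_comm]

/-- The canonical Poisson bracket
`{a,b} = ∑ (∂a/∂p_i ∂b/∂q_i - ∂a/∂q_i ∂b/∂p_i) - (-1)^{|a|} ∑ ∂a/∂x_i ∂b/∂x_i`. -/
def poisson (n m : ℕ) : Ham n m →ₗ[ℂ] Ham n m →ₗ[ℂ] Ham n m :=
  ∑ i : Fin n,
    ((LinearMap.mul ℂ (Ham n m)).compl₁₂ (pd (.inl (.inl i))) (pd (.inl (.inr i)))
      - (LinearMap.mul ℂ (Ham n m)).compl₁₂ (pd (.inl (.inr i))) (pd (.inl (.inl i))))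
  - ∑ i : Fin m, (LinearMap.mul ℂ (Ham n m)).compl₁₂
      ((pd (.inr i)).comp (parityInv n m).toLinearMap) (pd (.inr i))

/-- The Hamiltonians all of whose terms have order at least `k`. -/
def ordGe (n m k : ℕ) : Submodule ℂ (Ham n m) :=
  Submodule.span ℂ {f | ∃ w : List (Coord n m), k ≤ w.length ∧ f = mono w}

theorem ordGe_anti {j k : ℕ} (h : j ≤ k) : ordGe n m k ≤ ordGe n m j :=
  Submodule.span_mono fun _ ⟨w, hw, e⟩ => ⟨w, h.trans hw, e⟩

theorem mul_mem_ordGe {j k : ℕ} {f g : Ham n m} (hf : f ∈ ordGe n m j) (hg : g ∈ ordGe n m k) :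
    f * g ∈ ordGe n m (j + k) := by
  have : f * g ∈ ordGe n m j * ordGe n m k := Submodule.mul_mem_mul hf hg
  rw [ordGe, ordGe, Submodule.span_mul_span] at this
  refine Submodule.span_mono ?_ this
  rintro _ ⟨_, ⟨w, hw, rfl⟩, _, ⟨u, hu, rfl⟩, rfl⟩
  exact ⟨w ++ u, by simp; omega, by simp [mono]⟩

theorem gen_mem_ordGe (a : Coord n m) : gen a ∈ ordGe n m 1 :=
  Submodule.subset_span ⟨[a], by simp, by simp [mono]⟩

theorem pd_mono_mem (z : Coord n m) (w : List (Coord n m)) :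
    pd z (mono w) ∈ ordGe n m (w.length - 1) := by
  induction w with
  | nil => simp [mono, pd_one]
  | cons a w ih =>
    rw [pd_cons]
    refine Submodule.add_mem _ ?_ (Submodule.smul_mem _ _ ?_)
    · split_ifs
      · exact Submodule.subset_span ⟨w, by simp, rfl⟩
      · exact Submodule.zero_mem _
    · exact ordGe_anti (by simp; omega) (mul_mem_ordGe (gen_mem_ordGe a) ih)

theorem pd_mem {k : ℕ} (z : Coord n m) {f : Ham n m} (hf : f ∈ ordGe n m k) :
    pd z f ∈ ordGe n m (k - 1) := by
  have : ordGe n m k ≤ (ordGe n m (k - 1)).comap (pd z) := by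
    refine Submodule.span_le.2 ?_
    rintro _ ⟨w, hw, rfl⟩
    exact ordGe_anti (by omega) (pd_mono_mem z w)
  exact this hf

theorem parityInv_mono (w : List (Coord n m)) :
    ∃ c : ℂ, parityInv n m (mono w) = c • mono w := by
  induction w with
  | nil => exact ⟨1, by simp [mono]⟩
  | cons a w ih =>
    obtain ⟨c, hc⟩ := ih
    refine ⟨ksign (par a) * c, ?_⟩
    have h : mono (a :: w) = gen a * mono w := by simp [mono]
    rw [h, map_mul, hc, parityInv_gen, smul_mul_smul_comm]

theorem parityInv_mem {k : ℕ} {f : Ham n m} (hf : f ∈ ordGe n m k) :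
    parityInv n m f ∈ ordGe n m k := by
  have : ordGe n m k ≤ (ordGe n m k).comap (parityInv n m).toLinearMap := by
    refine Submodule.span_le.2 ?_
    rintro _ ⟨w, hw, rfl⟩
    obtain ⟨c, hc⟩ := parityInv_mono w
    change parityInv n m (mono w) ∈ ordGe n m k
    rw [hc]
    exact Submodule.smul_mem _ _ (Submodule.subset_span ⟨w, hw, rfl⟩)
  exact this hf

theorem poisson_apply (f g : Ham n m) : poisson n m f g =
    ∑ i : Fin n, (pd (.inl (.inl i)) f * pd (.inl (.inr i)) g
      - pd (.inl (.inr i)) f * pd (.inl (.inl i)) g)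
    - ∑ i : Fin m, pd (.inr i) (parityInv n m f) * pd (.inr i) g := by
  simp [poisson, LinearMap.sum_apply]

theorem poisson_mem {f g : Ham n m} (hf : f ∈ ordGe n m 3) (hg : g ∈ ordGe n m 3) :
    poisson n m f g ∈ ordGe n m 3 := by
  have key : ∀ {u v : Ham n m} (y z : Coord n m), u ∈ ordGe n m 3 → v ∈ ordGe n m 3 →
      pd y u * pd z v ∈ ordGe n m 3 := fun y z hu hv =>
    ordGe_anti (by norm_num) (mul_mem_ordGe (pd_mem y hu) (pd_mem z hv))
  rw [poisson_apply]
  exact Submodule.sub_mem _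
    (Submodule.sum_mem _ fun i _ => Submodule.sub_mem _ (key _ _ hf hg) (key _ _ hf hg))
    (Submodule.sum_mem _ fun i _ => key _ _ (parityInv_mem hf) hg)

theorem zmod2_cases (a : ZMod 2) : a = 0 ∨ a = 1 := by
  revert a; decide

theorem zmod2_one_add_one : (1 : ZMod 2) + 1 = 0 := by decide

theorem ksign_add (a b : ZMod 2) : ksign (a + b) = ksign a * ksign b := by
  rcases zmod2_cases a with rfl | rfl <;> rcases zmod2_cases b with rfl | rfl <;>
    simp [ksign, zmod2_one_add_one]

theorem ksign_zero : ksign 0 = 1 := by simp [ksign]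

theorem ksign_one : ksign 1 = -1 := by simp [ksign]

theorem mono_cons (a : Coord n m) (w : List (Coord n m)) : mono (a :: w) = gen a * mono w := by
  simp [mono]

theorem wpar_cons (a : Coord n m) (w : List (Coord n m)) : wpar (a :: w) = par a + wpar w := by
  simp [wpar]

/-- The Hamiltonians of parity `ε` all of whose terms have order at least `k`. -/
def homGe (n m k : ℕ) (ε : ZMod 2) : Submodule ℂ (Ham n m) :=
  Submodule.span ℂ {f | ∃ w : List (Coord n m), k ≤ w.length ∧ wpar w = ε ∧ f = mono w}

theorem mono_mem_homGe {k : ℕ} {w : List (Coord n m)} (hw : k ≤ w.length) :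
    mono w ∈ homGe n m k (wpar w) :=
  Submodule.subset_span ⟨w, hw, rfl, rfl⟩

theorem homGe_anti {j k : ℕ} {ε : ZMod 2} (h : j ≤ k) : homGe n m k ε ≤ homGe n m j ε :=
  Submodule.span_mono fun _ ⟨w, hw, e⟩ => ⟨w, h.trans hw, e⟩

theorem homGe_le (k : ℕ) (ε : ZMod 2) : homGe n m k ε ≤ ordGe n m k :=
  Submodule.span_mono fun _ ⟨w, hw, _, e⟩ => ⟨w, hw, e⟩

theorem homGe_induction {k : ℕ} {ε : ZMod 2} {S : Submodule ℂ (Ham n m)}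
    (h : ∀ w : List (Coord n m), k ≤ w.length → wpar w = ε → mono w ∈ S) {f : Ham n m}
    (hf : f ∈ homGe n m k ε) : f ∈ S := by
  refine (Submodule.span_le (p := S)).2 ?_ hf
  rintro _ ⟨w, hw, he, rfl⟩
  exact h w hw he

theorem mul_mem_homGe {j k : ℕ} {ε η : ZMod 2} {f g : Ham n m} (hf : f ∈ homGe n m j ε)
    (hg : g ∈ homGe n m k η) : f * g ∈ homGe n m (j + k) (ε + η) := by
  have : f * g ∈ homGe n m j ε * homGe n m k η := Submodule.mul_mem_mul hf hg
  rw [homGe, homGe, Submodule.span_mul_span] at this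
  refine Submodule.span_mono ?_ this
  rintro _ ⟨_, ⟨w, hw, hw', rfl⟩, _, ⟨u, hu, hu', rfl⟩, rfl⟩
  exact ⟨w ++ u, by simp; omega, by simp [wpar, ← hw', ← hu'], by simp [mono]⟩

theorem gen_mem_homGe (a : Coord n m) : gen a ∈ homGe n m 1 (par a) :=
  Submodule.subset_span ⟨[a], by simp, by simp [wpar], by simp [mono]⟩

theorem pd_mem_homGe {k : ℕ} {ε : ZMod 2} (z : Coord n m) {f : Ham n m}
    (hf : f ∈ homGe n m k ε) : pd z f ∈ homGe n m (k - 1) (ε + par z) := by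
  refine homGe_induction (S := (homGe n m (k - 1) (ε + par z)).comap (pd z)) ?_ hf
  clear hf f
  intro w
  induction w generalizing k ε with
  | nil => intro _ _; simp [mono, pd_one]
  | cons a w ih =>
    intro hk he
    rw [Submodule.mem_comap, pd_cons]
    rw [wpar_cons] at he
    subst he
    refine Submodule.add_mem _ ?_ (Submodule.smul_mem _ _ ?_)
    · split_ifs with h
      · subst h
        refine Submodule.subset_span ⟨w, by simp at hk; omega, ?_, rfl⟩
        rw [add_comm (par a), add_assoc, CharTwo.add_self_eq_zero, add_zero]
      · exact Submodule.zero_mem _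
    · have h1 := mul_mem_homGe (gen_mem_homGe a) (ih (k := w.length) le_rfl rfl)
      rw [← add_assoc] at h1
      cases w with
      | nil => simp [mono, pd_one]
      | cons b w => exact homGe_anti (by simp at hk ⊢; omega) h1

theorem parityInv_homGe {k : ℕ} {ε : ZMod 2} {f : Ham n m} (hf : f ∈ homGe n m k ε) :
    parityInv n m f = ksign ε • f := by
  refine homGe_induction (S := LinearMap.eqLocus (parityInv n m).toLinearMap
    (ksign ε • LinearMap.id)) ?_ hf
  rintro w - rfl
  clear hf
  change parityInv n m (mono w) = ksign (wpar w) • mono w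
  induction w with
  | nil => simp [mono, wpar, ksign_zero]
  | cons a w ih =>
    rw [mono_cons, map_mul, ih, parityInv_gen, smul_mul_smul_comm, wpar_cons, ksign_add]

theorem gen_mul_mono (a : Coord n m) (w : List (Coord n m)) :
    gen a * mono w = ksign (par a * wpar w) • (mono w * gen a) := by
  induction w with
  | nil => simp [mono, wpar, ksign_zero]
  | cons b w ih =>
    rw [mono_cons, ← mul_assoc, gen_swap, smul_mul_assoc, mul_assoc, ih, mul_smul_comm, smul_smul,
      wpar_cons, mul_add, ksign_add, mul_assoc]

theorem mul_comm_homGe {j k : ℕ} {ε η : ZMod 2} {f g : Ham n m} (hf : f ∈ homGe n m j ε)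
    (hg : g ∈ homGe n m k η) : f * g = ksign (ε * η) • (g * f) := by
  refine homGe_induction (S := LinearMap.eqLocus ((LinearMap.mul ℂ (Ham n m)).flip g)
    (ksign (ε * η) • LinearMap.mul ℂ (Ham n m) g)) ?_ hf
  rintro w - rfl
  change mono w * g = ksign (wpar w * η) • (g * mono w)
  refine homGe_induction (S := LinearMap.eqLocus (LinearMap.mul ℂ (Ham n m) (mono w))
    (ksign (wpar w * η) • (LinearMap.mul ℂ (Ham n m)).flip (mono w))) ?_ hg
  rintro u - rfl
  clear hf hg
  change mono w * mono u = ksign (wpar w * wpar u) • (mono u * mono w)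
  induction w with
  | nil => simp [mono, wpar, ksign_zero]
  | cons a w ih =>
    rw [mono_cons, mul_assoc, ih, mul_smul_comm, ← mul_assoc, gen_mul_mono, smul_mul_assoc,
      smul_smul, wpar_cons, add_mul, ksign_add, mul_comm (ksign _), mul_assoc]

/-- The super Leibniz rule for left derivatives. -/
theorem pd_mul {j : ℕ} {ε : ZMod 2} {f : Ham n m} (hf : f ∈ homGe n m j ε) (z : Coord n m)
    {k : ℕ} {η : ZMod 2} {g : Ham n m} (hg : g ∈ homGe n m k η) :
    pd z (f * g) = pd z f * g + ksign (par z * ε) • (f * pd z g) := by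
  refine homGe_induction (S := LinearMap.eqLocus ((pd z).comp ((LinearMap.mul ℂ (Ham n m)).flip g))
    (((LinearMap.mul ℂ (Ham n m)).flip g).comp (pd z) +
      ksign (par z * ε) • ((LinearMap.mul ℂ (Ham n m)).flip (pd z g)))) ?_ hf
  rintro w - rfl
  change pd z (mono w * g) = pd z (mono w) * g + ksign (par z * wpar w) • (mono w * pd z g)
  refine homGe_induction (S := LinearMap.eqLocus
    ((pd z).comp (LinearMap.mul ℂ (Ham n m) (mono w)))
    ((LinearMap.mul ℂ (Ham n m) (pd z (mono w))) +
      ksign (par z * wpar w) • ((LinearMap.mul ℂ (Ham n m) (mono w)).comp (pd z)))) ?_ hg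
  rintro u - rfl
  change pd z (mono w * mono u) =
    pd z (mono w) * mono u + ksign (par z * wpar w) • (mono w * pd z (mono u))
  clear hf hg
  have happ : ∀ v v' : List (Coord n m), mono v * mono v' = mono (v ++ v') := by simp [mono]
  induction w with
  | nil => simp [mono, wpar, ksign_zero, pd_one]
  | cons a w ih =>
    rw [happ, List.cons_append, pd_cons, ← happ, ih, pd_cons, mono_cons, wpar_cons, mul_add,
      mul_add, ksign_add, add_mul, add_assoc, smul_add, smul_mul_assoc, ite_mul, zero_mul,
      mul_smul_comm, smul_smul, mul_assoc, mul_assoc]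

theorem poisson_homGe {j k : ℕ} {ε η : ZMod 2} {f g : Ham n m} (hf : f ∈ homGe n m j ε)
    (hg : g ∈ homGe n m k η) : poisson n m f g ∈ homGe n m (j - 1 + (k - 1)) (ε + η) := by
  have key : ∀ y z : Coord n m, par y = par z →
      pd y f * pd z g ∈ homGe n m (j - 1 + (k - 1)) (ε + η) := by
    intro y z h
    have := mul_mem_homGe (pd_mem_homGe y hf) (pd_mem_homGe z hg)
    rwa [h, add_add_add_comm, CharTwo.add_self_eq_zero, add_zero] at this
  rw [poisson_apply]
  refine Submodule.sub_mem _ (Submodule.sum_mem _ fun i _ => Submodule.sub_mem _ (key _ _ rfl)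
    (key _ _ rfl)) (Submodule.sum_mem _ fun i _ => ?_)
  rw [parityInv_homGe hf, map_smul, smul_mul_assoc]
  exact Submodule.smul_mem _ _ (key _ _ rfl)

/-- The Poisson bracket is super antisymmetric. -/
theorem poisson_swap {j k : ℕ} {ε η : ZMod 2} {f g : Ham n m} (hf : f ∈ homGe n m j ε)
    (hg : g ∈ homGe n m k η) : poisson n m f g = -(ksign (ε * η) • poisson n m g f) := by
  have h0 : ∀ a b : Fin n ⊕ Fin n, pd (.inl a) f * pd (.inl b) g =
      ksign (ε * η) • (pd (.inl b) g * pd (.inl a) f) := by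
    intro a b
    have := mul_comm_homGe (pd_mem_homGe (.inl a) hf) (pd_mem_homGe (.inl b) hg)
    simpa only [par, add_zero] using this
  have h1 : ∀ i : Fin m, pd (.inr i) f * pd (.inr i) g =
      ksign ((ε + 1) * (η + 1)) • (pd (.inr i) g * pd (.inr i) f) := fun i =>
    mul_comm_homGe (pd_mem_homGe (.inr i) hf) (pd_mem_homGe (.inr i) hg)
  rw [poisson_apply, poisson_apply, parityInv_homGe hf, parityInv_homGe hg]
  simp only [map_smul, smul_mul_assoc, h0, h1]
  rw [smul_sub, neg_sub, Finset.smul_sum, Finset.smul_sum, sub_eq_add_neg, add_comm,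
    sub_eq_add_neg, ← Finset.sum_neg_distrib, ← Finset.sum_neg_distrib]
  congr 1
  · refine Finset.sum_congr rfl fun i _ => ?_
    rw [smul_smul, smul_smul, ← neg_smul]
    congr 1
    rcases zmod2_cases ε with rfl | rfl <;> rcases zmod2_cases η with rfl | rfl <;>
      simp [ksign, zmod2_one_add_one]
  · refine Finset.sum_congr rfl fun i _ => ?_
    rw [smul_sub, neg_sub]

/-- The Poisson bracket satisfies the super Leibniz rule in its second argument. -/
theorem poisson_mul {i j k : ℕ} {ε η θ : ZMod 2} {f g h : Ham n m} (hf : f ∈ homGe n m i ε)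
    (hg : g ∈ homGe n m j η) (hh : h ∈ homGe n m k θ) :
    poisson n m f (g * h) =
      poisson n m f g * h + ksign (ε * η) • (g * poisson n m f h) := by
  have h0 : ∀ a b : Fin n ⊕ Fin n, pd (.inl a) f * pd (.inl b) (g * h) =
      pd (.inl a) f * pd (.inl b) g * h +
        ksign (ε * η) • (g * (pd (.inl a) f * pd (.inl b) h)) := by
    intro a b
    have := mul_comm_homGe (pd_mem_homGe (.inl a) hf) hg
    simp only [par, add_zero] at this
    rw [pd_mul hg _ hh, mul_add, ← mul_assoc, mul_smul_comm, ← mul_assoc, this]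
    simp only [par, zero_mul, ksign_zero, one_smul, smul_mul_assoc, mul_assoc]
  have h1 : ∀ a : Fin m, pd (.inr a) f * pd (.inr a) (g * h) =
      pd (.inr a) f * pd (.inr a) g * h +
        ksign (ε * η) • (g * (pd (.inr a) f * pd (.inr a) h)) := by
    intro a
    have := mul_comm_homGe (pd_mem_homGe (.inr a) hf) hg
    rw [pd_mul hg _ hh, mul_add, ← mul_assoc, mul_smul_comm, ← mul_assoc, this]
    simp only [par, one_mul, smul_mul_assoc, smul_smul, mul_assoc]
    congr 2
    rw [add_mul, one_mul, ksign_add, mul_comm, mul_assoc, ksign_mul_self, mul_one]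
  rw [poisson_apply, poisson_apply, poisson_apply, parityInv_homGe hf]
  simp only [map_smul, smul_mul_assoc, h0, h1]
  simp only [sub_mul, mul_sub, Finset.sum_mul, Finset.mul_sum, smul_sub, Finset.smul_sum,
    smul_add, smul_mul_assoc, mul_smul_comm, Finset.sum_add_distrib, Finset.sum_sub_distrib,
    smul_comm (ksign ε)]
  abel

theorem pd_gen (z a : Coord n m) : pd z (gen a) = if a = z then 1 else 0 := by
  have := pd_cons z a ([] : List (Coord n m))
  simpa [mono, pd_one] using this

theorem poisson_one {f : Ham n m} : poisson n m f 1 = 0 := by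
  simp [poisson_apply, pd_one]

theorem poisson_gen (a b : Coord n m) :
    poisson n m (gen a) (gen b) = algebraMap ℂ (Ham n m) (form a b) := by
  rw [poisson_apply, parityInv_gen]
  simp only [map_smul, pd_gen]
  rcases a with (a | a) | a <;> rcases b with (b | b) | b <;>
    simp [form, par, ksign, apply_ite (algebraMap ℂ (Ham n m)), eq_comm] <;>
    split_ifs <;> simp

/-! ### The orthosymplectic Lie superalgebra -/

/-- The part of parity `ε` of the orthosymplectic Lie superalgebra, as a set of matrices: `ξ`
stands for the endomorphism `b ↦ ∑ a, ξ a b • a`; it is homogeneous of parity `ε` and satisfies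
`⟨ξ a, b⟩ + (-1)^{|ξ||a|} ⟨a, ξ b⟩ = 0`. -/
def osp (n m : ℕ) (ε : ZMod 2) : Set (Matrix (Coord n m) (Coord n m) ℂ) :=
  {ξ | (∀ a b, ξ a b ≠ 0 → par a = par b + ε) ∧
    ∀ a b, ∑ c, ξ c a * form c b + ksign (ε * par a) * ∑ c, ξ c b * form a c = 0}

/-- The linear Hamiltonian `ξ(z) = ∑_a ξ_{az} a`. -/
def img (ξ : Matrix (Coord n m) (Coord n m) ℂ) (z : Coord n m) : Ham n m := ∑ a, ξ a z • gen a

/-- The action of an endomorphism `ξ` on Hamiltonians by the Leibniz rule, i.e. as the linear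
vector field `∑_z ξ(z) ∂/∂z`. -/
def actHam (ξ : Matrix (Coord n m) (Coord n m) ℂ) : Ham n m →ₗ[ℂ] Ham n m :=
  ∑ z, (LinearMap.mulLeft ℂ (img ξ z)).comp (pd z)

theorem actHam_apply (ξ : Matrix (Coord n m) (Coord n m) ℂ) (f : Ham n m) :
    actHam ξ f = ∑ z, img ξ z * pd z f := by
  simp [actHam, LinearMap.sum_apply]

theorem actHam_mem (ξ : Matrix (Coord n m) (Coord n m) ℂ) {f : Ham n m}
    (hf : f ∈ ordGe n m 3) : actHam ξ f ∈ ordGe n m 3 := by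
  rw [actHam_apply]
  refine Submodule.sum_mem _ fun z _ => ?_
  refine ordGe_anti (j := 3) (k := 1 + (3 - 1)) (by norm_num)
    (mul_mem_ordGe (f := img ξ z) ?_ (pd_mem z hf))
  refine Submodule.sum_mem _ fun a _ => ?_
  exact Submodule.smul_mem _ _ (gen_mem_ordGe a)

theorem img_mem_homGe {δ : ZMod 2} {ξ : Matrix (Coord n m) (Coord n m) ℂ} (hξ : ξ ∈ osp n m δ)
    (z : Coord n m) : img ξ z ∈ homGe n m 1 (par z + δ) := by
  refine Submodule.sum_mem _ fun a _ => ?_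
  by_cases h : ξ a z = 0
  · rw [h, zero_smul]; exact Submodule.zero_mem _
  · rw [← hξ.1 a z h]
    exact Submodule.smul_mem _ _ (gen_mem_homGe a)

theorem actHam_homGe {δ : ZMod 2} {ξ : Matrix (Coord n m) (Coord n m) ℂ} (hξ : ξ ∈ osp n m δ)
    {k : ℕ} {ε : ZMod 2} {f : Ham n m} (hf : f ∈ homGe n m k ε) :
    actHam ξ f ∈ homGe n m k (ε + δ) := by
  rw [actHam_apply]
  refine Submodule.sum_mem _ fun z _ => ?_
  have h := mul_mem_homGe (img_mem_homGe hξ z) (pd_mem_homGe z hf)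
  rw [show par z + δ + (ε + par z) = ε + δ + (par z + par z) by ring,
    CharTwo.add_self_eq_zero, add_zero] at h
  exact homGe_anti (by omega) h

theorem actHam_gen (ξ : Matrix (Coord n m) (Coord n m) ℂ) (b : Coord n m) :
    actHam ξ (gen b) = img ξ b := by
  simp [actHam_apply, pd_gen]

theorem actHam_one (ξ : Matrix (Coord n m) (Coord n m) ℂ) : actHam ξ 1 = 0 := by
  simp [actHam_apply, pd_one]

/-- The action of the orthosymplectic Lie superalgebra obeys the super Leibniz rule. -/
theorem actHam_mul {δ : ZMod 2} {ξ : Matrix (Coord n m) (Coord n m) ℂ} (hξ : ξ ∈ osp n m δ)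
    {j k : ℕ} {ε η : ZMod 2} {f g : Ham n m} (hf : f ∈ homGe n m j ε) (hg : g ∈ homGe n m k η) :
    actHam ξ (f * g) = actHam ξ f * g + ksign (δ * ε) • (f * actHam ξ g) := by
  simp only [actHam_apply, Finset.sum_mul, Finset.mul_sum, Finset.smul_sum]
  rw [← Finset.sum_add_distrib]
  refine Finset.sum_congr rfl fun z _ => ?_
  rw [pd_mul hf z hg, mul_add, ← mul_assoc, mul_smul_comm, ← mul_assoc _ f, ← mul_assoc f,
    mul_comm_homGe (img_mem_homGe hξ z) hf, smul_mul_assoc, smul_smul, add_mul, ksign_add,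
    ← mul_assoc, ksign_mul_self, one_mul]

theorem poisson_act_gen {δ : ZMod 2} {ξ : Matrix (Coord n m) (Coord n m) ℂ} (hξ : ξ ∈ osp n m δ)
    (a b : Coord n m) : actHam ξ (poisson n m (gen a) (gen b)) =
      poisson n m (actHam ξ (gen a)) (gen b) +
        ksign (δ * par a) • poisson n m (gen a) (actHam ξ (gen b)) := by
  rw [poisson_gen, Algebra.algebraMap_eq_smul_one, map_smul, actHam_one, smul_zero, actHam_gen,
    actHam_gen]
  have h1 : poisson n m (img ξ a) (gen b) =
      algebraMap ℂ (Ham n m) (∑ c, ξ c a * form c b) := by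
    simp only [img, map_sum, map_smul, LinearMap.sum_apply, LinearMap.smul_apply, poisson_gen]
    simp only [Algebra.smul_def, map_mul]
  have h2 : poisson n m (gen a) (img ξ b) =
      algebraMap ℂ (Ham n m) (∑ c, ξ c b * form a c) := by
    simp only [img, map_sum, map_smul, poisson_gen]
    simp only [Algebra.smul_def, map_mul]
  rw [h1, h2, Algebra.smul_def, ← map_mul, ← map_add, hξ.2 a b, map_zero]

theorem poisson_act_of_gen {δ : ZMod 2} {ξ : Matrix (Coord n m) (Coord n m) ℂ}
    (hξ : ξ ∈ osp n m δ) {k : ℕ} {ε : ZMod 2} {f : Ham n m} (hf : f ∈ homGe n m k ε)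
    (h : ∀ b, actHam ξ (poisson n m f (gen b)) = poisson n m (actHam ξ f) (gen b) +
      ksign (δ * ε) • poisson n m f (actHam ξ (gen b))) (w : List (Coord n m)) :
    actHam ξ (poisson n m f (mono w)) = poisson n m (actHam ξ f) (mono w) +
      ksign (δ * ε) • poisson n m f (actHam ξ (mono w)) := by
  induction w with
  | nil => simp [mono, poisson_one, actHam_one]
  | cons b w ih =>
    have hb : gen b ∈ homGe n m 1 (par b) := gen_mem_homGe b
    have hw : mono w ∈ homGe n m 0 (wpar w) := mono_mem_homGe (Nat.zero_le _)
    have e1 := poisson_homGe hf hb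
    have e2 := poisson_homGe hf hw
    have e3 := actHam_homGe hξ hf
    have e4 := actHam_homGe hξ hb
    have e5 := actHam_homGe hξ hw
    rw [mono_cons, poisson_mul hf hb hw, map_add, map_smul, actHam_mul hξ e1 hw,
      actHam_mul hξ hb e2, poisson_mul e3 hb hw, actHam_mul hξ hb hw, map_add, map_smul,
      poisson_mul hf e4 hw, poisson_mul hf hb e5, h b, ih]
    generalize par b = β
    rcases zmod2_cases δ with rfl | rfl <;> rcases zmod2_cases ε with rfl | rfl <;>
      rcases zmod2_cases β with rfl | rfl <;>
      simp [ksign, zmod2_one_add_one, add_mul, mul_add] <;> abel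

theorem poisson_act_mono {δ : ZMod 2} {ξ : Matrix (Coord n m) (Coord n m) ℂ} (hξ : ξ ∈ osp n m δ)
    (u w : List (Coord n m)) :
    actHam ξ (poisson n m (mono u) (mono w)) = poisson n m (actHam ξ (mono u)) (mono w) +
      ksign (δ * wpar u) • poisson n m (mono u) (actHam ξ (mono w)) := by
  have hu : mono u ∈ homGe n m 0 (wpar u) := mono_mem_homGe (Nat.zero_le _)
  refine poisson_act_of_gen hξ hu (fun b => ?_) w
  have hb : gen b ∈ homGe n m 1 (par b) := gen_mem_homGe b
  have key := poisson_act_of_gen hξ hb (fun c => poisson_act_gen hξ b c) u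
  rw [poisson_swap hu hb, poisson_swap (actHam_homGe hξ hu) hb,
    poisson_swap hu (actHam_homGe hξ hb), map_neg, map_smul, key]
  generalize wpar u = ε
  generalize par b = β
  rcases zmod2_cases δ with rfl | rfl <;> rcases zmod2_cases ε with rfl | rfl <;>
    rcases zmod2_cases β with rfl | rfl <;>
    simp [ksign, zmod2_one_add_one, add_comm]

/-- The Poisson bracket is invariant under the orthosymplectic Lie superalgebra. -/
theorem poisson_act {δ : ZMod 2} {ξ : Matrix (Coord n m) (Coord n m) ℂ} (hξ : ξ ∈ osp n m δ)
    {j k : ℕ} {ε η : ZMod 2} {f g : Ham n m} (hf : f ∈ homGe n m j ε) (hg : g ∈ homGe n m k η) :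
    actHam ξ (poisson n m f g) = poisson n m (actHam ξ f) g +
      ksign (δ * ε) • poisson n m f (actHam ξ g) := by
  refine homGe_induction (S := LinearMap.eqLocus
    ((actHam ξ).comp ((poisson n m).flip g)) (((poisson n m).flip g).comp (actHam ξ) +
      ksign (δ * ε) • (poisson n m).flip (actHam ξ g))) ?_ hf
  rintro u - rfl
  refine homGe_induction (S := LinearMap.eqLocus
    ((actHam ξ).comp (poisson n m (mono u))) ((poisson n m (actHam ξ (mono u))) +
      ksign (δ * wpar u) • ((poisson n m (mono u)).comp (actHam ξ)))) ?_ hg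
  rintro w - -
  exact poisson_act_mono hξ u w

/-! ### The Lie superalgebra of Hamiltonians of cubic order or higher -/

/-- The Lie superalgebra of Hamiltonians whose terms have cubic order or higher. -/
abbrev tg (n m : ℕ) := ↥(ordGe n m 3)

/-- The Poisson bracket on `tg`. -/
def tgBracket (n m : ℕ) : tg n m →ₗ[ℂ] tg n m →ₗ[ℂ] tg n m :=
  LinearMap.mk₂ ℂ (fun f g => ⟨poisson n m f g, poisson_mem f.2 g.2⟩)
    (fun _ _ _ => Subtype.ext (by simp)) (fun _ _ _ => Subtype.ext (by simp))
    (fun _ _ _ => Subtype.ext (by simp)) (fun _ _ _ => Subtype.ext (by simp))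

/-- The action of an endomorphism on `tg`. -/
def actTg (ξ : Matrix (Coord n m) (Coord n m) ℂ) : tg n m →ₗ[ℂ] tg n m :=
  (actHam ξ).restrict fun _ hf => actHam_mem ξ hf

/-- The part of `tg` of parity `ε`. -/
def tgPart (n m : ℕ) (ε : ZMod 2) : Submodule ℂ (tg n m) :=
  (homGe n m 3 ε).comap (ordGe n m 3).subtype

/-- The parity involution of `tg`. -/
def tgInv (n m : ℕ) : tg n m →ₗ[ℂ] tg n m :=
  (parityInv n m).toLinearMap.restrict fun _ hf => parityInv_mem hf

/-- Words of length at least three in the coordinates. -/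
abbrev Word (n m : ℕ) := {w : List (Coord n m) // 3 ≤ w.length}

/-- The monomial of a word of length at least three, as an element of `tg`. -/
def monoTg (w : Word n m) : tg n m := ⟨mono w.1, Submodule.subset_span ⟨w.1, w.2, rfl⟩⟩

theorem tgPart_sup : tgPart n m 0 ⊔ tgPart n m 1 = ⊤ := by
  have key : ordGe n m 3 ≤ (tgPart n m 0 ⊔ tgPart n m 1).map (ordGe n m 3).subtype := by
    refine Submodule.span_le.2 ?_
    rintro _ ⟨w, hw, rfl⟩
    refine ⟨monoTg ⟨w, hw⟩, ?_, rfl⟩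
    have h : monoTg ⟨w, hw⟩ ∈ tgPart n m (wpar w) := mono_mem_homGe hw
    rcases zmod2_cases (wpar w) with h' | h' <;> rw [h'] at h
    · exact Submodule.mem_sup_left h
    · exact Submodule.mem_sup_right h
  refine eq_top_iff.2 fun f _ => ?_
  obtain ⟨g, hg, hgf⟩ := key f.2
  exact (Subtype.ext hgf : g = f) ▸ hg

theorem tgInv_apply {ε : ZMod 2} {f : tg n m} (hf : f ∈ tgPart n m ε) :
    tgInv n m f = ksign ε • f :=
  Subtype.ext (parityInv_homGe hf)

theorem tgBracket_mem {ε η : ZMod 2} {f g : tg n m} (hf : f ∈ tgPart n m ε)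
    (hg : g ∈ tgPart n m η) : tgBracket n m f g ∈ tgPart n m (ε + η) :=
  homGe_anti (by norm_num) (poisson_homGe hf hg)

theorem tgBracket_swap {ε η : ZMod 2} {f g : tg n m} (hf : f ∈ tgPart n m ε)
    (hg : g ∈ tgPart n m η) :
    tgBracket n m f g = -(ksign (ε * η) • tgBracket n m g f) :=
  Subtype.ext (poisson_swap hf hg)

theorem actTg_mem {δ : ZMod 2} {ξ : Matrix (Coord n m) (Coord n m) ℂ} (hξ : ξ ∈ osp n m δ)
    {ε : ZMod 2} {f : tg n m} (hf : f ∈ tgPart n m ε) : actTg ξ f ∈ tgPart n m (ε + δ) :=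
  actHam_homGe hξ hf

theorem tgBracket_act {δ : ZMod 2} {ξ : Matrix (Coord n m) (Coord n m) ℂ} (hξ : ξ ∈ osp n m δ)
    {ε η : ZMod 2} {f g : tg n m} (hf : f ∈ tgPart n m ε) (hg : g ∈ tgPart n m η) :
    actTg ξ (tgBracket n m f g) = tgBracket n m (actTg ξ f) g +
      ksign (δ * ε) • tgBracket n m f (actTg ξ g) :=
  Subtype.ext (poisson_act hξ hf hg)

/-! ### The Chevalley–Eilenberg complex -/

section CE

variable {g : Type*} [AddCommGroup g] [Module ℂ g]

/-- The relations `a ⊗ b = -(-1)^{|a||b|} b ⊗ a` of the exterior superalgebra of a superspace `g`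
with homogeneous parts `G 0` and `G 1`. -/
inductive ExtRel (G : ZMod 2 → Submodule ℂ g) : TensorAlgebra ℂ g → TensorAlgebra ℂ g → Prop
  | swap (i j : ZMod 2) (a b : g) (ha : a ∈ G i) (hb : b ∈ G j) :
      ExtRel G (TensorAlgebra.ι ℂ a * TensorAlgebra.ι ℂ b)
        (-(ksign (i * j) • (TensorAlgebra.ι ℂ b * TensorAlgebra.ι ℂ a)))

/-- The exterior superalgebra `Λ(g)`. -/
def SuperExt (G : ZMod 2 → Submodule ℂ g) : Type _ := RingQuot (ExtRel G)

instance (G : ZMod 2 → Submodule ℂ g) : Ring (SuperExt G) :=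
  inferInstanceAs (Ring (RingQuot (ExtRel G)))

instance (G : ZMod 2 → Submodule ℂ g) : Algebra ℂ (SuperExt G) :=
  inferInstanceAs (Algebra ℂ (RingQuot (ExtRel G)))

namespace SuperExt

/-- The quotient map from the tensor algebra. -/
def mk (G : ZMod 2 → Submodule ℂ g) : TensorAlgebra ℂ g →ₐ[ℂ] SuperExt G :=
  RingQuot.mkAlgHom ℂ (ExtRel G)

/-- The inclusion of `g` into `Λ(g)`. -/
def ι (G : ZMod 2 → Submodule ℂ g) : g →ₗ[ℂ] SuperExt G :=
  (mk G).toLinearMap.comp (TensorAlgebra.ι ℂ)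

variable {G : ZMod 2 → Submodule ℂ g}

theorem mk_surjective : Function.Surjective (mk G) := RingQuot.mkAlgHom_surjective ℂ (ExtRel G)

theorem mk_ι (a : g) : mk G (TensorAlgebra.ι ℂ a) = ι G a := rfl

theorem ι_swap {i j : ZMod 2} {a b : g} (ha : a ∈ G i) (hb : b ∈ G j) :
    ι G a * ι G b = -(ksign (i * j) • (ι G b * ι G a)) := by
  have h : mk G _ = mk G _ := RingQuot.mkAlgHom_rel ℂ (ExtRel.swap i j a b ha hb)
  simpa only [map_mul, map_neg, map_smul, mk_ι] using h

/-- The universal property of `Λ(g)`. -/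
def lift {A : Type*} [Ring A] [Algebra ℂ A] (f : g →ₗ[ℂ] A)
    (hf : ∀ i j a b, a ∈ G i → b ∈ G j → f a * f b = -(ksign (i * j) • (f b * f a))) :
    SuperExt G →ₐ[ℂ] A :=
  RingQuot.liftAlgHom ℂ ⟨TensorAlgebra.lift ℂ f, by
    rintro _ _ ⟨i, j, a, b, ha, hb⟩
    simpa only [map_mul, map_neg, map_smul, TensorAlgebra.lift_ι_apply] using hf i j a b ha hb⟩

theorem lift_ι {A : Type*} [Ring A] [Algebra ℂ A] (f : g →ₗ[ℂ] A)
    (hf : ∀ i j a b, a ∈ G i → b ∈ G j → f a * f b = -(ksign (i * j) • (f b * f a))) (a : g) :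
    lift f hf (ι G a) = f a := by
  have h : lift f hf (mk G (TensorAlgebra.ι ℂ a)) = TensorAlgebra.lift ℂ f (TensorAlgebra.ι ℂ a) :=
    RingQuot.liftAlgHom_mkAlgHom_apply ℂ _ _ _
  rwa [TensorAlgebra.lift_ι_apply, mk_ι] at h

theorem induction (hG : G 0 ⊔ G 1 = ⊤) {S : Submodule ℂ (SuperExt G)} (h1 : 1 ∈ S)
    (hS : ∀ i, ∀ a ∈ G i, ∀ w ∈ S, ι G a * w ∈ S) (w : SuperExt G) : w ∈ S := by
  obtain ⟨t, rfl⟩ := mk_surjective w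
  suffices h : ∀ w ∈ S, mk G t * w ∈ S by simpa using h 1 h1
  induction t using TensorAlgebra.induction with
  | algebraMap r =>
    intro w hw
    rw [AlgHom.commutes, ← Algebra.smul_def]
    exact S.smul_mem r hw
  | ι a =>
    intro w hw
    obtain ⟨b, hb, c, hc, rfl⟩ := Submodule.mem_sup.1 (hG ▸ Submodule.mem_top : a ∈ G 0 ⊔ G 1)
    rw [mk_ι, map_add, add_mul]
    exact S.add_mem (hS 0 b hb w hw) (hS 1 c hc w hw)
  | mul a b ha hb =>
    intro w hw
    rw [map_mul, mul_assoc]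
    exact ha _ (hb _ hw)
  | add a b ha hb =>
    intro w hw
    rw [map_add, add_mul]
    exact S.add_mem (ha w hw) (hb w hw)

end SuperExt

open SuperExt

/-- The wedge product `a_1 ∧ ⋯ ∧ a_p` of a list of elements of `g`. -/
def wedge (G : ZMod 2 → Submodule ℂ g) (l : List g) : SuperExt G := (l.map (ι G)).prod

/-- The Chevalley–Eilenberg boundary of `a_1 ∧ ⋯ ∧ a_p`, where `a_r` has parity `ε r`. Indices
start at `0` here, so that the summand `i + j - 1` of the sign exponent becomes `i + j + 1`. -/
def ceBoundary (G : ZMod 2 → Submodule ℂ g) (br : g →ₗ[ℂ] g →ₗ[ℂ] g) {p : ℕ}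
    (a : Fin p → g) (ε : Fin p → ZMod 2) : SuperExt G :=
  ∑ i, ∑ j ∈ Finset.Ioi i,
    ksign (ε i * ∑ r ∈ Finset.Iio i, ε r + ε j * ∑ r ∈ Finset.Iio j, ε r + ε i * ε j
        + ((i.val + j.val + 1 : ℕ) : ZMod 2)) •
      wedge G (br (a i) (a j) ::
        ((List.finRange p).filter fun r => r ≠ i ∧ r ≠ j).map a)

/-- The Leibniz action of an endomorphism `D` of parity `δ` on `a_1 ∧ ⋯ ∧ a_p`, where `a_r` has
parity `ε r`. -/
def leibniz (G : ZMod 2 → Submodule ℂ g) (δ : ZMod 2) (D : g →ₗ[ℂ] g) {p : ℕ}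
    (a : Fin p → g) (ε : Fin p → ZMod 2) : SuperExt G :=
  ∑ r, ksign (δ * ∑ s ∈ Finset.Iio r, ε s) •
    wedge G (List.ofFn (Function.update a r (D (a r))))

/-- The superspace `g` with parity involution `inv` and bracket `br`: what is used to extend the
bracket to the Chevalley–Eilenberg differential. -/
structure SuperBracket (G : ZMod 2 → Submodule ℂ g) (inv : g →ₗ[ℂ] g)
    (br : g →ₗ[ℂ] g →ₗ[ℂ] g) : Prop where
  sup : G 0 ⊔ G 1 = ⊤
  inv_apply : ∀ i, ∀ a ∈ G i, inv a = ksign i • a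
  mem : ∀ i j, ∀ a ∈ G i, ∀ b ∈ G j, br a b ∈ G (i + j)
  swap : ∀ i j, ∀ a ∈ G i, ∀ b ∈ G j, br a b = -(ksign (i * j) • br b a)

namespace SuperBracket

variable {G : ZMod 2 → Submodule ℂ g} {inv : g →ₗ[ℂ] g} {br : g →ₗ[ℂ] g →ₗ[ℂ] g}

/-- The power of the parity involution by which a map of parity `δ` moves past an element. -/
def tw (inv : g →ₗ[ℂ] g) (δ : ZMod 2) : g →ₗ[ℂ] g := if δ = 0 then LinearMap.id else inv

theorem tw_apply (H : SuperBracket G inv br) (δ : ZMod 2) {i : ZMod 2} {a : g} (ha : a ∈ G i) :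
    tw inv δ a = ksign (δ * i) • a := by
  rcases zmod2_cases δ with rfl | rfl
  · simp [tw, ksign_zero]
  · simp [tw, H.inv_apply i a ha]

/-- Left multiplication on pairs, whose iteration computes the derivation extending `D`. -/
def derOp (G : ZMod 2 → Submodule ℂ g) (inv : g →ₗ[ℂ] g) (δ : ZMod 2) (D : g →ₗ[ℂ] g) :
    g →ₗ[ℂ] Module.End ℂ (SuperExt G × SuperExt G) where
  toFun a := LinearMap.prod
    ((LinearMap.mulLeft ℂ (ι G a)).comp (LinearMap.fst ℂ _ _))
    ((LinearMap.mulLeft ℂ (ι G (D a))).comp (LinearMap.fst ℂ _ _) +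
      (LinearMap.mulLeft ℂ (ι G (tw inv δ a))).comp (LinearMap.snd ℂ _ _))
  map_add' a b := by
    ext x <;> simp [add_mul]
  map_smul' c a := by
    ext x <;> simp

theorem derOp_apply (δ : ZMod 2) (D : g →ₗ[ℂ] g) (a : g) (x : SuperExt G × SuperExt G) :
    derOp G inv δ D a x = (ι G a * x.1, ι G (D a) * x.1 + ι G (tw inv δ a) * x.2) := rfl

theorem derOp_rel (H : SuperBracket G inv br) {δ : ZMod 2} {D : g →ₗ[ℂ] g}
    (hD : ∀ i, ∀ a ∈ G i, D a ∈ G (i + δ)) (i j : ZMod 2) (a b : g) (ha : a ∈ G i) (hb : b ∈ G j) :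
    derOp G inv δ D a * derOp G inv δ D b =
      -(ksign (i * j) • (derOp G inv δ D b * derOp G inv δ D a)) := by
  refine LinearMap.ext fun x => ?_
  have e1 := ι_swap (G := G) ha hb
  have e2 := ι_swap (G := G) (hD i a ha) hb
  have e3 := ι_swap (G := G) ha (hD j b hb)
  simp only [Module.End.mul_apply, LinearMap.neg_apply, LinearMap.smul_apply, derOp_apply,
    H.tw_apply δ ha, H.tw_apply δ hb, map_smul, smul_mul_assoc, mul_add, mul_smul_comm,
    ← mul_assoc, e1, e2, e3]
  refine Prod.ext ?_ ?_
  · simp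
  · rcases zmod2_cases δ with rfl | rfl <;> rcases zmod2_cases i with rfl | rfl <;>
      rcases zmod2_cases j with rfl | rfl <;>
      simp [ksign, zmod2_one_add_one] <;> abel

theorem wedge_cons (a : g) (l : List g) : wedge G (a :: l) = ι G a * wedge G l := by
  simp [wedge]

/-- The super derivation of `Λ(g)` which extends a map `D` of parity `δ`. -/
def der (H : SuperBracket G inv br) (δ : ZMod 2) (D : g →ₗ[ℂ] g)
    (hD : ∀ i, ∀ a ∈ G i, D a ∈ G (i + δ)) : SuperExt G →ₗ[ℂ] SuperExt G :=
  (LinearMap.snd ℂ _ _).comp ((LinearMap.applyₗ ((1, 0) : SuperExt G × SuperExt G)).comp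
    (SuperExt.lift (derOp G inv δ D) (H.derOp_rel hD)).toLinearMap)

section der

variable (H : SuperBracket G inv br) {δ : ZMod 2} {D : g →ₗ[ℂ] g}
  (hD : ∀ i, ∀ a ∈ G i, D a ∈ G (i + δ))

theorem derOp_fst (w : SuperExt G) :
    (SuperExt.lift (derOp G inv δ D) (H.derOp_rel hD) w (1, 0)).1 = w := by
  refine SuperExt.induction H.sup (S := LinearMap.eqLocus ((LinearMap.fst ℂ _ _).comp
    ((LinearMap.applyₗ ((1, 0) : SuperExt G × SuperExt G)).comp
    (SuperExt.lift (derOp G inv δ D) (H.derOp_rel hD)).toLinearMap)) LinearMap.id) ?_ ?_ w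
  · simp
  · intro i a _ w hw
    have hw' : (SuperExt.lift (derOp G inv δ D) (H.derOp_rel hD) w (1, 0)).1 = w := hw
    change (SuperExt.lift (derOp G inv δ D) (H.derOp_rel hD) (ι G a * w) (1, 0)).1 = ι G a * w
    rw [map_mul, SuperExt.lift_ι, Module.End.mul_apply, derOp_apply, hw']

theorem der_one : H.der δ D hD 1 = 0 := by
  simp [der]

theorem der_ι_mul {i : ZMod 2} {a : g} (ha : a ∈ G i) (w : SuperExt G) :
    H.der δ D hD (ι G a * w) = ι G (D a) * w + ksign (δ * i) • (ι G a * H.der δ D hD w) := by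
  change (SuperExt.lift (derOp G inv δ D) (H.derOp_rel hD) (ι G a * w) (1, 0)).2 = _
  rw [map_mul, SuperExt.lift_ι, Module.End.mul_apply, derOp_apply, H.derOp_fst hD,
    H.tw_apply δ ha, map_smul, smul_mul_assoc]
  rfl

end der

theorem der_comb (H : SuperBracket G inv br) {δ : ZMod 2} {D E F : g →ₗ[ℂ] g}
    (hD : ∀ i, ∀ a ∈ G i, D a ∈ G (i + δ)) (hE : ∀ i, ∀ a ∈ G i, E a ∈ G (i + δ))
    (hF : ∀ i, ∀ a ∈ G i, F a ∈ G (i + δ)) (c : ℂ) (h : F = c • D + E) :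
    H.der δ F hF = c • H.der δ D hD + H.der δ E hE := by
  refine LinearMap.ext fun w => ?_
  refine SuperExt.induction H.sup (S := LinearMap.eqLocus (H.der δ F hF)
    (c • H.der δ D hD + H.der δ E hE)) ?_ ?_ w
  · simp [der_one]
  · intro i a ha w hw
    have hw' : H.der δ F hF w = c • H.der δ D hD w + H.der δ E hE w := hw
    change H.der δ F hF (ι G a * w) = c • H.der δ D hD (ι G a * w) + H.der δ E hE (ι G a * w)
    rw [H.der_ι_mul hF ha, H.der_ι_mul hD ha, H.der_ι_mul hE ha, hw', h]
    simp only [LinearMap.add_apply, LinearMap.smul_apply, map_add, map_smul, add_mul, mul_add,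
      smul_mul_assoc, mul_smul_comm, smul_add, smul_comm c]
    abel

/-- The projection to the part of parity `i`. -/
def proj (inv : g →ₗ[ℂ] g) (i : ZMod 2) : g →ₗ[ℂ] g :=
  (2⁻¹ : ℂ) • (LinearMap.id + ksign i • inv)

theorem proj_of_mem (H : SuperBracket G inv br) (i j : ZMod 2) {a : g} (ha : a ∈ G i) :
    proj inv j a = if i = j then a else 0 := by
  simp only [proj, LinearMap.smul_apply, LinearMap.add_apply, LinearMap.id_apply,
    H.inv_apply i a ha, smul_smul]
  have h2 : (2⁻¹ : ℂ) • (a + a) = a := by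
    rw [← two_smul ℂ a, smul_smul]; norm_num
  rcases zmod2_cases i with rfl | rfl <;> rcases zmod2_cases j with rfl | rfl <;>
    simp [ksign, h2]

theorem proj_mem (H : SuperBracket G inv br) (j : ZMod 2) (a : g) : proj inv j a ∈ G j := by
  obtain ⟨b, hb, c, hc, rfl⟩ := Submodule.mem_sup.1 (H.sup ▸ Submodule.mem_top : a ∈ G 0 ⊔ G 1)
  rw [map_add, H.proj_of_mem 0 j hb, H.proj_of_mem 1 j hc]
  rcases zmod2_cases j with rfl | rfl <;> simp [hb, hc]

theorem br_mem (H : SuperBracket G inv br) {i : ZMod 2} {a : g} (ha : a ∈ G i) :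
    ∀ j, ∀ b ∈ G j, br a b ∈ G (j + i) :=
  fun j b hb => add_comm i j ▸ H.mem i j a ha b hb

/-- The action of `g` on `Λ(g)` through the bracket. -/
def ad (H : SuperBracket G inv br) : g →ₗ[ℂ] Module.End ℂ (SuperExt G) where
  toFun a := H.der 0 (br (proj inv 0 a)) (H.br_mem (H.proj_mem 0 a)) +
    H.der 1 (br (proj inv 1 a)) (H.br_mem (H.proj_mem 1 a))
  map_add' a b := by
    rw [H.der_comb (H.br_mem (H.proj_mem 0 a)) (H.br_mem (H.proj_mem 0 b)) _ 1 (by simp),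
      H.der_comb (H.br_mem (H.proj_mem 1 a)) (H.br_mem (H.proj_mem 1 b)) _ 1 (by simp),
      one_smul, one_smul]
    abel
  map_smul' c a := by
    have h0 : ∀ δ i, ∀ x ∈ G i, (0 : g →ₗ[ℂ] g) x ∈ G (i + δ) := fun δ i x _ => by simp
    have hz : ∀ δ, H.der δ 0 (h0 δ) = 0 := fun δ => by
      have := H.der_comb (h0 δ) (h0 δ) (h0 δ) 1 (by simp)
      simpa using this
    rw [H.der_comb (H.br_mem (H.proj_mem 0 a)) (h0 0) _ c (by simp),
      H.der_comb (H.br_mem (H.proj_mem 1 a)) (h0 1) _ c (by simp), hz, hz]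
    simp

theorem ad_eq (H : SuperBracket G inv br) {i : ZMod 2} {a : g} (ha : a ∈ G i) :
    H.ad a = H.der i (br a) (H.br_mem ha) := by
  have hz : ∀ (δ : ZMod 2) (x : g) (hx : ∀ i, ∀ b ∈ G i, br x b ∈ G (i + δ)), x = 0 →
      H.der δ (br x) hx = 0 := fun δ x hx h => by
    have := H.der_comb hx hx hx 1 (by simp [h])
    simpa using this
  have he : ∀ (x : g) (hx : ∀ j, ∀ b ∈ G j, br x b ∈ G (j + i)), x = a →
      H.der i (br x) hx = H.der i (br a) (H.br_mem ha) := by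
    rintro x hx rfl; rfl
  change H.der 0 (br (proj inv 0 a)) _ + H.der 1 (br (proj inv 1 a)) _ = _
  rcases zmod2_cases i with rfl | rfl
  · rw [hz 1 _ _ (by simp [H.proj_of_mem 0 1 ha]), he _ _ (by simp [H.proj_of_mem 0 0 ha]),
      add_zero]
  · rw [hz 0 _ _ (by simp [H.proj_of_mem 1 0 ha]), he _ _ (by simp [H.proj_of_mem 1 1 ha]),
      zero_add]

theorem ad_one (H : SuperBracket G inv br) (a : g) : H.ad a 1 = 0 := by
  change H.der 0 _ _ 1 + H.der 1 _ _ 1 = 0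
  rw [der_one, der_one, add_zero]

theorem ad_ι_mul (H : SuperBracket G inv br) {i j : ZMod 2} {a b : g} (ha : a ∈ G i)
    (hb : b ∈ G j) (w : SuperExt G) :
    H.ad a (ι G b * w) = ι G (br a b) * w + ksign (i * j) • (ι G b * H.ad a w) := by
  rw [H.ad_eq ha, H.der_ι_mul _ hb]

/-- Left multiplication on pairs, whose iteration computes the Chevalley–Eilenberg differential. -/
def ceOp (H : SuperBracket G inv br) : g →ₗ[ℂ] Module.End ℂ (SuperExt G × SuperExt G) where
  toFun a := LinearMap.prod
    ((LinearMap.mulLeft ℂ (ι G a)).comp (LinearMap.fst ℂ _ _))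
    ((H.ad a).comp (LinearMap.fst ℂ _ _) -
      (LinearMap.mulLeft ℂ (ι G a)).comp (LinearMap.snd ℂ _ _))
  map_add' a b := by
    ext x <;> (simp [add_mul]; try abel)
  map_smul' c a := by
    ext x <;> simp

theorem ceOp_apply (H : SuperBracket G inv br) (a : g) (x : SuperExt G × SuperExt G) :
    H.ceOp a x = (ι G a * x.1, H.ad a x.1 - ι G a * x.2) := rfl

theorem ceOp_rel (H : SuperBracket G inv br) (i j : ZMod 2) (a b : g) (ha : a ∈ G i)
    (hb : b ∈ G j) : H.ceOp a * H.ceOp b = -(ksign (i * j) • (H.ceOp b * H.ceOp a)) := by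
  refine LinearMap.ext fun x => ?_
  have e1 := ι_swap (G := G) ha hb
  simp only [Module.End.mul_apply, LinearMap.neg_apply, LinearMap.smul_apply, ceOp_apply,
    H.ad_ι_mul ha hb, H.ad_ι_mul hb ha, mul_sub, ← mul_assoc, e1, H.swap i j a ha b hb]
  refine Prod.ext ?_ ?_
  · simp
  · rcases zmod2_cases i with rfl | rfl <;> rcases zmod2_cases j with rfl | rfl <;>
      (simp [ksign]; abel)

/-- The Chevalley–Eilenberg differential. -/
def ce (H : SuperBracket G inv br) : SuperExt G →ₗ[ℂ] SuperExt G :=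
  (LinearMap.snd ℂ _ _).comp ((LinearMap.applyₗ ((1, 0) : SuperExt G × SuperExt G)).comp
    (SuperExt.lift H.ceOp H.ceOp_rel).toLinearMap)

theorem ceOp_fst (H : SuperBracket G inv br) (w : SuperExt G) :
    (SuperExt.lift H.ceOp H.ceOp_rel w (1, 0)).1 = w := by
  refine SuperExt.induction H.sup (S := LinearMap.eqLocus ((LinearMap.fst ℂ _ _).comp
    ((LinearMap.applyₗ ((1, 0) : SuperExt G × SuperExt G)).comp
    (SuperExt.lift H.ceOp H.ceOp_rel).toLinearMap)) LinearMap.id) ?_ ?_ w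
  · simp
  · intro i a _ w hw
    have hw' : (SuperExt.lift H.ceOp H.ceOp_rel w (1, 0)).1 = w := hw
    change (SuperExt.lift H.ceOp H.ceOp_rel (ι G a * w) (1, 0)).1 = ι G a * w
    rw [map_mul, SuperExt.lift_ι, Module.End.mul_apply, ceOp_apply, hw']

theorem ce_one (H : SuperBracket G inv br) : H.ce 1 = 0 := by
  simp [ce]

theorem ce_ι_mul (H : SuperBracket G inv br) (a : g) (w : SuperExt G) :
    H.ce (ι G a * w) = H.ad a w - ι G a * H.ce w := by
  change (SuperExt.lift H.ceOp H.ceOp_rel (ι G a * w) (1, 0)).2 = _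
  rw [map_mul, SuperExt.lift_ι, Module.End.mul_apply, ceOp_apply, H.ceOp_fst]
  rfl

theorem sum_Iio_succ {M : Type*} [AddCommMonoid M] {p : ℕ} (f : Fin (p + 1) → M) (r : Fin p) :
    ∑ s ∈ Finset.Iio r.succ, f s = f 0 + ∑ s ∈ Finset.Iio r, f s.succ := by
  have h : ∀ {q : ℕ} (f : Fin q → M) (r : Fin q),
      ∑ s ∈ Finset.Iio r, f s = ∑ s, if s < r then f s else 0 := fun f r => by
    rw [← Finset.sum_filter]; congr 1; ext; simp
  rw [h, h, Fin.sum_univ_succ]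
  simp [Fin.succ_lt_succ_iff]

theorem sum_Ioi_succ {M : Type*} [AddCommMonoid M] {p : ℕ} (f : Fin (p + 1) → M) (r : Fin p) :
    ∑ s ∈ Finset.Ioi r.succ, f s = ∑ s ∈ Finset.Ioi r, f s.succ := by
  have h : ∀ {q : ℕ} (f : Fin q → M) (r : Fin q),
      ∑ s ∈ Finset.Ioi r, f s = ∑ s, if r < s then f s else 0 := fun f r => by
    rw [← Finset.sum_filter]; congr 1; ext; simp
  rw [h, h, Fin.sum_univ_succ]
  simp [Fin.succ_lt_succ_iff]

theorem sum_Ioi_zero {M : Type*} [AddCommMonoid M] {p : ℕ} (f : Fin (p + 1) → M) :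
    ∑ s ∈ Finset.Ioi (0 : Fin (p + 1)), f s = ∑ s : Fin p, f s.succ := by
  have h : ∀ {q : ℕ} (f : Fin q → M) (r : Fin q),
      ∑ s ∈ Finset.Ioi r, f s = ∑ s, if r < s then f s else 0 := fun f r => by
    rw [← Finset.sum_filter]; congr 1; ext; simp
  rw [h, Fin.sum_univ_succ]
  simp

theorem sum_Iio_zero {M : Type*} [AddCommMonoid M] {p : ℕ} (f : Fin (p + 1) → M) :
    ∑ s ∈ Finset.Iio (0 : Fin (p + 1)), f s = 0 := by
  refine Finset.sum_eq_zero fun s hs => ?_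
  simp at hs

theorem ofFn_update_zero {p : ℕ} (a : Fin (p + 1) → g) (b : g) :
    List.ofFn (Function.update a 0 b) = b :: List.ofFn fun s => a s.succ := by
  rw [List.ofFn_succ, Function.update_self]
  congr 2

theorem ofFn_update_succ {p : ℕ} (a : Fin (p + 1) → g) (r : Fin p) (b : g) :
    List.ofFn (Function.update a r.succ b) =
      a 0 :: List.ofFn (Function.update (fun s => a s.succ) r b) := by
  rw [List.ofFn_succ, Function.update_of_ne (Fin.succ_ne_zero r).symm]
  congr 2
  funext s
  by_cases h : s = r
  · subst h; simp
  · rw [Function.update_of_ne h, Function.update_of_ne (fun h' => h (Fin.succ_injective _ h'))]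

theorem der_wedge (H : SuperBracket G inv br) {δ : ZMod 2} {D : g →ₗ[ℂ] g}
    (hD : ∀ i, ∀ a ∈ G i, D a ∈ G (i + δ)) : ∀ {p : ℕ} (a : Fin p → g) (ε : Fin p → ZMod 2),
    (∀ r, a r ∈ G (ε r)) → H.der δ D hD (wedge G (List.ofFn a)) = leibniz G δ D a ε
  | 0, a, ε, _ => by simp [leibniz, wedge, der_one]
  | p + 1, a, ε, ha => by
    rw [List.ofFn_succ, wedge_cons, H.der_ι_mul hD (ha 0),
      H.der_wedge hD (fun s => a s.succ) (fun s => ε s.succ) (fun r => ha r.succ), leibniz, leibniz,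
      Fin.sum_univ_succ, sum_Iio_zero, mul_zero, ksign_zero, one_smul, ofFn_update_zero, wedge_cons,
      Finset.mul_sum, Finset.smul_sum]
    congr 1
    refine Finset.sum_congr rfl fun r _ => ?_
    rw [ofFn_update_succ, wedge_cons, sum_Iio_succ, mul_add, ksign_add, mul_smul_comm, smul_smul]

theorem wedge_move : ∀ {p : ℕ} (a : Fin p → g) (ε : Fin p → ZMod 2) (_ : ∀ r, a r ∈ G (ε r))
    (r : Fin p) {η : ZMod 2} {b : g} (_ : b ∈ G η),
    wedge G (List.ofFn (Function.update a r b)) =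
      ksign (η * ∑ s ∈ Finset.Iio r, ε s + (r.val : ZMod 2)) •
        wedge G (b :: ((List.finRange p).filter fun s => s ≠ r).map a)
  | 0, _, _, _, r, _, _, _ => r.elim0
  | p + 1, a, ε, ha, r, η, b, hb => by
    induction r using Fin.cases with
    | zero =>
      rw [ofFn_update_zero, sum_Iio_zero, List.finRange_succ]
      simp [ksign_zero, List.filter_map, Function.comp_def, List.ofFn_eq_map]
    | succ r =>
      rw [ofFn_update_succ, wedge_cons, wedge_move (fun s => a s.succ) (fun s => ε s.succ)
        (fun r => ha r.succ) r hb, wedge_cons, mul_smul_comm, ← mul_assoc, ι_swap (ha 0) hb,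
        sum_Iio_succ, List.finRange_succ]
      have hl : ((0 :: (List.finRange p).map Fin.succ).filter fun s => s ≠ r.succ).map a =
          a 0 :: ((List.finRange p).filter fun s => s ≠ r).map fun s => a s.succ := by
        rw [List.filter_cons_of_pos (by simpa using (Fin.succ_ne_zero r).symm)]
        simp [List.filter_map, Function.comp_def]
      rw [hl, wedge_cons, wedge_cons, neg_mul, smul_mul_assoc, smul_neg, smul_smul, mul_assoc,
        ← neg_smul]
      congr 1
      rw [Fin.val_succ, Nat.cast_add, Nat.cast_one, mul_add, ksign_add, ksign_add, ksign_add,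
        ksign_add, ksign_one, mul_comm (ε 0)]
      ring

/-- The explicit formula for the Chevalley–Eilenberg differential. -/
theorem ce_wedge (H : SuperBracket G inv br) : ∀ {p : ℕ} (a : Fin p → g) (ε : Fin p → ZMod 2),
    (∀ r, a r ∈ G (ε r)) → H.ce (wedge G (List.ofFn a)) = ceBoundary G br a ε
  | 0, a, ε, _ => by simp [ceBoundary, wedge, ce_one]
  | p + 1, a, ε, ha => by
    have ih := H.ce_wedge (fun s => a s.succ) (fun s => ε s.succ) (fun r => ha r.succ)
    rw [List.ofFn_succ, wedge_cons, H.ce_ι_mul, ih, H.ad_eq (ha 0),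
      H.der_wedge _ _ (fun s => ε s.succ) (fun r => ha r.succ), ceBoundary, ceBoundary,
      Fin.sum_univ_succ, sum_Ioi_zero, leibniz, sub_eq_add_neg]
    congr 1
    · refine Finset.sum_congr rfl fun j _ => ?_
      rw [wedge_move _ (fun s => ε s.succ) (fun r => ha r.succ) j
        (H.mem _ _ _ (ha 0) _ (ha j.succ)), smul_smul, sum_Iio_succ, sum_Iio_zero,
        List.finRange_succ]
      congr 1
      · rw [← ksign_add]
        congr 1
        simp only [Fin.val_zero, Fin.val_succ, Nat.cast_add, Nat.cast_one, Nat.cast_zero]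
        linear_combination (ε 0 * ∑ s ∈ Finset.Iio j, ε s.succ - ε j.succ * ε 0 - 1) *
          zmod2_one_add_one
      · congr 2
        rw [List.filter_cons_of_neg (by simp)]
        simp [List.filter_map, Function.comp_def]
    · rw [Finset.mul_sum, ← Finset.sum_neg_distrib]
      refine Finset.sum_congr rfl fun i _ => ?_
      rw [sum_Ioi_succ, Finset.mul_sum, ← Finset.sum_neg_distrib]
      refine Finset.sum_congr rfl fun j _ => ?_
      have hl : ((List.finRange (p + 1)).filter fun r => r ≠ i.succ ∧ r ≠ j.succ).map a =
          a 0 :: ((List.finRange p).filter fun r => r ≠ i ∧ r ≠ j).map fun s => a s.succ := by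
        rw [List.finRange_succ, List.filter_cons_of_pos (by
          simpa using ⟨(Fin.succ_ne_zero i).symm, (Fin.succ_ne_zero j).symm⟩)]
        simp [List.filter_map, Function.comp_def]
      rw [hl, mul_smul_comm, wedge_cons, wedge_cons, wedge_cons, ← mul_assoc,
        ι_swap (ha 0) (H.mem _ _ _ (ha i.succ) _ (ha j.succ)), neg_mul, smul_neg, neg_neg,
        smul_mul_assoc, smul_smul, mul_assoc, sum_Iio_succ, sum_Iio_succ, ← ksign_add]
      congr 2
      simp only [Fin.val_succ, Nat.cast_add, Nat.cast_one]
      linear_combination (-1 : ZMod 2) * zmod2_one_add_one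

theorem der_ad (H : SuperBracket G inv br) {δ : ZMod 2} {D : g →ₗ[ℂ] g}
    (hD : ∀ i, ∀ a ∈ G i, D a ∈ G (i + δ))
    (hbr : ∀ i j, ∀ a ∈ G i, ∀ b ∈ G j, D (br a b) = br (D a) b + ksign (δ * i) • br a (D b))
    {i : ZMod 2} {a : g} (ha : a ∈ G i) (w : SuperExt G) :
    H.der δ D hD (H.ad a w) = H.ad (D a) w + ksign (δ * i) • H.ad a (H.der δ D hD w) := by
  refine SuperExt.induction H.sup (S := LinearMap.eqLocus ((H.der δ D hD).comp (H.ad a))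
    (H.ad (D a) + ksign (δ * i) • (H.ad a).comp (H.der δ D hD))) ?_ ?_ w
  · simp [der_one, ad_one]
  · intro j b hb w hw
    have hw' : H.der δ D hD (H.ad a w) =
      H.ad (D a) w + ksign (δ * i) • H.ad a (H.der δ D hD w) := hw
    change H.der δ D hD (H.ad a (ι G b * w)) =
      H.ad (D a) (ι G b * w) + ksign (δ * i) • H.ad a (H.der δ D hD (ι G b * w))
    rw [H.ad_ι_mul ha hb, map_add, map_smul, H.der_ι_mul hD (H.mem i j a ha b hb),
      H.der_ι_mul hD hb, hw', H.ad_ι_mul (hD i a ha) hb, H.der_ι_mul hD hb, map_add, map_smul,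
      H.ad_ι_mul ha (hD j b hb), H.ad_ι_mul ha hb, hbr i j a ha b hb]
    rcases zmod2_cases δ with rfl | rfl <;> rcases zmod2_cases i with rfl | rfl <;>
      rcases zmod2_cases j with rfl | rfl <;>
      (simp [ksign, zmod2_one_add_one, add_mul, mul_add]; abel)

/-- The differential commutes with the derivations which preserve the bracket. -/
theorem ce_der (H : SuperBracket G inv br) {δ : ZMod 2} {D : g →ₗ[ℂ] g}
    (hD : ∀ i, ∀ a ∈ G i, D a ∈ G (i + δ))
    (hbr : ∀ i j, ∀ a ∈ G i, ∀ b ∈ G j, D (br a b) = br (D a) b + ksign (δ * i) • br a (D b))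
    (w : SuperExt G) : H.ce (H.der δ D hD w) = H.der δ D hD (H.ce w) := by
  refine SuperExt.induction H.sup (S := LinearMap.eqLocus (H.ce.comp (H.der δ D hD))
    ((H.der δ D hD).comp H.ce)) ?_ ?_ w
  · simp [der_one, ce_one]
  · intro i a ha w hw
    have hw' : H.ce (H.der δ D hD w) = H.der δ D hD (H.ce w) := hw
    change H.ce (H.der δ D hD (ι G a * w)) = H.der δ D hD (H.ce (ι G a * w))
    rw [H.der_ι_mul hD ha, map_add, map_smul, ce_ι_mul, ce_ι_mul, ce_ι_mul, map_sub,
      H.der_ad hD hbr ha, H.der_ι_mul hD ha, hw', smul_sub]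
    abel

theorem wedge_induction (H : SuperBracket G inv br) {S : Submodule ℂ (SuperExt G)}
    (hS : ∀ (p : ℕ) (a : Fin p → g) (ε : Fin p → ZMod 2), (∀ r, a r ∈ G (ε r)) →
      wedge G (List.ofFn a) ∈ S) (w : SuperExt G) : w ∈ S := by
  let T : Submodule ℂ (SuperExt G) := Submodule.span ℂ
    {y | ∃ (p : ℕ) (a : Fin p → g) (ε : Fin p → ZMod 2), (∀ r, a r ∈ G (ε r)) ∧
      y = wedge G (List.ofFn a)}
  have hT : T ≤ S := by
    refine Submodule.span_le.2 ?_
    rintro _ ⟨p, a, ε, ha, rfl⟩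
    exact hS p a ε ha
  refine hT (SuperExt.induction H.sup (S := T) ?_ ?_ w)
  · exact Submodule.subset_span ⟨0, Fin.elim0, Fin.elim0, fun r => r.elim0, by simp [wedge]⟩
  · intro i b hb w hw
    have : T ≤ T.comap (LinearMap.mulLeft ℂ (ι G b)) := by
      refine Submodule.span_le.2 ?_
      rintro _ ⟨p, a, ε, ha, rfl⟩
      refine Submodule.subset_span ⟨p + 1, Fin.cons b a, Fin.cons i ε, ?_, ?_⟩
      · intro r
        induction r using Fin.cases with
        | zero => simpa using hb
        | succ r => simpa using ha r
      · rw [LinearMap.mulLeft_apply, List.ofFn_succ, wedge_cons]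
        simp
    exact this hw

end SuperBracket

end CE

/-- The Poisson bracket on `tg` has the properties needed for the differential. -/
theorem tgSuper (n m : ℕ) : SuperBracket (tgPart n m) (tgInv n m) (tgBracket n m) where
  sup := tgPart_sup
  inv_apply _ _ ha := tgInv_apply ha
  mem _ _ _ ha _ hb := tgBracket_mem ha hb
  swap _ _ _ ha _ hb := tgBracket_swap ha hb

/-- The submodule `osp · Λ(tg)` of `Λ(tg)`. -/
def ospSub (n m : ℕ) : Submodule ℂ (SuperExt (tgPart n m)) :=
  Submodule.span ℂ {y | ∃ (δ : ZMod 2) (ξ : Matrix (Coord n m) (Coord n m) ℂ) (p : ℕ)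
    (a : Fin p → tg n m) (ε : Fin p → ZMod 2), ξ ∈ osp n m δ ∧ (∀ r, a r ∈ tgPart n m (ε r)) ∧
      y = leibniz (tgPart n m) δ (actTg ξ) a ε}

/-- The space of the relative Chevalley–Eilenberg complex: the `osp`-coinvariants of `Λ(tg)`. -/
abbrev RelCE (n m : ℕ) := SuperExt (tgPart n m) ⧸ ospSub n m

theorem der_mem_ospSub {δ : ZMod 2} {ξ : Matrix (Coord n m) (Coord n m) ℂ} (hξ : ξ ∈ osp n m δ)
    (w : SuperExt (tgPart n m)) :
    (tgSuper n m).der δ (actTg ξ) (fun _ _ ha => actTg_mem hξ ha) w ∈ ospSub n m := by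
  refine (tgSuper n m).wedge_induction (S := (ospSub n m).comap
    ((tgSuper n m).der δ (actTg ξ) (fun _ _ ha => actTg_mem hξ ha))) ?_ w
  intro p a ε ha
  rw [Submodule.mem_comap, SuperBracket.der_wedge _ _ a ε ha]
  exact Submodule.subset_span ⟨δ, ξ, p, a, ε, hξ, ha, rfl⟩

theorem ce_mem_ospSub {w : SuperExt (tgPart n m)} (hw : w ∈ ospSub n m) :
    (tgSuper n m).ce w ∈ ospSub n m := by
  refine Submodule.span_induction (p := fun w _ => (tgSuper n m).ce w ∈ ospSub n m)
    ?_ ?_ ?_ ?_ hw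
  · intro w hw
    obtain ⟨δ, ξ, p, a, ε, hξ, ha, e⟩ := hw
    have e1 := (tgSuper n m).der_wedge (fun _ _ ha => actTg_mem hξ ha) a ε ha
    have e2 := (tgSuper n m).ce_der (fun _ _ ha => actTg_mem hξ ha)
      (fun i j a ha b hb => tgBracket_act hξ ha hb) (wedge (tgPart n m) (List.ofFn a))
    have e3 := der_mem_ospSub hξ ((tgSuper n m).ce (wedge (tgPart n m) (List.ofFn a)))
    rw [e, ← e1, e2]
    exact e3
  · rw [map_zero]; exact Submodule.zero_mem _
  · intro x y _ _ hx hy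
    rw [map_add]; exact Submodule.add_mem _ hx hy
  · intro c x _ hx
    rw [map_smul]; exact Submodule.smul_mem _ c hx

theorem ospSub_le_comap : ospSub n m ≤ (ospSub n m).comap (tgSuper n m).ce :=
  fun _ hw => Submodule.mem_comap.2 (ce_mem_ospSub hw)

/-- The class of an element of `Λ(tg)` in the relative Chevalley–Eilenberg complex. -/
def relCls (n m : ℕ) : SuperExt (tgPart n m) →ₗ[ℂ] RelCE n m := (ospSub n m).mkQ

/-- The Chevalley–Eilenberg differential of the relative Chevalley–Eilenberg complex. -/
def relD (n m : ℕ) : RelCE n m →ₗ[ℂ] RelCE n m :=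
  (ospSub n m).mapQ (ospSub n m) (tgSuper n m).ce ospSub_le_comap

/-- The class of `a_1 ∧ ⋯ ∧ a_p` is sent to the class of its Chevalley–Eilenberg boundary. -/
theorem relD_wedge {p : ℕ} (a : Fin p → tg n m) (ε : Fin p → ZMod 2)
    (ha : ∀ r, a r ∈ tgPart n m (ε r)) :
    relD n m (relCls n m (wedge (tgPart n m) (List.ofFn a))) =
      relCls n m (ceBoundary (tgPart n m) (tgBracket n m) a ε) := by
  rw [relD, relCls, Submodule.mkQ_apply, Submodule.mapQ_apply, SuperBracket.ce_wedge _ a ε ha]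
  rfl

/-! ### The graph complex -/

/-- A graph together with a linear ordering of its vertices and a linear ordering of the two
half-edges of every edge. The half-edges are natural numbers; a vertex is the set of its incident
half-edges, so that `verts` is a partition of the set of half-edges; an edge is an ordered pair of
half-edges, and `edges` is a partition of the set of half-edges into pairs. All vertices have
valency at least three. -/
structure OrdGraph where
  verts : List (Finset ℕ)
  edges : Finset (ℕ × ℕ)
  verts_disjoint : verts.Pairwise Disjoint
  valency : ∀ v ∈ verts, 3 ≤ v.card
  edges_ne : ∀ e ∈ edges, e.1 ≠ e.2
  edges_mem : ∀ e ∈ edges, (∃ v ∈ verts, e.1 ∈ v) ∧ ∃ v ∈ verts, e.2 ∈ v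
  edges_cover : ∀ v ∈ verts, ∀ h ∈ v, ∃! e, e ∈ edges ∧ (h = e.1 ∨ h = e.2)

namespace OrdGraph

/-- `Y` arises from `X` by exchanging two neighbours in the ordering of the vertices. -/
def VertexSwap (X Y : OrdGraph) : Prop :=
  ∃ (A B : List (Finset ℕ)) (v w : Finset ℕ),
    X.verts = A ++ v :: w :: B ∧ Y.verts = A ++ w :: v :: B ∧ Y.edges = X.edges

/-- `Y` arises from `X` by reversing the orientation of one edge. -/
def EdgeFlip (X Y : OrdGraph) : Prop :=
  ∃ e ∈ X.edges, Y.verts = X.verts ∧ Y.edges = insert e.swap (X.edges.erase e)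

/-- `X` and `Y` are isomorphic through a bijection of the half-edges which respects the vertices and
their ordering, and the edges and their orientations. -/
def Iso (X Y : OrdGraph) : Prop :=
  ∃ f : ℕ → ℕ, Set.InjOn f {h | ∃ v ∈ X.verts, h ∈ v} ∧
    Y.verts = X.verts.map (Finset.image f) ∧ Y.edges = X.edges.image (Prod.map f f)

/-- The relations of the graph complex: isomorphic graphs are identified, and a change of the
orderings by an element of `S_m × S_2 × ⋯ × S_2` multiplies a graph by the total sign of that
element (it suffices to impose this for the generating transpositions). -/
def relations : Submodule ℂ (OrdGraph →₀ ℂ) :=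
  Submodule.span ℂ
    ({z | ∃ X Y, Iso X Y ∧ z = Finsupp.single X 1 - Finsupp.single Y 1} ∪
      {z | ∃ X Y, (VertexSwap X Y ∨ EdgeFlip X Y) ∧
        z = Finsupp.single X 1 + Finsupp.single Y 1})

/-- The vertex incident to a half-edge. -/
def vertexOf (X : OrdGraph) (h : ℕ) : Finset ℕ := (X.verts.find? fun v => h ∈ v).getD ∅

theorem nodup (X : OrdGraph) : X.verts.Nodup := by
  refine X.verts_disjoint.imp_of_mem ?_
  rintro v w hv - hd rfl
  have := X.valency v hv
  rw [disjoint_self.1 hd] at this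
  simp at this

theorem eq_of_mem (X : OrdGraph) {v w : Finset ℕ} (hv : v ∈ X.verts) (hw : w ∈ X.verts) {h : ℕ}
    (h1 : h ∈ v) (h2 : h ∈ w) : v = w := by
  by_contra hne
  exact Finset.disjoint_left.1
    (X.verts_disjoint.forall hv hw hne) h1 h2

theorem vertexOf_eq (X : OrdGraph) {v : Finset ℕ} (hv : v ∈ X.verts) {h : ℕ} (hh : h ∈ v) :
    X.vertexOf h = v := by
  unfold vertexOf
  cases hf : X.verts.find? fun v => h ∈ v with
  | none => exact absurd hh (by simpa using List.find?_eq_none.1 hf v hv)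
  | some w =>
    exact X.eq_of_mem (List.mem_of_find?_eq_some hf) hv (by simpa using List.find?_some hf) hh

/-- The edge `e` is not a loop of `X`. -/
def NonLoop (X : OrdGraph) (e : ℕ × ℕ) : Prop := e ∈ X.edges ∧ X.vertexOf e.1 ≠ X.vertexOf e.2

/-- The vertex `(v - h) ∪ (v' - h')` which results from contracting the edge `e = (h, h')` with
incident vertices `v` and `v'`. -/
def merged (X : OrdGraph) (e : ℕ × ℕ) : Finset ℕ :=
  (X.vertexOf e.1).erase e.1 ∪ (X.vertexOf e.2).erase e.2

/-- The vertices not incident to `e`, in their order. -/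
def others (X : OrdGraph) (e : ℕ × ℕ) : List (Finset ℕ) :=
  X.verts.filter fun v => v ≠ X.vertexOf e.1 ∧ v ≠ X.vertexOf e.2

theorem mem_others {X : OrdGraph} {e : ℕ × ℕ} {v : Finset ℕ} :
    v ∈ X.others e ↔ v ∈ X.verts ∧ v ≠ X.vertexOf e.1 ∧ v ≠ X.vertexOf e.2 := by
  simp [others]

theorem NonLoop.mem {X : OrdGraph} {e : ℕ × ℕ} (he : X.NonLoop e) :
    X.vertexOf e.1 ∈ X.verts ∧ e.1 ∈ X.vertexOf e.1 ∧
      X.vertexOf e.2 ∈ X.verts ∧ e.2 ∈ X.vertexOf e.2 := by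
  obtain ⟨⟨v, hv, h1⟩, w, hw, h2⟩ := X.edges_mem e he.1
  rw [X.vertexOf_eq hv h1, X.vertexOf_eq hw h2]
  exact ⟨hv, h1, hw, h2⟩

/-- A half-edge of the contraction is a half-edge of `X` which does not belong to `e`. -/
theorem mem_contract {X : OrdGraph} {e : ℕ × ℕ} (he : X.NonLoop e) (h : ℕ) :
    (∃ v ∈ X.merged e :: X.others e, h ∈ v) ↔ (∃ v ∈ X.verts, h ∈ v) ∧ h ≠ e.1 ∧ h ≠ e.2 := by
  obtain ⟨m1, i1, m2, i2⟩ := he.mem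
  constructor
  · rintro ⟨v, hv, hh⟩
    rcases List.mem_cons.1 hv with rfl | hv
    · rcases Finset.mem_union.1 hh with hh | hh
      · obtain ⟨hne, hm⟩ := Finset.mem_erase.1 hh
        exact ⟨⟨_, m1, hm⟩, hne, fun h' => he.2 (X.eq_of_mem m1 m2 hm (h' ▸ i2))⟩
      · obtain ⟨hne, hm⟩ := Finset.mem_erase.1 hh
        exact ⟨⟨_, m2, hm⟩, fun h' => he.2 (X.eq_of_mem m1 m2 (h' ▸ i1) hm), hne⟩
    · obtain ⟨hv, n1, n2⟩ := mem_others.1 hv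
      exact ⟨⟨v, hv, hh⟩, fun h' => n1 (X.eq_of_mem hv m1 hh (h' ▸ i1)),
        fun h' => n2 (X.eq_of_mem hv m2 hh (h' ▸ i2))⟩
  · rintro ⟨⟨v, hv, hh⟩, n1, n2⟩
    by_cases h1 : v = X.vertexOf e.1
    · exact ⟨_, List.mem_cons_self, Finset.mem_union_left _ (Finset.mem_erase.2 ⟨n1, h1 ▸ hh⟩)⟩
    · by_cases h2 : v = X.vertexOf e.2
      · exact ⟨_, List.mem_cons_self, Finset.mem_union_right _ (Finset.mem_erase.2 ⟨n2, h2 ▸ hh⟩)⟩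
      · exact ⟨v, List.mem_cons_of_mem _ (mem_others.2 ⟨hv, h1, h2⟩), hh⟩

/-- The contraction of the edge `e = (h, h')` with incident vertices `v ≠ v'`; if the vertices of
`X` are `v, v', v_3, …, v_m`, in this order, then those of the contraction are
`(v - h) ∪ (v' - h'), v_3, …, v_m`. -/
def contract (X : OrdGraph) (e : ℕ × ℕ) (he : X.NonLoop e) : OrdGraph where
  verts := X.merged e :: X.others e
  edges := X.edges.erase e
  verts_disjoint := by
    obtain ⟨m1, i1, m2, i2⟩ := he.mem
    refine List.pairwise_cons.2 ⟨fun w hw => ?_, X.verts_disjoint.filter _⟩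
    obtain ⟨hw, n1, n2⟩ := mem_others.1 hw
    refine Finset.disjoint_left.2 fun h hh hm => ?_
    rcases Finset.mem_union.1 hh with hh | hh
    · exact n1 (X.eq_of_mem hw m1 hm (Finset.mem_of_mem_erase hh))
    · exact n2 (X.eq_of_mem hw m2 hm (Finset.mem_of_mem_erase hh))
  valency := by
    obtain ⟨m1, i1, m2, i2⟩ := he.mem
    intro v hv
    rcases List.mem_cons.1 hv with rfl | hv
    · have hd : Disjoint ((X.vertexOf e.1).erase e.1) ((X.vertexOf e.2).erase e.2) :=
        Finset.disjoint_left.2 fun h h1 h2 => he.2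
          (X.eq_of_mem m1 m2 (Finset.mem_of_mem_erase h1) (Finset.mem_of_mem_erase h2))
      have h1 := X.valency _ m1
      have h2 := X.valency _ m2
      rw [merged, Finset.card_union_of_disjoint hd, Finset.card_erase_of_mem i1,
        Finset.card_erase_of_mem i2]
      omega
    · exact X.valency v (mem_others.1 hv).1
  edges_ne := fun f hf => X.edges_ne f (Finset.mem_of_mem_erase hf)
  edges_mem := by
    intro f hf
    obtain ⟨hne, hf⟩ := Finset.mem_erase.1 hf
    obtain ⟨⟨v, hv, h1⟩, w, hw, h2⟩ := X.edges_mem f hf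
    have key : ∀ u ∈ X.verts, ∀ h ∈ u, (h = f.1 ∨ h = f.2) → h ≠ e.1 ∧ h ≠ e.2 := by
      intro u hu h hh hf'
      constructor <;> intro h'
      · exact hne ((X.edges_cover u hu h hh).unique ⟨hf, hf'⟩ ⟨he.1, Or.inl h'⟩)
      · exact hne ((X.edges_cover u hu h hh).unique ⟨hf, hf'⟩ ⟨he.1, Or.inr h'⟩)
    exact ⟨(mem_contract he _).2 ⟨⟨v, hv, h1⟩, key v hv _ h1 (Or.inl rfl)⟩,
      (mem_contract he _).2 ⟨⟨w, hw, h2⟩, key w hw _ h2 (Or.inr rfl)⟩⟩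
  edges_cover := by
    intro v hv h hh
    obtain ⟨⟨w, hw, hh'⟩, n1, n2⟩ := (mem_contract he h).1 ⟨v, hv, hh⟩
    obtain ⟨f, ⟨hf, hf'⟩, hu⟩ := X.edges_cover w hw h hh'
    refine ⟨f, ⟨Finset.mem_erase.2 ⟨?_, hf⟩, hf'⟩, fun y hy =>
      hu y ⟨Finset.mem_of_mem_erase hy.1, hy.2⟩⟩
    rintro rfl
    exact hf'.elim n1 n2

/-- The sign of the permutation which moves the vertices incident to `e = (h, h')` to the front,
first that of `h` and then that of `h'`, and keeps the order of the others. -/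
def contractSign (X : OrdGraph) (e : ℕ × ℕ) : ℂ :=
  let i := X.verts.idxOf (X.vertexOf e.1)
  let j := X.verts.idxOf (X.vertexOf e.2)
  (-1) ^ (if i < j then i + j + 1 else i + j)

end OrdGraph

/-- The space underlying the graph complex. -/
abbrev GC := (OrdGraph →₀ ℂ) ⧸ OrdGraph.relations

/-- The class of an oriented graph in the graph complex. -/
def OrdGraph.cls (X : OrdGraph) : GC := OrdGraph.relations.mkQ (Finsupp.single X 1)

open Classical in
/-- The class of the oriented graph `X / e`, and `0` if `e` is a loop. -/
def OrdGraph.contractCls (X : OrdGraph) (e : ℕ × ℕ) : GC :=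
  if he : X.NonLoop e then X.contractSign e • (X.contract e he).cls else 0

namespace OrdGraph

theorem ext' {X Y : OrdGraph} (h1 : X.verts = Y.verts) (h2 : X.edges = Y.edges) : X = Y := by
  cases X; cases Y; cases h1; cases h2; rfl

theorem cls_iso {X Y : OrdGraph} (h : Iso X Y) : X.cls = Y.cls := by
  rw [cls, cls, ← sub_eq_zero, ← map_sub, Submodule.mkQ_apply, Submodule.Quotient.mk_eq_zero]
  exact Submodule.subset_span (Or.inl ⟨X, Y, h, rfl⟩)

theorem cls_neg {X Y : OrdGraph} (h : VertexSwap X Y ∨ EdgeFlip X Y) : Y.cls = -X.cls := by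
  rw [cls, cls, eq_neg_iff_add_eq_zero, add_comm, ← map_add, Submodule.mkQ_apply,
    Submodule.Quotient.mk_eq_zero]
  exact Submodule.subset_span (Or.inr ⟨X, Y, h, rfl⟩)

theorem mem_of_edge {X : OrdGraph} {e : ℕ × ℕ} (he : e ∈ X.edges) :
    X.vertexOf e.1 ∈ X.verts ∧ e.1 ∈ X.vertexOf e.1 ∧
      X.vertexOf e.2 ∈ X.verts ∧ e.2 ∈ X.vertexOf e.2 := by
  obtain ⟨⟨v, hv, h1⟩, w, hw, h2⟩ := X.edges_mem e he
  rw [X.vertexOf_eq hv h1, X.vertexOf_eq hw h2]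
  exact ⟨hv, h1, hw, h2⟩

theorem contractCls_of {X : OrdGraph} {e : ℕ × ℕ} (he : X.NonLoop e) :
    X.contractCls e = X.contractSign e • (X.contract e he).cls := dif_pos he

theorem contractCls_of_not {X : OrdGraph} {e : ℕ × ℕ} (he : ¬ X.NonLoop e) :
    X.contractCls e = 0 := dif_neg he

theorem exists_injective_of_iso {X Y : OrdGraph} (h : Iso X Y) : ∃ f : ℕ → ℕ,
    Function.Injective f ∧ Y.verts = X.verts.map (Finset.image f) ∧
      Y.edges = X.edges.image (Prod.map f f) := by
  classical
  obtain ⟨f, hf, h1, h2⟩ := h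
  obtain ⟨B, hB⟩ : ∃ B : ℕ, ∀ v ∈ X.verts, ∀ h ∈ v, f h < B := by
    refine ⟨(X.verts.toFinset.biUnion id).sup f + 1, fun v hv h hh => Nat.lt_succ_of_le ?_⟩
    exact Finset.le_sup (f := f) (Finset.mem_biUnion.2 ⟨v, List.mem_toFinset.2 hv, hh⟩)
  have hg : ∀ h, (∃ v ∈ X.verts, h ∈ v) →
      (if ∃ v ∈ X.verts, h ∈ v then f h else h + B) = f h := fun h hh => if_pos hh
  refine ⟨fun h => if ∃ v ∈ X.verts, h ∈ v then f h else h + B, ?_, ?_, ?_⟩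
  · intro a b hab
    by_cases ha : ∃ v ∈ X.verts, a ∈ v <;> by_cases hb : ∃ v ∈ X.verts, b ∈ v <;>
      simp only [ha, hb, if_true, if_false] at hab
    · exact hf ha hb hab
    · obtain ⟨v, hv, hh⟩ := ha
      have := hB v hv a hh
      omega
    · obtain ⟨v, hv, hh⟩ := hb
      have := hB v hv b hh
      omega
    · omega
  · rw [h1]
    refine List.map_congr_left fun v hv => Finset.image_congr fun h hh => (hg h ⟨v, hv, hh⟩).symm
  · rw [h2]
    refine Finset.image_congr fun e he => ?_
    obtain ⟨ha, hb⟩ := X.edges_mem e he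
    exact Prod.ext (hg _ ha).symm (hg _ hb).symm

theorem idxOf_map {f : Finset ℕ → Finset ℕ} (hf : Function.Injective f) (l : List (Finset ℕ))
    (v : Finset ℕ) : (l.map f).idxOf (f v) = l.idxOf v := by
  induction l with
  | nil => rfl
  | cons a l ih =>
    by_cases h : a = v
    · subst h; simp
    · rw [List.map_cons, List.idxOf_cons_ne _ (fun h' => h (hf h')), List.idxOf_cons_ne _ h, ih]

theorem boundary_iso {X Y : OrdGraph} (h : Iso X Y) :
    ∑ e ∈ Y.edges, Y.contractCls e = ∑ e ∈ X.edges, X.contractCls e := by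
  obtain ⟨f, hf, h1, h2⟩ := exists_injective_of_iso h
  have hi : Function.Injective (Finset.image f) := Finset.image_injective hf
  rw [h2, Finset.sum_image (fun a _ b _ hab => hf.prodMap hf hab)]
  refine Finset.sum_congr rfl fun e he => ?_
  obtain ⟨m1, i1, m2, i2⟩ := mem_of_edge he
  have v1 : Y.vertexOf (f e.1) = (X.vertexOf e.1).image f :=
    Y.vertexOf_eq (h1 ▸ List.mem_map_of_mem m1) (Finset.mem_image_of_mem _ i1)
  have v2 : Y.vertexOf (f e.2) = (X.vertexOf e.2).image f :=
    Y.vertexOf_eq (h1 ▸ List.mem_map_of_mem m2) (Finset.mem_image_of_mem _ i2)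
  have heY : Prod.map f f e ∈ Y.edges := h2 ▸ Finset.mem_image_of_mem _ he
  have hnl : Y.NonLoop (Prod.map f f e) ↔ X.NonLoop e := by
    simp only [NonLoop, heY, he, true_and, Prod.map_fst, Prod.map_snd, v1, v2, hi.ne_iff]
  by_cases hX : X.NonLoop e
  · have hY := hnl.2 hX
    rw [contractCls_of hX, contractCls_of hY]
    congr 1
    · simp only [contractSign, Prod.map_fst, Prod.map_snd, v1, v2, h1, idxOf_map hi]
    · refine (cls_iso ⟨f, hf.injOn, ?_, ?_⟩).symm
      · change Y.merged _ :: Y.others _ = (X.merged _ :: X.others _).map _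
        rw [List.map_cons]
        congr 1
        · simp only [merged, Prod.map_fst, Prod.map_snd, v1, v2, Finset.image_union,
            Finset.image_erase hf]
        · simp only [others, Prod.map_fst, Prod.map_snd, v1, v2, h1, List.filter_map]
          congr 1
          refine List.filter_congr fun v _ => ?_
          simp [hi.eq_iff]
      · change Y.edges.erase _ = (X.edges.erase _).image _
        rw [h2, Finset.image_erase (hf.prodMap hf)]
  · rw [contractCls_of_not hX, contractCls_of_not (fun h => hX (hnl.1 h))]

theorem vertexOf_congr {X Y : OrdGraph} (h : X.verts.Perm Y.verts) {e : ℕ × ℕ}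
    (he : e ∈ X.edges) : Y.vertexOf e.1 = X.vertexOf e.1 ∧ Y.vertexOf e.2 = X.vertexOf e.2 := by
  obtain ⟨m1, i1, m2, i2⟩ := mem_of_edge he
  exact ⟨Y.vertexOf_eq (h.mem_iff.1 m1) i1, Y.vertexOf_eq (h.mem_iff.1 m2) i2⟩

theorem boundary_flip {X Y : OrdGraph} (h : EdgeFlip X Y) :
    ∑ e ∈ Y.edges, Y.contractCls e = -∑ e ∈ X.edges, X.contractCls e := by
  obtain ⟨o, ho, h1, h2⟩ := h
  have hv : ∀ k, Y.vertexOf k = X.vertexOf k := fun k => by rw [vertexOf, vertexOf, h1]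
  have hs : o.swap ∉ X.edges := by
    intro hs
    obtain ⟨⟨v, hv, h⟩, -⟩ := X.edges_mem o ho
    have := (X.edges_cover v hv _ h).unique ⟨ho, Or.inl rfl⟩ ⟨hs, Or.inr rfl⟩
    exact X.edges_ne o ho (congrArg Prod.fst this)
  have hs' : o.swap ∉ X.edges.erase o := fun h => hs (Finset.mem_of_mem_erase h)
  rw [h2, Finset.sum_insert hs', ← Finset.add_sum_erase _ _ ho, neg_add, ← Finset.sum_neg_distrib]
  congr 1
  · have hoY : o.swap ∈ Y.edges := h2 ▸ Finset.mem_insert_self _ _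
    have hnl : Y.NonLoop o.swap ↔ X.NonLoop o := by
      simp only [NonLoop, hoY, ho, true_and, hv, Prod.fst_swap, Prod.snd_swap, ne_comm]
    by_cases hX : X.NonLoop o
    · rw [contractCls_of hX, contractCls_of (hnl.2 hX), ← neg_smul]
      congr 1
      · have hne : X.verts.idxOf (X.vertexOf o.1) ≠ X.verts.idxOf (X.vertexOf o.2) := fun h =>
          hX.2 ((List.idxOf_inj hX.mem.1).1 h)
        simp only [contractSign, hv, Prod.fst_swap, Prod.snd_swap, h1]
        rcases lt_or_gt_of_ne hne with h | h
        · rw [if_pos h, if_neg h.le.not_gt, pow_succ]; ring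
        · rw [if_pos h, if_neg h.le.not_gt, pow_succ]; ring
      · congr 1
        refine ext' ?_ ?_
        · change Y.merged _ :: Y.others _ = X.merged _ :: X.others _
          simp only [merged, others, hv, Prod.fst_swap, Prod.snd_swap, h1, Finset.union_comm,
            and_comm]
        · change Y.edges.erase _ = X.edges.erase _
          rw [h2, Finset.erase_insert hs']
    · rw [contractCls_of_not hX, contractCls_of_not (fun h => hX (hnl.1 h)), neg_zero]
  · refine Finset.sum_congr rfl fun e he => ?_
    obtain ⟨hne, heX⟩ := Finset.mem_erase.1 he
    have heY : e ∈ Y.edges := h2 ▸ Finset.mem_insert_of_mem he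
    have hnl : Y.NonLoop e ↔ X.NonLoop e := by
      simp only [NonLoop, heX, heY, true_and, hv]
    by_cases hX : X.NonLoop e
    · rw [contractCls_of hX, contractCls_of (hnl.2 hX), ← smul_neg]
      congr 1
      · simp only [contractSign, hv, h1]
      · refine cls_neg (Or.inr ⟨o, Finset.mem_erase.2 ⟨hne.symm, ho⟩, ?_, ?_⟩)
        · change Y.merged _ :: Y.others _ = X.merged _ :: X.others _
          simp only [merged, others, hv, h1]
        · change Y.edges.erase _ = insert _ ((X.edges.erase _).erase _)
          rw [h2, Finset.erase_insert_of_ne (fun h : o.swap = e => hs (h.symm ▸ heX)), Finset.erase_right_comm]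
    · rw [contractCls_of_not hX, contractCls_of_not (fun h => hX (hnl.1 h)), neg_zero]

theorem sign_aux (k l : ℕ) (h : l ≠ k) (h' : l ≠ k + 1) :
    ((-1 : ℂ) ^ (if k + 1 < l then k + 1 + l + 1 else k + 1 + l) =
      -(-1) ^ (if k < l then k + l + 1 else k + l)) ∧
    ((-1 : ℂ) ^ (if l < k + 1 then l + (k + 1) + 1 else l + (k + 1)) =
      -(-1) ^ (if l < k then l + k + 1 else l + k)) := by
  constructor
  · by_cases h1 : k < l
    · rw [if_pos h1, if_pos (by omega), show k + 1 + l + 1 = (k + l + 1) + 1 by ring, pow_succ]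
      ring
    · rw [if_neg h1, if_neg (by omega), show k + 1 + l = (k + l) + 1 by ring, pow_succ]
      ring
  · by_cases h1 : l < k
    · rw [if_pos h1, if_pos (by omega), show l + (k + 1) + 1 = (l + k + 1) + 1 by ring, pow_succ]
      ring
    · rw [if_neg h1, if_neg (by omega), show l + (k + 1) = (l + k) + 1 by ring, pow_succ]
      ring

theorem boundary_swap {X Y : OrdGraph} (h : VertexSwap X Y) :
    ∑ e ∈ Y.edges, Y.contractCls e = -∑ e ∈ X.edges, X.contractCls e := by
  obtain ⟨A, B, v, w, h1, h2, h3⟩ := h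
  have hp : X.verts.Perm Y.verts := by
    rw [h1, h2]; exact List.Perm.append_left A (List.Perm.swap _ _ _)
  have hnd : (A ++ v :: w :: B).Nodup := h1 ▸ X.nodup
  have hvw : v ≠ w := by
    rintro rfl
    have := (List.nodup_append.1 hnd).2.1
    simp at this
  have hvA : v ∉ A := fun h => (List.nodup_append.1 hnd).2.2 v h v (by simp) rfl
  have hwA : w ∉ A := fun h => (List.nodup_append.1 hnd).2.2 w h w (by simp) rfl
  have xv : X.verts.idxOf v = A.length := by
    rw [h1, List.idxOf_append_of_notMem hvA]; simp
  have xw : X.verts.idxOf w = A.length + 1 := by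
    rw [h1, List.idxOf_append_of_notMem hwA, List.idxOf_cons_ne _ hvw]; simp
  have yw : Y.verts.idxOf w = A.length := by
    rw [h2, List.idxOf_append_of_notMem hwA]; simp
  have yv : Y.verts.idxOf v = A.length + 1 := by
    rw [h2, List.idxOf_append_of_notMem hvA, List.idxOf_cons_ne _ hvw.symm]; simp
  have xo : ∀ u, u ≠ v → u ≠ w → Y.verts.idxOf u = X.verts.idxOf u := by
    intro u n1 n2
    rw [h1, h2]
    by_cases hu : u ∈ A
    · rw [List.idxOf_append_of_mem hu, List.idxOf_append_of_mem hu]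
    · rw [List.idxOf_append_of_notMem hu, List.idxOf_append_of_notMem hu,
        List.idxOf_cons_ne _ n1.symm, List.idxOf_cons_ne _ n2.symm,
        List.idxOf_cons_ne _ n1.symm, List.idxOf_cons_ne _ n2.symm]
  rw [h3, ← Finset.sum_neg_distrib]
  refine Finset.sum_congr rfl fun e he => ?_
  obtain ⟨e1, e2⟩ := vertexOf_congr hp he
  have hnl : Y.NonLoop e ↔ X.NonLoop e := by simp only [NonLoop, h3, e1, e2]
  by_cases hX : X.NonLoop e
  swap
  · rw [contractCls_of_not hX, contractCls_of_not (fun h => hX (hnl.1 h)), neg_zero]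
  have hY := hnl.2 hX
  obtain ⟨m1, -, m2, -⟩ := hX.mem
  have hne := hX.2
  rw [contractCls_of hX, contractCls_of hY]
  by_cases hc : (v ≠ X.vertexOf e.1 ∧ v ≠ X.vertexOf e.2) ∧
      (w ≠ X.vertexOf e.1 ∧ w ≠ X.vertexOf e.2)
  · rw [← smul_neg]
    congr 1
    · simp only [contractSign, e1, e2, xo _ hc.1.1.symm hc.2.1.symm,
        xo _ hc.1.2.symm hc.2.2.symm]
    · refine cls_neg (Or.inl ⟨X.merged e :: A.filter
        (fun u => u ≠ X.vertexOf e.1 ∧ u ≠ X.vertexOf e.2), B.filter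
        (fun u => u ≠ X.vertexOf e.1 ∧ u ≠ X.vertexOf e.2), v, w, ?_, ?_, ?_⟩)
      · change X.merged _ :: X.others _ = _
        rw [others, h1, List.filter_append, List.filter_cons_of_pos (by simpa using hc.1),
          List.filter_cons_of_pos (by simpa using hc.2)]
        rfl
      · change Y.merged _ :: Y.others _ = _
        rw [others, merged, merged, e1, e2, h2, List.filter_append,
          List.filter_cons_of_pos (by simpa using hc.2),
          List.filter_cons_of_pos (by simpa using hc.1)]
        rfl
      · change Y.edges.erase _ = X.edges.erase _
        rw [h3]
  · have hg : Y.contract e hY = X.contract e hX := by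
      refine ext' ?_ ?_
      · change Y.merged _ :: Y.others _ = X.merged _ :: X.others _
        rw [others, others, merged, merged, e1, e2, h1, h2, List.filter_append, List.filter_append]
        congr 2
        by_cases hcv : v ≠ X.vertexOf e.1 ∧ v ≠ X.vertexOf e.2
        · have hcw : ¬ (w ≠ X.vertexOf e.1 ∧ w ≠ X.vertexOf e.2) := fun h => hc ⟨hcv, h⟩
          rw [List.filter_cons_of_neg (a := w) (by simpa using hcw),
            List.filter_cons_of_pos (a := v) (by simpa using hcv),
            List.filter_cons_of_pos (a := v) (by simpa using hcv),
            List.filter_cons_of_neg (a := w) (by simpa using hcw)]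
        · rw [List.filter_cons_of_neg (a := v) (by simpa using hcv)]
          by_cases hcw : w ≠ X.vertexOf e.1 ∧ w ≠ X.vertexOf e.2
          · rw [List.filter_cons_of_pos (a := w) (by simpa using hcw),
              List.filter_cons_of_pos (a := w) (by simpa using hcw),
              List.filter_cons_of_neg (a := v) (by simpa using hcv)]
          · rw [List.filter_cons_of_neg (a := w) (by simpa using hcw),
              List.filter_cons_of_neg (a := w) (by simpa using hcw),
              List.filter_cons_of_neg (a := v) (by simpa using hcv)]
      · change Y.edges.erase _ = X.edges.erase _
        rw [h3]
    rw [hg, ← neg_smul]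
    congr 1
    have hidx : ∀ u u', u ∈ X.verts → u ≠ u' → X.verts.idxOf u ≠ X.verts.idxOf u' :=
      fun u u' hu h h' => h ((List.idxOf_inj hu).1 h')
    simp only [contractSign, e1, e2]
    have k1 := hidx _ _ m1 hne
    generalize X.vertexOf e.1 = a at *
    generalize X.vertexOf e.2 = b at *
    have p1 : ∀ u ∈ X.verts, u ≠ v → u ≠ w →
        X.verts.idxOf u ≠ A.length ∧ X.verts.idxOf u ≠ A.length + 1 := fun u hu n1 n2 =>
      ⟨xv ▸ hidx u v hu n1, xw ▸ hidx u w hu n2⟩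
    by_cases av : a = v
    · subst av
      by_cases bw : b = w
      · subst bw
        rw [xv, xw, yv, yw, if_neg (show ¬ (A.length + 1 < A.length) by omega),
          if_pos (show A.length < A.length + 1 by omega),
          show A.length + (A.length + 1) + 1 = (A.length + 1 + A.length) + 1 by ring, pow_succ]
        ring
      · obtain ⟨q1, q2⟩ := p1 b m2 hne.symm bw
        rw [xv, yv, xo b hne.symm bw]
        exact (sign_aux _ _ q1 q2).1
    · by_cases aw : a = w
      · subst aw
        by_cases bv : b = v
        · subst bv
          rw [xv, xw, yv, yw, if_neg (show ¬ (A.length + 1 < A.length) by omega),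
            if_pos (show A.length < A.length + 1 by omega),
            show A.length + (A.length + 1) + 1 = (A.length + 1 + A.length) + 1 by ring, pow_succ]
          ring
        · obtain ⟨q1, q2⟩ := p1 b m2 bv hne.symm
          rw [xw, yw, xo b bv hne.symm, (sign_aux _ _ q1 q2).1, neg_neg]
      · obtain ⟨q1, q2⟩ := p1 a m1 av aw
        by_cases bv : b = v
        · subst bv
          rw [xv, yv, xo a av aw]
          exact (sign_aux _ _ q1 q2).2
        · have bw : b = w := by
            by_contra bw
            exact hc ⟨⟨Ne.symm av, Ne.symm bv⟩, Ne.symm aw, Ne.symm bw⟩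
          subst bw
          rw [xw, yw, xo a av aw, (sign_aux _ _ q1 q2).2, neg_neg]

end OrdGraph

theorem OrdGraph.relations_le_ker : OrdGraph.relations ≤ LinearMap.ker
    (Finsupp.linearCombination ℂ fun X : OrdGraph => ∑ e ∈ X.edges, X.contractCls e) := by
  refine Submodule.span_le.2 ?_
  rintro z (⟨X, Y, h, rfl⟩ | ⟨X, Y, h, rfl⟩)
  · simp [OrdGraph.boundary_iso h]
  · rcases h with h | h
    · simp [OrdGraph.boundary_swap h]
    · simp [OrdGraph.boundary_flip h]

/-- The differential of the graph complex, `∂ X = ∑ X / e`. -/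
def graphD : GC →ₗ[ℂ] GC :=
  OrdGraph.relations.liftQ
    (Finsupp.linearCombination ℂ fun X : OrdGraph => ∑ e ∈ X.edges, X.contractCls e)
    OrdGraph.relations_le_ker

theorem graphD_cls (X : OrdGraph) : graphD X.cls = ∑ e ∈ X.edges, X.contractCls e := by
  rw [graphD, OrdGraph.cls, Submodule.mkQ_apply, Submodule.liftQ_apply]
  simp

/-! ### Chord diagrams and the map `Φ` -/

/-- An oriented chord diagram on `{0, …, N - 1}`: a partition into ordered pairs. -/
def IsOrientedChordDiagram {N : ℕ} (c : Finset (Fin N × Fin N)) : Prop :=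
  (∀ e ∈ c, e.1 ≠ e.2) ∧ ∀ h, ∃! e, e ∈ c ∧ (h = e.1 ∨ h = e.2)

open Classical in
/-- The chord diagrams on `{0, …, N - 1}`, each with its canonical orientation, in which every chord
`(i, j)` has `i < j`. -/
def chordDiagrams (N : ℕ) : Finset (Finset (Fin N × Fin N)) :=
  Finset.univ.filter fun c => IsOrientedChordDiagram c ∧ ∀ e ∈ c, e.1 < e.2

theorem chordDiagrams_oriented {N : ℕ} {c : Finset (Fin N × Fin N)} (hc : c ∈ chordDiagrams N) :
    IsOrientedChordDiagram c := by
  classical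
  simp only [chordDiagrams, Finset.mem_filter] at hc
  exact hc.2.1

/-- The Koszul sign of the rearrangement `x_0 ⊗ x_1 ⊗ ⋯ ↦ x_{l_0} ⊗ x_{l_1} ⊗ ⋯` of homogeneous
vectors, where `x_i` has parity `ε i`. -/
def koszul {N : ℕ} (ε : Fin N → ZMod 2) : List (Fin N) → ℂ
  | [] => 1
  | i :: l => (l.map fun j => if j < i then ksign (ε i * ε j) else 1).prod * koszul ε l

/-- The invariant `β_c` on the tensor `x_0 ⊗ ⋯ ⊗ x_{N-1}` of coordinates: the factors are permuted,
with Koszul sign, into the order `i_1, j_1, i_2, j_2, …` given by the chords `(i_r, j_r)` of `c`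
(listed in any order), and then contracted in pairs with the symplectic form. -/
def beta {N : ℕ} (c : Finset (Fin N × Fin N)) (x : Fin N → Coord n m) : ℂ :=
  koszul (fun i => par (x i)) (c.toList.flatMap fun e => [e.1, e.2]) *
    ∏ e ∈ c, form (x e.1) (x e.2)

/-- The consecutive intervals of lengths `k_1, k_2, …`, the first one starting at `s`. -/
def intervals : ℕ → List ℕ → List (Finset ℕ)
  | _, [] => []
  | s, k :: ks => Finset.Ico s (s + k) :: intervals (s + k) ks

theorem mem_intervals (h : ℕ) : ∀ (ks : List ℕ) (s : ℕ),
    (∃ v ∈ intervals s ks, h ∈ v) ↔ s ≤ h ∧ h < s + ks.sum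
  | [], s => by simp [intervals]
  | k :: ks, s => by
    have ih := mem_intervals h ks (s + k)
    simp only [intervals, List.mem_cons, exists_eq_or_imp, ih, Finset.mem_Ico, List.sum_cons]
    omega

theorem intervals_disjoint : ∀ (ks : List ℕ) (s : ℕ), (intervals s ks).Pairwise Disjoint
  | [], s => List.Pairwise.nil
  | k :: ks, s => by
    refine List.pairwise_cons.2 ⟨fun v hv => Finset.disjoint_left.2 fun h h1 h2 => ?_,
      intervals_disjoint ks (s + k)⟩
    have h3 := ((mem_intervals h ks (s + k)).1 ⟨v, hv, h2⟩).1
    have h4 := (Finset.mem_Ico.1 h1).2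
    omega

theorem card_of_mem_intervals {v : Finset ℕ} : ∀ (ks : List ℕ) (s : ℕ),
    v ∈ intervals s ks → v.card ∈ ks
  | [], s, hv => by simp [intervals] at hv
  | k :: ks, s, hv => by
    rcases List.mem_cons.1 hv with rfl | hv
    · simp
    · exact List.mem_cons_of_mem _ (card_of_mem_intervals ks (s + k) hv)

/-- The oriented graph `Γ_{k_1,…,k_i}(c)`, with half-edges `0, …, N - 1`, where
`N = k_1 + ⋯ + k_i`: its vertices are the consecutive intervals of lengths `k_1, …, k_i`, in this
order, and its oriented edges are the chords of `c`. -/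
def chordGraph (ks : List ℕ) (hk : ∀ k ∈ ks, 3 ≤ k) (c : Finset (Fin ks.sum × Fin ks.sum))
    (hc : IsOrientedChordDiagram c) : OrdGraph where
  verts := intervals 0 ks
  edges := c.image fun e => (e.1.val, e.2.val)
  verts_disjoint := intervals_disjoint ks 0
  valency := fun _ hv => hk _ (card_of_mem_intervals ks 0 hv)
  edges_ne := by
    intro e he
    obtain ⟨f, hf, rfl⟩ := Finset.mem_image.1 he
    exact fun h => hc.1 f hf (Fin.ext h)
  edges_mem := by
    intro e he
    obtain ⟨f, hf, rfl⟩ := Finset.mem_image.1 he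
    exact ⟨(mem_intervals _ ks 0).2 ⟨Nat.zero_le _, by simp⟩,
      (mem_intervals _ ks 0).2 ⟨Nat.zero_le _, by simp⟩⟩
  edges_cover := by
    intro v hv h hh
    have hlt := ((mem_intervals h ks 0).1 ⟨v, hv, hh⟩).2
    rw [zero_add] at hlt
    obtain ⟨f, ⟨hf, hf'⟩, hu⟩ := hc.2 ⟨h, hlt⟩
    refine ⟨(f.1.val, f.2.val), ⟨Finset.mem_image_of_mem _ hf, ?_⟩, ?_⟩
    · exact hf'.imp (fun h => congrArg Fin.val h) (fun h => congrArg Fin.val h)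
    · rintro y ⟨hy, hy'⟩
      obtain ⟨g, hg, rfl⟩ := Finset.mem_image.1 hy
      rw [hu g ⟨hg, hy'.imp (fun h => Fin.ext h) (fun h => Fin.ext h)⟩]

/-- The lengths of a list of words. -/
def lengths (ws : List (Word n m)) : List ℕ := ws.map fun w => w.1.length

theorem three_le_lengths (ws : List (Word n m)) : ∀ k ∈ lengths ws, 3 ≤ k := by
  intro k hk
  obtain ⟨w, -, rfl⟩ := List.mem_map.1 hk
  exact w.2

theorem length_flatMap (ws : List (Word n m)) :
    (ws.flatMap Subtype.val).length = (lengths ws).sum := by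
  simp [lengths]

/-- The letters of a list of words, one word after the other. -/
def letters (ws : List (Word n m)) (i : Fin (lengths ws).sum) : Coord n m :=
  (ws.flatMap Subtype.val).get (i.cast (length_flatMap ws).symm)

/-- `Φ` is the linear map with
`Φ((x_{11} ⋯ x_{1k_1}) ∧ ⋯ ∧ (x_{i1} ⋯ x_{ik_i})) = ∑_c β_c(x) Γ_{k_1,…,k_i}(c)`,
the sum being over all chord diagrams with their canonical orientations (an empty sum if
`k_1 + ⋯ + k_i` is odd). -/
def IsPhi (Φ : RelCE n m →ₗ[ℂ] GC) : Prop :=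
  ∀ ws : List (Word n m),
    Φ (relCls n m (wedge (tgPart n m) (ws.map monoTg))) =
      ∑ c ∈ (chordDiagrams (lengths ws).sum).attach,
        beta c.1 (letters ws) •
          (chordGraph (lengths ws) (three_le_lengths ws) c.1
            (chordDiagrams_oriented c.2)).cls

end SuperGraph

end

noncomputable section

namespace SuperGraph

set_option linter.unusedSectionVars false

/-! ### Skew derivations of words and the Wick functional -/

section Wick

variable {R : Type*} [CommRing R] [Algebra ℂ R] {M : Type*} [AddCommGroup M] [Module ℂ M]
  [Module R M] [IsScalarTower ℂ R M] {β : Type*}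

/-! The idea is to replace the sum over chord diagrams by a single functional on words. Read the
factors of a wedge product of monomials as one word, label its letters by distinct half-edges, and
pair two labelled letters by the symplectic form times a formal variable for the edge between their
labels. The Wick functional of this pairing (a super analogue of the hafnian, computed by
contracting the first letter with each later one) is a polynomial `wk` in the edge variables. Its
monomials are the chord diagrams and its coefficients are the numbers `beta` (`wick_eq_sum_chords`,
`wk_finRange`). The linear map `asm` attaches the list of vertices to such a polynomial and gives an
element of the graph complex; the result is `graphSum` for labelled words and `wordSum` for plain
ones. Reversing an edge changes the sign of a graph and a loop makes it zero, so the edge variables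
may be taken antisymmetric (`asm_edgeVar_mul`). The form is super-antisymmetric, hence the pairing
is supersymmetric.

The map is well defined for three reasons. A supersymmetric even pairing has a supersymmetric Wick
functional (`SwapInv.wick`), which gives the relations of the symmetric algebra inside a vertex.
Exchanging two whole words gives their Koszul sign, and the exchange of the two vertices gives the
additional minus sign of the exterior superalgebra (`graphSum_swap_words`). Finally, an invariant
form has an invariant Wick functional (`xl_wick`), so the lift to the exterior superalgebra vanishes
on the submodule divided out in the coinvariants (`ospSub_le_ker`). Uniqueness holds because the
wedge products of monomials span (`span_wedge_monoTg`).

For the chain map property, contracting an edge amounts to differentiating by its variable. On the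
graph side, the boundary is a sum over pairs of vertices and over pairs of half-edges in them of
such derivatives (`graphD_eq_pairSum`). On the algebraic side, a derivation applied to the Wick
functional contracts one pair, with the differentiated pairing, and leaves the Wick functional of
the other letters (`derivation_wick`). For the variable of the edge between the letters `a` and `b`
only this pair contributes, and it contributes their symplectic form (`edgeDer_wk`). Summed over `a`
in one word and `b` in another, this is the Poisson bracket of the two monomials (`poisson_mono`).
So each pair of vertices contributes one term with a bracket (`cutTerm_eq`), and these terms add up
to the recursive description of the Chevalley–Eilenberg differential (`pairSum_eq_lift`).

Operators on words are encoded throughout by their effect on functionals: `dl`, `pe`, `xl` and `bl`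
take a function `f` on words and evaluate it on the transformed word. Signs and inductions are then
handled without a module of words. -/

theorem ksign_comm_mul (a b : ZMod 2) : ksign (a * b) * ksign (b * a) = 1 := by
  rw [mul_comm b a, ksign_mul_self]

/-- The parity of a word of letters with parities `p`. -/
def lpar (p : β → ZMod 2) (l : List β) : ZMod 2 := (l.map p).sum

theorem lpar_nil (p : β → ZMod 2) : lpar p [] = 0 := rfl

theorem lpar_cons (p : β → ZMod 2) (a : β) (l : List β) : lpar p (a :: l) = p a + lpar p l := by
  simp [lpar]

theorem lpar_append (p : β → ZMod 2) (l l' : List β) :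
    lpar p (l ++ l') = lpar p l + lpar p l' := by
  simp [lpar]

/-- The functional `t ↦ f (D t)`, where `D` is the skew derivation of words which sends a letter
`k` to the scalar `Q s k`. -/
def dl (p : β → ZMod 2) (Q : β → β → R) (s : β) : (List β → M) → List β → M
  | _, [] => 0
  | f, k :: t => Q s k • f t + ksign (p s * p k) • dl p Q s (fun u => f (k :: u)) t

variable {p : β → ZMod 2} {Q Q' : β → β → R}

theorem dl_add (s : β) (f g : List β → M) (t : List β) :
    dl p Q s (fun u => f u + g u) t = dl p Q s f t + dl p Q s g t := by
  induction t generalizing f g with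
  | nil => simp [dl]
  | cons k t ih => simp only [dl, ih, smul_add]; abel

theorem dl_smul (s : β) (c : ℂ) (f : List β → M) (t : List β) :
    dl p Q s (fun u => c • f u) t = c • dl p Q s f t := by
  induction t generalizing f with
  | nil => simp [dl]
  | cons k t ih => simp only [dl, ih, smul_add, smul_comm c]

theorem dl_rsmul (s : β) (c : R) (f : List β → M) (t : List β) :
    dl p Q s (fun u => c • f u) t = c • dl p Q s f t := by
  induction t generalizing f with
  | nil => simp [dl]
  | cons k t ih => simp only [dl, ih, smul_add, smul_comm c]

theorem dl_zero (s : β) (t : List β) : dl p Q s (fun _ => (0 : M)) t = 0 := by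
  induction t with
  | nil => simp [dl]
  | cons k t ih => simp only [dl, ih, smul_zero, add_zero]

theorem dl_sum {κ : Type*} (s : β) (S : Finset κ) (f : κ → List β → M) (t : List β) :
    dl p Q s (fun u => ∑ i ∈ S, f i u) t = ∑ i ∈ S, dl p Q s (f i) t := by
  classical
  induction S using Finset.induction_on with
  | empty => simp [dl_zero]
  | insert a S ha ih => simp only [Finset.sum_insert ha, dl_add, ih]

theorem dl_congr (s : β) {f g : List β → M} {t : List β}
    (h : ∀ u : List β, u.length + 1 = t.length → f u = g u) : dl p Q s f t = dl p Q s g t := by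
  induction t generalizing f g with
  | nil => rfl
  | cons k t ih =>
    simp only [dl]
    rw [h t (by simp), ih fun u hu => h (k :: u) (by simp [hu])]

theorem dl_append (s : β) (f : List β → M) (u v : List β) :
    dl p Q s f (u ++ v) = dl p Q s (fun w => f (w ++ v)) u +
      ksign (p s * lpar p u) • dl p Q s (fun w => f (u ++ w)) v := by
  induction u generalizing f with
  | nil => simp [dl, lpar_nil, ksign_zero]
  | cons k u ih =>
    simp only [List.cons_append, dl, ih, lpar_cons, mul_add, ksign_add, smul_add, smul_smul,
      add_assoc]

/-- Either the pairing vanishes or the two letters have equal parity, so a sign that depends on `k`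
may be rewritten in terms of `s`. -/
theorem even_smul {s k : β} (hQ : ∀ s t, p s ≠ p t → Q s t = 0) (a : ZMod 2) (x : M) :
    ksign (a * p k) • Q s k • x = ksign (a * p s) • Q s k • x := by
  by_cases h : p s = p k
  · rw [h]
  · rw [hQ _ _ h]; simp

/-- On a word `k :: t`, the terms in which one of the two derivations hits `k` are exchanged, and
evenness turns the sign for passing `k` into the sign for exchanging `a` and `b`. Two different
pairings are allowed because `dl_pe` uses the lemma for a pairing together with its derivative. -/
theorem dl_comm (hQ : ∀ s t, p s ≠ p t → Q s t = 0) (hQ' : ∀ s t, p s ≠ p t → Q' s t = 0)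
    (a b : β) (f : List β → M) (t : List β) :
    dl p Q a (dl p Q' b f) t = ksign (p a * p b) • dl p Q' b (dl p Q a f) t := by
  induction t generalizing f with
  | nil => simp [dl]
  | cons k t ih =>
    simp only [dl, dl_add, dl_smul, dl_rsmul, ih, smul_add, smul_smul]
    rw [add_left_comm]
    have e1 := even_smul (s := a) (k := k) hQ (p b) (dl p Q' b f t)
    have e2 := even_smul (s := b) (k := k) hQ' (p a) (dl p Q a f t)
    rw [← smul_smul (ksign (p a * p b)), e1, e2, mul_comm (p b) (p a),
      smul_smul (ksign (p a * p b)) (ksign (p a * p b)) (Q a k • _), ksign_mul_self, one_smul]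
    congr 3
    ring

/-- Letters with a map: naturality of `dl`. -/
theorem dl_map {R' : Type*} [CommRing R'] [Algebra ℂ R'] {γ : Type*} (g : γ → β)
    (φ : R →ₐ[ℂ] R') {q : γ → ZMod 2} (hq : ∀ c, q c = p (g c)) {S : γ → γ → R'}
    (hS : ∀ c d, S c d = φ (Q (g c) (g d))) (s : γ) (f : List β → R) (t : List γ) :
    φ (dl p Q (g s) f (t.map g)) = dl q S s (fun u => φ (f (u.map g))) t := by
  induction t generalizing f with
  | nil => simp [dl]
  | cons k t ih =>
    simp only [List.map_cons, dl, map_add, map_smul, ih, smul_eq_mul, map_mul, hq, hS]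

/-- Here `g` depends on the letter only, not on its position; the hypothesis is therefore useful
mainly for words with distinct letters. -/
theorem dl_eq_sum (s : β) (f : List β → M) (t : List β) (g : β → M)
    (h : ∀ u k v, t = u ++ k :: v → g k = ksign (p s * lpar p u) • Q s k • f (u ++ v)) :
    dl p Q s f t = (t.map g).sum := by
  induction t generalizing f g with
  | nil => simp [dl]
  | cons k t ih =>
    rw [dl, List.map_cons, List.sum_cons, h [] k t rfl,
      -- The sign for passing `k` is put into `g`, so that it occurs twice and cancels.
      ih _ (fun j => ksign (p s * p k) • g j)]
    · have e : ksign (p s * p k) • (t.map fun j => ksign (p s * p k) • g j).sum =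
          (t.map g).sum := by
        rw [List.smul_sum, List.map_map]
        congr 1
        refine List.map_congr_left fun j _ => ?_
        simp [smul_smul, ksign_mul_self]
      rw [e]
      simp only [lpar_nil, mul_zero, ksign_zero, one_smul, List.nil_append]
    · rintro u j v rfl
      rw [h (k :: u) j v rfl, lpar_cons, mul_add, ksign_add, smul_smul, ← mul_assoc,
        ksign_mul_self, one_mul]
      rfl

/-- The Wick functional, the sum over all perfect matchings of a word; the first argument bounds
the number of pairs. -/
def wickN (p : β → ZMod 2) (Q : β → β → R) : ℕ → List β → R
  | _, [] => 1
  | 0, _ :: _ => 0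
  | k + 1, s :: t => dl p Q s (wickN p Q k) t

/-- The Wick functional, the sum over all perfect matchings of a word. -/
def wick (p : β → ZMod 2) (Q : β → β → R) (l : List β) : R := wickN p Q l.length l

/-- Every contraction removes two letters, so all bounds that are at least half the length give the
same value. The bound is there to make the recursion structural. -/
theorem wickN_eq (k j : ℕ) (l : List β) (hk : l.length ≤ 2 * k) (hj : l.length ≤ 2 * j) :
    wickN p Q k l = wickN p Q j l := by
  induction k generalizing j l with
  | zero =>
    obtain rfl : l = [] := List.length_eq_zero_iff.1 (by omega)
    cases j <;> simp [wickN]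
  | succ k ih =>
    cases l with
    | nil => cases j <;> simp [wickN]
    | cons s t =>
      cases j with
      | zero => simp at hj
      | succ j =>
        rw [wickN, wickN]
        refine dl_congr s fun u hu => ih j u ?_ ?_ <;> simp at hk hj <;> omega

theorem wickN_eq_wick (k : ℕ) (l : List β) (hk : l.length ≤ 2 * k) :
    wickN p Q k l = wick p Q l := wickN_eq _ _ _ hk (by omega)

theorem wick_nil : wick p Q [] = 1 := rfl

theorem wick_cons (s : β) (t : List β) : wick p Q (s :: t) = dl p Q s (wick p Q) t := by
  rw [wick, List.length_cons, wickN]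
  exact dl_congr s fun u hu => wickN_eq_wick _ _ (by omega)

/-! ### Supersymmetry of the Wick functional. -/

/-- A functional on words is supersymmetric under an exchange of neighbouring letters. -/
def SwapInv (p : β → ZMod 2) (f : List β → M) : Prop :=
  ∀ u a b v, f (u ++ a :: b :: v) = ksign (p a * p b) • f (u ++ b :: a :: v)

theorem SwapInv.cons_left {f : List β → M} (h : SwapInv p f) (k : β) :
    SwapInv p fun u => f (k :: u) := fun u a b v => h (k :: u) a b v

/-- If the derivation hits neither `a` nor `b`, the symmetry of `f` applies. The two terms in which
it hits one of them are exchanged, with signs that agree because `Q` is even. -/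
theorem SwapInv.dl (hQ : ∀ s t, p s ≠ p t → Q s t = 0) {f : List β → M} (h : SwapInv p f)
    (s : β) : SwapInv p (dl p Q s f) := by
  intro u a b v
  induction u generalizing f with
  | nil =>
    have e1 : (fun u => f (a :: b :: u)) = fun u => ksign (p a * p b) • f (b :: a :: u) :=
      funext fun u => h [] a b u
    simp only [List.nil_append, SuperGraph.dl, e1, dl_smul, smul_add, smul_smul]
    have e2 := even_smul (s := s) (k := b) hQ (p a) (f (a :: v))
    have e3 := even_smul (s := s) (k := a) hQ (p b) (f (b :: v))
    rw [mul_comm (ksign (p a * p b)) (ksign (p s * p b)), ← smul_smul (ksign (p s * p b)), e2,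
      mul_comm (p a) (p b), e3, mul_comm (p b) (p s),
      mul_comm (p a) (p s), smul_smul (ksign (p s * p b)) (ksign (p s * p b)), ksign_mul_self,
      one_smul, add_left_comm]
    congr 3
    ring
  | cons k u ih =>
    simp only [List.cons_append, SuperGraph.dl]
    rw [ih (h.cons_left k), h u a b v, smul_add, smul_comm (Q s k), smul_comm (ksign (p s * p k))]

/-- An exchange away from the first letter is covered by `SwapInv.dl`. If the first two letters are
exchanged, the term that pairs them is symmetric because `Q` is, and the terms that pair each with a
later letter agree because skew derivations supercommute. -/
theorem SwapInv.wickN (hQ : ∀ s t, p s ≠ p t → Q s t = 0)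
    (hs : ∀ s t, Q s t = ksign (p s * p t) • Q t s) (k : ℕ) : SwapInv p (wickN p Q k) := by
  induction k with
  | zero =>
    intro u a b v
    cases u <;> simp [SuperGraph.wickN]
  | succ k ih =>
    intro u a b v
    cases u with
    | cons s u => exact ih.dl hQ s u a b v
    | nil =>
      rw [List.nil_append, List.nil_append, SuperGraph.wickN, SuperGraph.wickN, SuperGraph.dl, SuperGraph.dl, smul_add, hs a b, smul_assoc, smul_smul,
        mul_comm (p b) (p a), ksign_mul_self, one_smul]
      congr 1
      cases k with
      | zero =>
        -- No further pair is allowed, so the terms that leave the other letter over vanish.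
        simp [SuperGraph.wickN, dl_zero]
      | succ k =>
        simp only [SuperGraph.wickN]
        rw [mul_comm (p a)]
        exact (dl_comm (M := R) hQ hQ b a (SuperGraph.wickN p Q k) v).symm

theorem SwapInv.wick (hQ : ∀ s t, p s ≠ p t → Q s t = 0)
    (hs : ∀ s t, Q s t = ksign (p s * p t) • Q t s) : SwapInv p (wick p Q) := by
  intro u a b v
  rw [SuperGraph.wick, SuperGraph.wick, SwapInv.wickN hQ hs]
  simp

theorem SwapInv.move {f : List β → M} (h : SwapInv p f) (u : List β) (a : β) (v w : List β) :
    f (u ++ a :: (v ++ w)) = ksign (p a * lpar p v) • f (u ++ v ++ a :: w) := by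
  induction v generalizing u with
  | nil => simp [lpar_nil, ksign_zero]
  | cons b v ih =>
    have := ih (u ++ [b])
    simp only [List.append_assoc, List.nil_append, List.cons_append] at this ⊢
    rw [h, this, smul_smul, lpar_cons, mul_add, ksign_add]

theorem SwapInv.block {f : List β → M} (h : SwapInv p f) (u x v w : List β) :
    f (u ++ x ++ v ++ w) = ksign (lpar p x * lpar p v) • f (u ++ v ++ x ++ w) := by
  induction x generalizing u with
  | nil => simp [lpar_nil, ksign_zero]
  | cons a x ih =>
    have h1 := ih (u ++ [a])
    have h2 := h.move u a v (x ++ w)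
    simp only [List.append_assoc, List.nil_append, List.cons_append] at h1 h2 ⊢
    rw [h1, h2, smul_smul, lpar_cons, add_mul, ksign_add, mul_comm (ksign _)]

/-! ### Contraction of one pair, and derivations of the coefficients. -/

/-- The sum over all ways to contract a pair of letters of a word. -/
def pe (p : β → ZMod 2) (Q : β → β → R) : (List β → M) → List β → M
  | _, [] => 0
  | f, s :: t => dl p Q s f t + pe p Q (fun u => f (s :: u)) t

theorem pe_add (f g : List β → M) (t : List β) :
    pe p Q (fun u => f u + g u) t = pe p Q f t + pe p Q g t := by
  induction t generalizing f g with
  | nil => simp [pe]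
  | cons k t ih => simp only [pe, ih, dl_add]; abel

theorem pe_smul (c : ℂ) (f : List β → M) (t : List β) :
    pe p Q (fun u => c • f u) t = c • pe p Q f t := by
  induction t generalizing f with
  | nil => simp [pe]
  | cons k t ih => simp only [pe, ih, dl_smul, smul_add]

theorem pe_rsmul (c : R) (f : List β → M) (t : List β) :
    pe p Q (fun u => c • f u) t = c • pe p Q f t := by
  induction t generalizing f with
  | nil => simp [pe]
  | cons k t ih => simp only [pe, ih, dl_rsmul, smul_add]

theorem pe_zero (t : List β) : pe p Q (fun _ => (0 : M)) t = 0 := by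
  induction t with
  | nil => simp [pe]
  | cons k t ih => simp only [pe, ih, dl_zero, add_zero]

theorem pe_congr {f g : List β → M} {t : List β}
    (h : ∀ u : List β, u.length + 2 = t.length → f u = g u) : pe p Q f t = pe p Q g t := by
  induction t generalizing f g with
  | nil => rfl
  | cons k t ih =>
    simp only [pe]
    rw [dl_congr k fun u hu => h u (by simp [← hu]), ih fun u hu => h (k :: u) (by simp [← hu])]

/-- The contraction of a pair with an even pairing is an even operator, so it commutes with a skew
derivation without a sign. -/
theorem dl_pe (hQ : ∀ s t, p s ≠ p t → Q s t = 0) (hQ' : ∀ s t, p s ≠ p t → Q' s t = 0)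
    (s : β) (f : List β → M) (t : List β) :
    dl p Q s (pe p Q' f) t = pe p Q' (dl p Q s f) t := by
  induction t generalizing f with
  | nil => simp [dl, pe]
  | cons k t ih =>
    simp only [dl, pe, dl_add, pe_add, pe_smul, pe_rsmul, ih, smul_add]
    rw [dl_comm hQ' hQ k s f t, mul_comm (p k)]
    abel

theorem derivation_dl (δ : Derivation ℂ R R) (s : β) (f : List β → R) (t : List β) :
    δ (dl p Q s f t) = dl p (fun a b => δ (Q a b)) s f t + dl p Q s (fun u => δ (f u)) t := by
  induction t generalizing f with
  | nil => simp [dl]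
  | cons k t ih =>
    simp only [dl, map_add, Derivation.map_smul, ih, smul_eq_mul, Derivation.leibniz, smul_add]
    rw [mul_comm (f t)]
    abel

/-- This is the product rule for a sum over perfect matchings: one pair is singled out to be
differentiated, and the others form a matching of the remaining letters. Singling out a pair lowers
the bound by one. In the induction the pair may lie beyond the first letter, and then `dl_pe` moves
its contraction outward. -/
theorem derivation_wickN (hQ : ∀ s t, p s ≠ p t → Q s t = 0) (δ : Derivation ℂ R R) (k : ℕ)
    (t : List β) : δ (wickN p Q (k + 1) t) = pe p (fun a b => δ (Q a b)) (wickN p Q k) t := by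
  have hQ' : ∀ s t, p s ≠ p t → δ (Q s t) = 0 := fun s t h => by rw [hQ s t h, map_zero]
  induction k generalizing t with
  | zero =>
    cases t with
    | nil => simp [wickN, pe]
    | cons s t =>
      rw [wickN, derivation_dl, pe]
      congr 1
      have h1 : (fun u => δ (wickN p Q 0 u)) = fun _ => 0 := by
        funext u; cases u <;> simp [wickN]
      have h2 : (fun u => wickN p Q 0 (s :: u)) = fun _ => 0 := by
        funext u; simp [wickN]
      rw [h1, h2, dl_zero, pe_zero]
  | succ k ih =>
    cases t with
    | nil => simp [wickN, pe]
    | cons s t =>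
      rw [wickN, derivation_dl, pe]
      congr 1
      simp only [ih]
      rw [dl_pe hQ hQ']
      rfl

theorem derivation_wick (hQ : ∀ s t, p s ≠ p t → Q s t = 0) (δ : Derivation ℂ R R)
    (t : List β) : δ (wick p Q t) = pe p (fun a b => δ (Q a b)) (wick p Q) t := by
  -- A bound larger than needed leaves enough room after one pair has been used.
  rw [← wickN_eq_wick (t.length + 1) t (by omega), derivation_wickN hQ]
  exact pe_congr fun u hu => wickN_eq_wick _ _ (by omega)

theorem wickN_map {R' : Type*} [CommRing R'] [Algebra ℂ R'] {γ : Type*} (g : γ → β)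
    (φ : R →ₐ[ℂ] R') {q : γ → ZMod 2} (hq : ∀ c, q c = p (g c)) {S : γ → γ → R'}
    (hS : ∀ c d, S c d = φ (Q (g c) (g d))) (k : ℕ) (t : List γ) :
    φ (wickN p Q k (t.map g)) = wickN q S k t := by
  induction k generalizing t with
  | zero => cases t <;> simp [wickN]
  | succ k ih =>
    cases t with
    | nil => simp [wickN]
    | cons s t =>
      rw [List.map_cons, wickN, wickN, dl_map g φ hq hS]
      simp only [ih]

/-- Naturality of the Wick functional. -/
theorem wick_map {R' : Type*} [CommRing R'] [Algebra ℂ R'] {γ : Type*} (g : γ → β)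
    (φ : R →ₐ[ℂ] R') {q : γ → ZMod 2} (hq : ∀ c, q c = p (g c)) {S : γ → γ → R'}
    (hS : ∀ c d, S c d = φ (Q (g c) (g d))) (t : List γ) :
    φ (wick p Q (t.map g)) = wick q S t := by
  rw [wick, wickN_map g φ hq hS, List.length_map, wick]

theorem dl_eq_zero {s : β} {t : List β} (h : ∀ k ∈ t, Q s k = 0) (f : List β → M) :
    dl p Q s f t = 0 := by
  induction t generalizing f with
  | nil => rfl
  | cons k t ih =>
    rw [dl, h k (by simp), zero_smul, ih fun j hj => h j (by simp [hj]), smul_zero, add_zero]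

theorem pe_eq_zero {t : List β} (h : ∀ s ∈ t, ∀ k ∈ t, Q s k = 0) (f : List β → M) :
    pe p Q f t = 0 := by
  induction t generalizing f with
  | nil => rfl
  | cons k t ih =>
    rw [pe, dl_eq_zero (fun j hj => h k (by simp) j (by simp [hj])),
      ih (fun i hi j hj => h i (by simp [hi]) j (by simp [hj])), add_zero]

theorem pe_append_left {u t : List β} (h : ∀ s ∈ u, ∀ k ∈ u ++ t, Q s k = 0) (f : List β → M) :
    pe p Q f (u ++ t) = pe p Q (fun w => f (u ++ w)) t := by
  induction u generalizing f with
  | nil => rfl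
  | cons k u ih =>
    rw [List.cons_append, pe, dl_eq_zero (fun j hj => h k (by simp) j (by simp at hj ⊢; tauto)),
      ih (fun i hi j hj => h i (by simp [hi]) j (by simp at hj ⊢; tauto)), zero_add]
    rfl

/-- The contraction of a single pair of letters. -/
theorem pe_single {u v w : List β} {a b : β}
    (h : ∀ s ∈ u ++ a :: v ++ b :: w, ∀ k ∈ u ++ a :: v ++ b :: w,
      ¬ (s = a ∧ k = b) → ¬ (s = b ∧ k = a) → Q s k = 0)
    (hnd : (u ++ a :: v ++ b :: w).Nodup) (f : List β → M) :
    pe p Q f (u ++ a :: v ++ b :: w) = ksign (p a * lpar p v) • Q a b • f (u ++ v ++ w) := by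
  simp only [List.append_assoc, List.cons_append] at h hnd ⊢
  have hu := List.nodup_append.1 hnd
  have ha := List.nodup_cons.1 hu.2.1
  have hv := List.nodup_append.1 ha.2
  have hb := List.nodup_cons.1 hv.2.1
  have hau : a ∉ u := fun h => hu.2.2 a h a (by simp) rfl
  have hbu : b ∉ u := fun h => hu.2.2 b h b (by simp) rfl
  have hav : a ∉ v := fun h => ha.1 (by simp [h])
  have hab : a ≠ b := fun h => ha.1 (by simp [h])
  have haw : a ∉ w := fun h => ha.1 (by simp [h])
  have hbv : b ∉ v := fun h => hv.2.2 b h b (by simp) rfl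
  -- The letters of `u` pair with nothing, `a` pairs only with `b`, and no pair lies wholly to the
  -- right of `a`; the sign is that of moving `a` past `v`.
  rw [pe_append_left, pe, pe_eq_zero, add_zero, dl_append, dl_eq_zero, zero_add, dl, dl_eq_zero,
    smul_zero, add_zero]
  · intro k hk
    refine h a (by simp) k (by simp [hk]) ?_ ?_
    · rintro ⟨-, rfl⟩; exact hb.1 hk
    · rintro ⟨rfl, -⟩; exact hab rfl
  · intro k hk
    refine h a (by simp) k (by simp [hk]) ?_ ?_
    · rintro ⟨-, rfl⟩; exact hbv hk
    · rintro ⟨rfl, -⟩; exact hab rfl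
  · intro s hs k hk
    refine h s (by simp at hs ⊢; tauto) k (by simp at hk ⊢; tauto) ?_ ?_
    · rintro ⟨rfl, -⟩; exact ha.1 hs
    · rintro ⟨-, rfl⟩; exact ha.1 hk
  · intro s hs k hk
    refine h s (by simp [hs]) k hk ?_ ?_
    · rintro ⟨rfl, -⟩; exact hau hs
    · rintro ⟨rfl, -⟩; exact hbu hs

end Wick

/-! ### Labelled coordinates and invariance under the orthosymplectic Lie superalgebra -/

section Labelled

variable {n m : ℕ}

theorem form_eq_zero {a b : Coord n m} (h : par a ≠ par b) : form a b = 0 := by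
  rcases a with (a | a) | a <;> rcases b with (b | b) | b <;> simp [par, form] at h ⊢

theorem form_swap (a b : Coord n m) : form a b = -(ksign (par a * par b) * form b a) := by
  rcases a with (a | a) | a <;> rcases b with (b | b) | b <;>
    simp [par, form, ksign, eq_comm] <;> split_ifs <;> simp

variable {R : Type*} [CommRing R] [Algebra ℂ R] {M : Type*} [AddCommGroup M] [Module ℂ M]
  [Module R M] [IsScalarTower ℂ R M] {α : Type*}

/-- The parity of a labelled coordinate. -/
def cpar (s : α × Coord n m) : ZMod 2 := par s.2

/-- The symplectic form on labelled coordinates, with values recorded by edges `e`. -/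
def pairing (e : α → α → R) (s t : α × Coord n m) : R := form s.2 t.2 • e s.1 t.1

theorem pairing_even (e : α → α → R) (s t : α × Coord n m) (h : cpar s ≠ cpar t) :
    pairing e s t = 0 := by
  rw [pairing, form_eq_zero h, zero_smul]

/-- The minus sign of the super-antisymmetric form cancels against that of the antisymmetric edge
values. The result is the symmetry required by `SwapInv.wick`. -/
theorem pairing_swap {e : α → α → R} (he : ∀ i j, e i j = -e j i) (s t : α × Coord n m) :
    pairing e s t = ksign (cpar s * cpar t) • pairing e t s := by
  rw [pairing, pairing, form_swap, he, neg_smul, smul_neg, neg_neg, mul_smul]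
  rfl

/-- The functional `t ↦ f (ξ t)`, where `ξ` of parity `δ` acts on words of labelled coordinates
by the Leibniz rule. -/
def xl (δ : ZMod 2) (ξ : Matrix (Coord n m) (Coord n m) ℂ) :
    (List (α × Coord n m) → M) → List (α × Coord n m) → M
  | _, [] => 0
  | f, s :: t => ∑ b, ξ b s.2 • f ((s.1, b) :: t) +
      ksign (δ * cpar s) • xl δ ξ (fun u => f (s :: u)) t

variable {δ : ZMod 2} {ξ : Matrix (Coord n m) (Coord n m) ℂ}

theorem xl_add (f g : List (α × Coord n m) → M) (t : List (α × Coord n m)) :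
    xl δ ξ (fun u => f u + g u) t = xl δ ξ f t + xl δ ξ g t := by
  induction t generalizing f g with
  | nil => simp [xl]
  | cons k t ih => simp only [xl, ih, smul_add, Finset.sum_add_distrib]; abel

theorem xl_smul (c : ℂ) (f : List (α × Coord n m) → M) (t : List (α × Coord n m)) :
    xl δ ξ (fun u => c • f u) t = c • xl δ ξ f t := by
  induction t generalizing f with
  | nil => simp [xl]
  | cons k t ih => simp only [xl, ih, smul_add, Finset.smul_sum, smul_comm c]

theorem xl_rsmul (c : R) (f : List (α × Coord n m) → M) (t : List (α × Coord n m)) :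
    xl δ ξ (fun u => c • f u) t = c • xl δ ξ f t := by
  induction t generalizing f with
  | nil => simp [xl]
  | cons k t ih => simp only [xl, ih, smul_add, Finset.smul_sum, smul_comm c]

theorem xl_zero (t : List (α × Coord n m)) : xl δ ξ (fun _ => (0 : M)) t = 0 := by
  induction t with
  | nil => simp [xl]
  | cons k t ih => simp only [xl, ih, smul_zero, Finset.sum_const_zero, add_zero]

theorem xl_congr {f g : List (α × Coord n m) → M} {t : List (α × Coord n m)}
    (h : ∀ u : List (α × Coord n m), u.map Prod.fst = t.map Prod.fst → f u = g u) :
    xl δ ξ f t = xl δ ξ g t := by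
  induction t generalizing f g with
  | nil => rfl
  | cons k t ih =>
    simp only [xl]
    rw [ih fun u hu => h (k :: u) (by simp [hu])]
    congr 1
    exact Finset.sum_congr rfl fun b _ => by rw [h _ (by simp)]

theorem xl_append (f : List (α × Coord n m) → M) (u v : List (α × Coord n m)) :
    xl δ ξ f (u ++ v) = xl δ ξ (fun w => f (w ++ v)) u +
      ksign (δ * lpar cpar u) • xl δ ξ (fun w => f (u ++ w)) v := by
  induction u generalizing f with
  | nil => simp [xl, lpar_nil, ksign_zero]
  | cons k u ih =>
    simp only [List.cons_append, xl, ih, lpar_cons, mul_add, ksign_add, smul_add, smul_smul,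
      add_assoc]

theorem map_xl {M' : Type*} [AddCommGroup M'] [Module ℂ M'] (φ : M →ₗ[ℂ] M')
    (f : List (α × Coord n m) → M) (t : List (α × Coord n m)) :
    φ (xl δ ξ f t) = xl δ ξ (fun u => φ (f u)) t := by
  induction t generalizing f with
  | nil => simp [xl]
  | cons k t ih => simp only [xl, map_add, map_sum, map_smul, ih]

/-- Only coordinates `b` of parity `par c + δ` occur in the image of `c`, so the sign is constant on
the sum. -/
theorem osp_sum_smul (hξ : ξ ∈ osp n m δ) (c : Coord n m) (η : ZMod 2) (F : Coord n m → M) :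
    ∑ b, ξ b c • ksign (par b * η) • F b = ksign ((par c + δ) * η) • ∑ b, ξ b c • F b := by
  rw [Finset.smul_sum]
  refine Finset.sum_congr rfl fun b _ => ?_
  by_cases h : ξ b c = 0
  · simp [h]
  · rw [hξ.1 b c h, smul_comm]

/-- The action of `ξ` and the contraction with a letter `s` supercommute up to the contraction
with `ξ s`. -/
theorem xl_dl (hξ : ξ ∈ osp n m δ) (e : α → α → R) (s : α × Coord n m)
    (f : List (α × Coord n m) → M) (t : List (α × Coord n m)) :
    ∑ b, ξ b s.2 • dl cpar (pairing e) (s.1, b) f t +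
        ksign (δ * cpar s) • xl δ ξ (dl cpar (pairing e) s f) t =
      dl cpar (pairing e) s (xl δ ξ f) t := by
  induction t generalizing f with
  | nil => simp [xl, dl]
  | cons k t ih =>
    -- Invariance of the form under `ξ`, the second condition in `osp`; the edge value is a common
    -- factor because `ξ` keeps the labels.
    have hq : (∑ b, ξ b s.2 • pairing e (s.1, b) k) +
        ksign (δ * cpar s) • ∑ b, ξ b k.2 • pairing e s (k.1, b) = 0 := by
      simp only [pairing, smul_smul, ← Finset.sum_smul]
      rw [← add_smul]
      have := hξ.2 s.2 k.2
      rw [cpar, this, zero_smul]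
    have ih' := ih fun u => f (k :: u)
    have hA := osp_sum_smul hξ s.2 (cpar k)
      fun b => dl cpar (pairing e) (s.1, b) (fun u => f (k :: u)) t
    have hC := osp_sum_smul hξ k.2 (cpar s)
      fun b => dl cpar (pairing e) s (fun u => f ((k.1, b) :: u)) t
    have hq1 : (∑ b, ξ b s.2 • pairing e (s.1, b) k • f t) +
        ksign (δ * cpar s) • ∑ b, ξ b k.2 • pairing e s (k.1, b) • f t = 0 := by
      have := congrArg (fun r : R => r • f t) hq
      simpa only [add_smul, Finset.sum_smul, smul_assoc, zero_smul] using this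
    simp only [xl, dl, smul_add, Finset.sum_add_distrib, xl_add, xl_smul, xl_rsmul, dl_add, dl_smul,
      dl_sum]
    rw [← ih']
    simp only [mul_comm (cpar s) (cpar _)]
    simp only [cpar] at hA hC hq1 ⊢
    rw [hA, hC]
    have hq2 := eq_neg_of_add_eq_zero_left hq1
    rw [hq2]
    generalize (∑ b, ξ b k.2 • pairing e s (k.1, b) • f t) = q
    generalize (∑ b, ξ b s.2 • dl _ (pairing e) (s.1, b) (fun u => f (k :: u)) t) = A
    generalize xl δ ξ (dl _ (pairing e) s fun u => f (k :: u)) t = B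
    generalize (∑ b, ξ b k.2 • dl _ (pairing e) s (fun u => f ((k.1, b) :: u)) t) = C
    generalize xl δ ξ f t = D
    -- The two signs agree where the letters have equal parity, and otherwise the pairing is zero.
    have hD : ksign (δ * par s.2) • ksign (δ * par k.2) • pairing e s k • D =
        pairing e s k • D := by
      by_cases h : par s.2 = par k.2
      · rw [h, smul_smul, ksign_mul_self, one_smul]
      · rw [pairing_even e s k h]; simp
    rw [hD]
    generalize pairing e s k • D = D'
    rcases zmod2_cases δ with rfl | rfl <;> rcases zmod2_cases (par s.2) with h1 | h1 <;>
      rcases zmod2_cases (par k.2) with h2 | h2 <;> rw [h1, h2] <;>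
      simp [ksign, zmod2_one_add_one] <;> abel

/-- For the Wick functional of `s :: t`, the left-hand side of `xl_dl` is the action of `ξ` on the
whole word and the right-hand side contracts `s` into a functional which is zero by induction. -/
theorem xl_wickN (hξ : ξ ∈ osp n m δ) (e : α → α → R) (k : ℕ) (t : List (α × Coord n m)) :
    xl δ ξ (wickN cpar (pairing e) k) t = 0 := by
  induction k generalizing t with
  | zero =>
    cases t with
    | nil => rfl
    | cons s t => simp [xl, wickN, xl_zero]
  | succ k ih =>
    cases t with
    | nil => rfl
    | cons s t =>
      have h := xl_dl hξ e s (wickN cpar (pairing e) k) t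
      have h0 : xl δ ξ (wickN cpar (pairing e) k) = fun _ => 0 := funext ih
      rw [h0, dl_zero] at h
      exact h

/-- The Wick functional is invariant under the orthosymplectic Lie superalgebra. -/
theorem xl_wick (hξ : ξ ∈ osp n m δ) (e : α → α → R) (t : List (α × Coord n m)) :
    xl δ ξ (wick cpar (pairing e)) t = 0 := by
  -- The action of `ξ` preserves the length, so one bound serves for all words that occur.
  rw [← xl_wickN hξ e t.length t]
  refine xl_congr fun u hu => ?_
  have := congrArg List.length hu
  simp only [List.length_map] at this
  rw [wick, this]

end Labelled

/-! ### The Wick functional as a sum over chord diagrams -/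

section Chords

variable {α : Type*} [LinearOrder α]

/-- The Koszul sign which brings a word of letters of parities `p` into increasing order. -/
def kz (p : α → ZMod 2) : List α → ℂ
  | [] => 1
  | i :: l => (l.map fun j => if j < i then ksign (p i * p j) else 1).prod * kz p l

theorem koszul_eq_kz {N : ℕ} (ε : Fin N → ZMod 2) (l : List (Fin N)) : koszul ε l = kz ε l := by
  induction l with
  | nil => rfl
  | cons i l ih => rw [koszul, kz, ih]

/-- The word `i_1 j_1 i_2 j_2 ⋯` of a list of pairs. -/
def flatPairs (l : List (α × α)) : List α := l.flatMap fun e => [e.1, e.2]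

theorem flatPairs_cons (e : α × α) (l : List (α × α)) :
    flatPairs (e :: l) = e.1 :: e.2 :: flatPairs l := rfl

theorem mem_flatPairs {l : List (α × α)} {a : α} :
    a ∈ flatPairs l ↔ ∃ e ∈ l, a = e.1 ∨ a = e.2 := by
  simp [flatPairs]

theorem kz_swap_aux {p : α → ZMod 2} {a c : α} (h : a ≠ c) :
    (if c < a then ksign (p a * p c) else 1) =
      ksign (p a * p c) * (if a < c then ksign (p c * p a) else 1) := by
  rcases lt_or_gt_of_ne h with h | h
  · rw [if_neg h.not_gt, if_pos h, ksign_comm_mul]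
  · rw [if_pos h, if_neg h.not_gt, mul_one]

/-- Each pair consists of letters of equal parity and is therefore even as a whole, so pairs may be
permuted freely. Hence the sign of a chord diagram does not depend on the order in which
`Finset.toList` lists its chords. -/
theorem kz_perm {p : α → ZMod 2} {l l' : List (α × α)} (h : l.Perm l')
    (hp : ∀ e ∈ l, p e.1 = p e.2) (hn : (flatPairs l).Nodup) :
    kz p (flatPairs l) = kz p (flatPairs l') := by
  induction h with
  | nil => rfl
  | @cons e l₁ l₂ h ih =>
    have hperm : (flatPairs l₁).Perm (flatPairs l₂) := h.flatMap_right _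
    rw [flatPairs_cons] at hn
    have hn' := (List.nodup_cons.1 (List.nodup_cons.1 hn).2).2
    rw [flatPairs_cons, flatPairs_cons, kz, kz, kz, kz,
      ih (fun e he => hp e (List.mem_cons_of_mem _ he)) hn',
      List.map_cons, List.map_cons, List.prod_cons, List.prod_cons,
      (hperm.map _).prod_eq, (hperm.map fun j => if j < e.2 then ksign (p e.2 * p j) else 1).prod_eq]
  | swap e f l =>
    simp only [flatPairs_cons] at hn ⊢
    have h1 := hp e (by simp)
    have h2 := hp f (by simp)
    simp only [List.nodup_cons, List.mem_cons, not_or] at hn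
    simp only [kz, List.map_cons, List.prod_cons]
    rw [kz_swap_aux (p := p) (a := f.1) (c := e.1) hn.1.2.1,
      kz_swap_aux (p := p) (a := f.1) (c := e.2) hn.1.2.2.1,
      kz_swap_aux (p := p) (a := f.2) (c := e.1) hn.2.1.1,
      kz_swap_aux (p := p) (a := f.2) (c := e.2) hn.2.1.2.1, h1, h2]
    have := ksign_mul_self (p f.2 * p e.2)
    -- Both letters of `f` pass both letters of `e`; the four signs are equal.
    have h4 : ksign (p f.2 * p e.2) ^ 4 = 1 := by
      rw [show (4 : ℕ) = 2 * 2 from rfl, pow_mul, pow_two (ksign _), this, one_pow]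
    ring_nf
    rw [h4]
    ring
  | trans h1 h2 ih1 ih2 =>
    rw [ih1 hp hn, ih2 (fun e he => hp e (h1.mem_iff.2 he))
      ((h1.flatMap_right _).nodup_iff.1 hn)]

open Classical in
/-- The partitions of a finite set `S` into pairs `(i, j)` with `i < j`. -/
def chords (S : Finset α) : Finset (Finset (α × α)) :=
  (S ×ˢ S).powerset.filter fun c => (∀ e ∈ c, e.1 < e.2) ∧
    ∀ h ∈ S, ∃! e, e ∈ c ∧ (h = e.1 ∨ h = e.2)

theorem mem_chords {S : Finset α} {c : Finset (α × α)} : c ∈ chords S ↔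
    (∀ e ∈ c, e.1 ∈ S ∧ e.2 ∈ S) ∧ (∀ e ∈ c, e.1 < e.2) ∧
      ∀ h ∈ S, ∃! e, e ∈ c ∧ (h = e.1 ∨ h = e.2) := by
  simp only [chords, Finset.mem_filter, Finset.mem_powerset, Finset.subset_iff, Finset.mem_product]

theorem chords_empty : chords (∅ : Finset α) = {∅} := by
  ext c
  rw [mem_chords, Finset.mem_singleton]
  constructor
  · rintro ⟨h, -, -⟩
    exact Finset.eq_empty_of_forall_notMem fun e he => by simpa using (h e he).1
  · rintro rfl; simp

theorem chordDiagrams_eq (N : ℕ) : chordDiagrams N = chords (Finset.univ : Finset (Fin N)) := by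
  ext c
  classical
  rw [chordDiagrams, Finset.mem_filter, mem_chords]
  simp only [IsOrientedChordDiagram, Finset.mem_univ, true_and, true_imp_iff, and_self,
    implies_true]
  constructor
  · rintro ⟨⟨h1, h2⟩, h3⟩; exact ⟨h3, h2⟩
  · rintro ⟨h3, h2⟩; exact ⟨⟨fun e he => (h3 e he).ne, h2⟩, h3⟩

theorem insert_mem_chords {h k : α} {t : Finset α} (ht : ∀ j ∈ t, h < j) (hk : k ∈ t)
    {c : Finset (α × α)} (hc : c ∈ chords (t.erase k)) :
    insert (h, k) c ∈ chords (insert h t) := by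
  obtain ⟨h1, h2, h3⟩ := mem_chords.1 hc
  have hht : h ∉ t := fun h' => lt_irrefl _ (ht h h')
  have hn : ∀ e ∈ c, e.1 ≠ h ∧ e.2 ≠ h ∧ e.1 ≠ k ∧ e.2 ≠ k := by
    intro e he
    obtain ⟨a1, a2⟩ := h1 e he
    rw [Finset.mem_erase] at a1 a2
    exact ⟨fun h' => hht (h' ▸ a1.2), fun h' => hht (h' ▸ a2.2), a1.1, a2.1⟩
  refine mem_chords.2 ⟨?_, ?_, ?_⟩
  · intro e he
    rcases Finset.mem_insert.1 he with rfl | he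
    · simp [hk]
    · obtain ⟨a1, a2⟩ := h1 e he
      exact ⟨Finset.mem_insert_of_mem (Finset.mem_of_mem_erase a1),
        Finset.mem_insert_of_mem (Finset.mem_of_mem_erase a2)⟩
  · intro e he
    rcases Finset.mem_insert.1 he with rfl | he
    · exact ht k hk
    · exact h2 e he
  · intro g hg
    by_cases hgk : g = h ∨ g = k
    · refine ⟨(h, k), ⟨Finset.mem_insert_self _ _, hgk⟩, ?_⟩
      rintro e ⟨he, he'⟩
      rcases Finset.mem_insert.1 he with rfl | he
      · rfl
      · obtain ⟨b1, b2, b3, b4⟩ := hn e he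
        exfalso
        rcases hgk with rfl | rfl <;> rcases he' with he' | he' <;> simp_all
    · push Not at hgk
      have hgt : g ∈ t.erase k := by
        rw [Finset.mem_insert] at hg
        exact Finset.mem_erase.2 ⟨hgk.2, hg.resolve_left hgk.1⟩
      obtain ⟨e, ⟨he, he'⟩, hu⟩ := h3 g hgt
      refine ⟨e, ⟨Finset.mem_insert_of_mem he, he'⟩, ?_⟩
      rintro f ⟨hf, hf'⟩
      rcases Finset.mem_insert.1 hf with rfl | hf
      · exact absurd hf' (by simpa using hgk)
      · exact hu f ⟨hf, hf'⟩

theorem erase_mem_chords {h : α} {t : Finset α} (ht : ∀ j ∈ t, h < j)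
    {c : Finset (α × α)} (hc : c ∈ chords (insert h t)) :
    ∃ k ∈ t, (h, k) ∈ c ∧ c.erase (h, k) ∈ chords (t.erase k) := by
  obtain ⟨h1, h2, h3⟩ := mem_chords.1 hc
  obtain ⟨⟨i, k⟩, ⟨he, he'⟩, hu⟩ := h3 h (Finset.mem_insert_self _ _)
  have hik : i < k := h2 _ he
  -- The smallest element can only be the left end of its chord.
  have hi : h = i := by
    rcases he' with he' | he'
    · exact he'
    · exfalso
      have hk' : h = k := he'
      rcases Finset.mem_insert.1 (h1 _ he).1 with h' | h'
      · have h'' : i = h := h'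
        exact hik.ne (h''.trans hk')
      · exact absurd (ht i h') (by rw [hk']; exact hik.not_gt)
  subst hi
  have hk : k ∈ t := (Finset.mem_insert.1 (h1 _ he).2).resolve_left hik.ne'
  refine ⟨k, hk, he, mem_chords.2 ⟨?_, fun e he => h2 e (Finset.mem_of_mem_erase he), ?_⟩⟩
  · intro e hec
    obtain ⟨hne, hec⟩ := Finset.mem_erase.1 hec
    obtain ⟨a1, a2⟩ := h1 e hec
    have huk := (h3 k (Finset.mem_insert_of_mem hk)).unique (y₁ := (h, k)) (y₂ := e) ⟨he, Or.inr rfl⟩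
    refine ⟨Finset.mem_erase.2 ⟨?_, (Finset.mem_insert.1 a1).resolve_left ?_⟩,
      Finset.mem_erase.2 ⟨?_, (Finset.mem_insert.1 a2).resolve_left ?_⟩⟩
    · intro h'; exact hne (huk ⟨hec, Or.inl h'.symm⟩).symm
    · intro h'; exact hne (hu e ⟨hec, Or.inl h'.symm⟩)
    · intro h'; exact hne (huk ⟨hec, Or.inr h'.symm⟩).symm
    · intro h'; exact hne (hu e ⟨hec, Or.inr h'.symm⟩)
  · intro g hg
    obtain ⟨hgk, hg⟩ := Finset.mem_erase.1 hg
    obtain ⟨e, ⟨he1, he1'⟩, hu1⟩ := h3 g (Finset.mem_insert_of_mem hg)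
    refine ⟨e, ⟨Finset.mem_erase.2 ⟨?_, he1⟩, he1'⟩,
      fun f hf => hu1 f ⟨Finset.mem_of_mem_erase hf.1, hf.2⟩⟩
    rintro rfl
    rcases he1' with h' | h'
    · exact (ht g hg).ne h'.symm
    · exact hgk h'

/-- A chord diagram on a set with smallest element `h` amounts to a partner `k` of `h` together with
a chord diagram on the rest. This is the same recursion as `wick_cons`. -/
theorem sum_chords_insert {A : Type*} [AddCommMonoid A] {h : α} {t : Finset α}
    (ht : ∀ j ∈ t, h < j) (T : Finset (α × α) → A) :
    ∑ c ∈ chords (insert h t), T c = ∑ k ∈ t, ∑ c ∈ chords (t.erase k), T (insert (h, k) c) := by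
  have hht : h ∉ t := fun h' => lt_irrefl _ (ht h h')
  have hnot : ∀ k k' c, c ∈ chords (t.erase k) → (h, k') ∉ c := fun k k' c hc hm =>
    hht (Finset.mem_of_mem_erase ((mem_chords.1 hc).1 _ hm).1)
  rw [Finset.sum_sigma']
  symm
  refine Finset.sum_bij (fun x _ => insert (h, x.1) x.2) ?_ ?_ ?_ ?_
  · rintro ⟨k, c⟩ hx
    obtain ⟨hk, hc⟩ := Finset.mem_sigma.1 hx
    exact insert_mem_chords ht hk hc
  · rintro ⟨k, c⟩ hx ⟨k', c'⟩ hx' heq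
    obtain ⟨hk, hc⟩ := Finset.mem_sigma.1 hx
    obtain ⟨hk', hc'⟩ := Finset.mem_sigma.1 hx'
    simp only at heq hk hc hk' hc'
    have hm : (h, k) ∈ insert (h, k') c' := heq ▸ Finset.mem_insert_self _ _
    have hkk : k = k' := by
      rcases Finset.mem_insert.1 hm with hm | hm
      · exact congrArg Prod.snd hm
      · exact absurd hm (hnot _ _ _ hc')
    subst hkk
    have := congrArg (fun s => s.erase (h, k)) heq
    simp only [Finset.erase_insert (hnot _ _ _ hc), Finset.erase_insert (hnot _ _ _ hc')] at this
    rw [this]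
  · intro c hc
    obtain ⟨k, hk, hm, he⟩ := erase_mem_chords ht hc
    exact ⟨⟨k, c.erase (h, k)⟩, Finset.mem_sigma.2 ⟨hk, he⟩, Finset.insert_erase hm⟩
  · rintro ⟨k, c⟩ _
    rfl

theorem flatPairs_nodup : ∀ {l : List (α × α)}, l.Nodup → (∀ e ∈ l, e.1 ≠ e.2) →
    (∀ e ∈ l, ∀ f ∈ l, ∀ g, (g = e.1 ∨ g = e.2) → (g = f.1 ∨ g = f.2) → e = f) →
    (flatPairs l).Nodup
  | [], _, _, _ => List.nodup_nil
  | e :: l, hl, h1, h2 => by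
    have hne := List.nodup_cons.1 hl
    have ih := flatPairs_nodup hne.2 (fun e he => h1 e (List.mem_cons_of_mem _ he))
      (fun e he f hf => h2 e (List.mem_cons_of_mem _ he) f (List.mem_cons_of_mem _ hf))
    have key : ∀ g, (g = e.1 ∨ g = e.2) → g ∉ flatPairs l := by
      intro g hg hm
      obtain ⟨f, hf, hgf⟩ := mem_flatPairs.1 hm
      exact hne.1 (h2 e (by simp) f (List.mem_cons_of_mem _ hf) g hg hgf ▸ hf)
    rw [flatPairs_cons, List.nodup_cons, List.nodup_cons, List.mem_cons, not_or]
    exact ⟨⟨h1 e (by simp), key _ (Or.inl rfl)⟩, key _ (Or.inr rfl), ih⟩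

theorem chords_nodup {S : Finset α} {c : Finset (α × α)} (hc : c ∈ chords S) :
    (flatPairs c.toList).Nodup := by
  obtain ⟨h1, h2, h3⟩ := mem_chords.1 hc
  refine flatPairs_nodup c.nodup_toList (fun e he => (h2 e (Finset.mem_toList.1 he)).ne) ?_
  intro e he f hf g hg hg'
  rw [Finset.mem_toList] at he hf
  have hgS : g ∈ S := by
    rcases hg with rfl | rfl
    exacts [(h1 e he).1, (h1 e he).2]
  exact (h3 g hgS).unique ⟨he, hg⟩ ⟨hf, hg'⟩

theorem mem_flatPairs_chords {S : Finset α} {c : Finset (α × α)} (hc : c ∈ chords S) (g : α) :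
    g ∈ flatPairs c.toList ↔ g ∈ S := by
  obtain ⟨h1, h2, h3⟩ := mem_chords.1 hc
  simp only [mem_flatPairs, Finset.mem_toList]
  constructor
  · rintro ⟨e, he, rfl | rfl⟩
    exacts [(h1 e he).1, (h1 e he).2]
  · intro hg
    obtain ⟨e, he, -⟩ := h3 g hg
    exact ⟨e, he⟩

variable {R : Type*} [CommRing R] [Algebra ℂ R] {p : α → ZMod 2} {Q : α → α → R}

/-- The contribution of a chord diagram to the Wick functional. -/
def chordTerm (p : α → ZMod 2) (Q : α → α → R) (c : Finset (α × α)) : R :=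
  kz p (flatPairs c.toList) • ∏ e ∈ c, Q e.1 e.2

theorem prod_lt_aux (k : α) (u v : List α) (hu : ∀ j ∈ u, j < k) (hv : ∀ j ∈ v, k < j) :
    ((u ++ v).map fun j => if j < k then ksign (p k * p j) else 1).prod =
      ksign (p k * lpar p u) := by
  rw [List.map_append, List.prod_append]
  have h2 : (v.map fun j => if j < k then ksign (p k * p j) else 1).prod = 1 := by
    refine List.prod_eq_one fun x hx => ?_
    obtain ⟨j, hj, rfl⟩ := List.mem_map.1 hx
    rw [if_neg (hv j hj).not_gt]
  rw [h2, mul_one]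
  induction u with
  | nil => simp [lpar_nil, ksign_zero]
  | cons j u ih =>
    rw [List.map_cons, List.prod_cons, if_pos (hu j (by simp)), lpar_cons, mul_add, ksign_add,
      ih fun i hi => hu i (by simp [hi])]

/-- With `(h, k)` listed first, `h` passes no smaller letter and `k` passes exactly the letters of
`u`, because the word is increasing. Evenness of the pairing makes the parity of `k` that of `h`. -/
theorem chordTerm_insert (hQ : ∀ s t, p s ≠ p t → Q s t = 0) {h k : α} {u v : List α}
    (hs : (h :: (u ++ k :: v)).Pairwise (· < ·)) {c : Finset (α × α)}
    (hc : c ∈ chords (u ++ v).toFinset) :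
    chordTerm p Q (insert (h, k) c) = ksign (p h * lpar p u) • Q h k • chordTerm p Q c := by
  obtain ⟨hs1, hs2⟩ := List.pairwise_cons.1 hs
  obtain ⟨hs3, hs4, hs5⟩ := List.pairwise_append.1 hs2
  obtain ⟨hs6, hs7⟩ := List.pairwise_cons.1 hs4
  have hnd : (u ++ k :: v).Nodup := hs2.imp fun h => h.ne
  have hnd' : (u ++ v).Nodup := by
    refine hnd.sublist ?_
    exact List.Sublist.append_left (List.sublist_cons_self _ _) _
  have hm := mem_flatPairs_chords hc
  have hcn := chords_nodup hc
  have hnot : (h, k) ∉ c := fun h' => by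
    have := (hm h).1 (mem_flatPairs.2 ⟨_, Finset.mem_toList.2 h', Or.inl rfl⟩)
    rw [List.mem_toFinset] at this
    exact lt_irrefl _ (hs1 h (by simp at this ⊢; tauto))
  -- If some chord joins letters of different parity, both sides vanish. Otherwise `kz_perm` permits
  -- listing `(h, k)` first.
  by_cases hp : ∀ e ∈ insert (h, k) c, p e.1 = p e.2
  · have hperm : ((h, k) :: c.toList).Perm (insert (h, k) c).toList :=
      (Finset.toList_insert hnot).symm
    have hr : (flatPairs c.toList).Perm (u ++ v) :=
      (List.perm_ext_iff_of_nodup hcn hnd').2 fun g => by rw [hm, List.mem_toFinset]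
    have hk : p h = p k := hp (h, k) (Finset.mem_insert_self _ _)
    have hnd2 : (h :: k :: flatPairs c.toList).Nodup := by
      have h0 : (h :: (u ++ k :: v)).Nodup := hs.imp fun h => h.ne
      refine (List.Perm.nodup_iff ?_).2 h0
      exact (List.Perm.cons _ ((hr.cons k).trans List.perm_middle.symm))
    rw [chordTerm, ← kz_perm hperm _ hnd2, flatPairs_cons, Finset.prod_insert hnot]
    · rw [kz, kz, (hr.map _).prod_eq, prod_lt_aux k u v, chordTerm, hk]
      · have h1 : ((k :: flatPairs c.toList).map fun j =>
            if j < h then ksign (p h * p j) else 1).prod = 1 := by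
          refine List.prod_eq_one fun x hx => ?_
          obtain ⟨j, hj, rfl⟩ := List.mem_map.1 hx
          rw [if_neg]
          have : h < j := by
            refine hs1 j ?_
            rw [List.mem_cons, hr.mem_iff] at hj
            simp at hj ⊢; tauto
          exact this.not_gt
        simp only [hk] at h1
        rw [h1, one_mul, mul_smul, smul_eq_mul, mul_smul_comm]
      · intro j hj; exact hs5 j hj k (by simp)
      · exact hs6
    · intro e he
      rcases List.mem_cons.1 he with rfl | he
      · exact hk
      · exact hp e (Finset.mem_insert_of_mem (Finset.mem_toList.1 he))
  · push Not at hp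
    obtain ⟨e, he, hne⟩ := hp
    rw [chordTerm, Finset.prod_eq_zero he (hQ _ _ hne), smul_zero]
    rcases Finset.mem_insert.1 he with rfl | he
    · rw [hQ _ _ hne]; simp
    · rw [chordTerm, Finset.prod_eq_zero he (hQ _ _ hne)]; simp

/-- The Wick functional of an increasing word is the sum over all chord diagrams. -/
theorem wick_eq_sum_chords (hQ : ∀ s t, p s ≠ p t → Q s t = 0) (N : ℕ) : ∀ l : List α,
    l.length = N → l.Pairwise (· < ·) →
      wick p Q l = ∑ c ∈ chords l.toFinset, chordTerm p Q c := by
  -- Strong induction is needed because a step removes two letters.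
  induction N using Nat.strong_induction_on with
  | _ N ih =>
  intro l hN hl
  cases l with
  | nil => simp [wick_nil, chords_empty, chordTerm, kz, flatPairs]
  | cons h t =>
    obtain ⟨h1, h2⟩ := List.pairwise_cons.1 hl
    rw [wick_cons, List.toFinset_cons, sum_chords_insert (by simpa using h1),
      List.sum_toFinset _ (h2.imp fun h => h.ne)]
    refine dl_eq_sum h _ t _ ?_
    rintro u k v rfl
    have hnd : (u ++ k :: v).Nodup := h2.imp fun h => h.ne
    have hsub : (u ++ v).Sublist (u ++ k :: v) :=
      List.Sublist.append_left (List.sublist_cons_self _ _) _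
    have he : (u ++ k :: v).toFinset.erase k = (u ++ v).toFinset := by
      have hk : k ∉ u ++ v := (List.nodup_middle.1 hnd |> List.nodup_cons.1).1
      ext j
      simp only [Finset.mem_erase, List.mem_toFinset, List.mem_append, List.mem_cons] at hk ⊢
      constructor
      · tauto
      · intro hj
        refine ⟨?_, by tauto⟩
        rintro rfl; exact hk hj
    rw [ih (u ++ v).length (by simp at hN ⊢; omega) (u ++ v) rfl (h2.sublist hsub), he,
      Finset.smul_sum, Finset.smul_sum]
    exact Finset.sum_congr rfl fun c hc => chordTerm_insert hQ hl hc

end Chords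

/-! ### Assembling graphs from monomials in edge variables -/

namespace OrdGraph

/-- The conditions under which lists of vertices and sets of edges form a graph. -/
def IsGraph (V : List (Finset ℕ)) (E : Finset (ℕ × ℕ)) : Prop :=
  V.Pairwise Disjoint ∧ (∀ v ∈ V, 3 ≤ v.card) ∧ (∀ e ∈ E, e.1 ≠ e.2) ∧
    (∀ e ∈ E, (∃ v ∈ V, e.1 ∈ v) ∧ ∃ v ∈ V, e.2 ∈ v) ∧
    ∀ v ∈ V, ∀ h ∈ v, ∃! e, e ∈ E ∧ (h = e.1 ∨ h = e.2)

/-- The graph with given vertices and edges. -/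
def ofIsGraph {V : List (Finset ℕ)} {E : Finset (ℕ × ℕ)} (h : IsGraph V E) : OrdGraph :=
  ⟨V, E, h.1, h.2.1, h.2.2.1, h.2.2.2.1, h.2.2.2.2⟩

theorem isGraph (X : OrdGraph) : IsGraph X.verts X.edges :=
  ⟨X.verts_disjoint, X.valency, X.edges_ne, X.edges_mem, X.edges_cover⟩

theorem IsGraph.perm {V V' : List (Finset ℕ)} {E : Finset (ℕ × ℕ)} (h : IsGraph V E)
    (hp : V.Perm V') : IsGraph V' E := by
  obtain ⟨h1, h2, h3, h4, h5⟩ := h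
  refine ⟨(hp.pairwise_iff fun {a b} h => h.symm).1 h1, fun v hv => h2 v (hp.mem_iff.2 hv), h3, ?_,
    fun v hv => h5 v (hp.mem_iff.2 hv)⟩
  simpa only [hp.mem_iff] using h4

theorem IsGraph.flip {V : List (Finset ℕ)} {E : Finset (ℕ × ℕ)} (hg : IsGraph V E)
    {e : ℕ × ℕ} (he : e ∈ E) : IsGraph V (insert e.swap (E.erase e)) := by
  obtain ⟨h1, h2, h3, h4, h5⟩ := hg
  refine ⟨h1, h2, ?_, ?_, ?_⟩
  · intro f hf
    rcases Finset.mem_insert.1 hf with rfl | hf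
    · exact (h3 e he).symm
    · exact h3 f (Finset.mem_of_mem_erase hf)
  · intro f hf
    rcases Finset.mem_insert.1 hf with rfl | hf
    · exact (h4 e he).symm
    · exact h4 f (Finset.mem_of_mem_erase hf)
  · intro v hv h hh
    obtain ⟨f, ⟨hf, hf'⟩, hu⟩ := h5 v hv h hh
    by_cases hfe : f = e
    · subst hfe
      refine ⟨f.swap, ⟨Finset.mem_insert_self _ _, hf'.symm⟩, ?_⟩
      rintro y ⟨hy, hy'⟩
      rcases Finset.mem_insert.1 hy with rfl | hy
      · rfl
      · exact absurd (hu y ⟨Finset.mem_of_mem_erase hy, hy'⟩) (Finset.ne_of_mem_erase hy)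
    · refine ⟨f, ⟨Finset.mem_insert_of_mem (Finset.mem_erase.2 ⟨hfe, hf⟩), hf'⟩, ?_⟩
      rintro y ⟨hy, hy'⟩
      rcases Finset.mem_insert.1 hy with rfl | hy
      · exact absurd (hu e ⟨he, hy'.symm⟩).symm hfe
      · exact hu y ⟨Finset.mem_of_mem_erase hy, hy'⟩

theorem isGraph_map {τ : ℕ → ℕ} (hτ : Function.Injective τ) {V : List (Finset ℕ)}
    {E : Finset (ℕ × ℕ)} :
    IsGraph (V.map (Finset.image τ)) (E.image (Prod.map τ τ)) ↔ IsGraph V E := by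
  have hex : ∀ a, (∃ v ∈ V.map (Finset.image τ), τ a ∈ v) ↔ ∃ v ∈ V, a ∈ v := by
    intro a
    simp [hτ.eq_iff]
  have huq : ∀ h, (∃! e, e ∈ E.image (Prod.map τ τ) ∧ (τ h = e.1 ∨ τ h = e.2)) ↔
      ∃! e, e ∈ E ∧ (h = e.1 ∨ h = e.2) := by
    intro h
    have hm : ∀ e : ℕ × ℕ, (e ∈ E.image (Prod.map τ τ) ∧ (τ h = e.1 ∨ τ h = e.2)) ↔
        ∃ f, (f ∈ E ∧ (h = f.1 ∨ h = f.2)) ∧ Prod.map τ τ f = e := by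
      intro e
      constructor
      · rintro ⟨he, he'⟩
        obtain ⟨f, hf, rfl⟩ := Finset.mem_image.1 he
        exact ⟨f, ⟨hf, he'.imp (fun h => hτ h) fun h => hτ h⟩, rfl⟩
      · rintro ⟨f, ⟨hf, hf'⟩, rfl⟩
        exact ⟨Finset.mem_image_of_mem _ hf, hf'.imp (fun h => congrArg τ h) fun h => congrArg τ h⟩
    constructor
    · rintro ⟨e, he, hu⟩
      obtain ⟨f, hf, rfl⟩ := (hm e).1 he
      exact ⟨f, hf, fun y hy => hτ.prodMap hτ (hu _ ((hm _).2 ⟨y, hy, rfl⟩))⟩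
    · rintro ⟨f, hf, hu⟩
      refine ⟨Prod.map τ τ f, (hm _).2 ⟨f, hf, rfl⟩, fun y hy => ?_⟩
      obtain ⟨g, hg, rfl⟩ := (hm y).1 hy
      rw [hu g hg]
  unfold IsGraph
  refine and_congr ?_ (and_congr ?_ (and_congr ?_ (and_congr ?_ ?_)))
  · rw [List.pairwise_map]
    simp only [Finset.disjoint_image hτ]
  · simp [Finset.card_image_of_injective _ hτ]
  · constructor
    · intro h e he h'
      exact h _ (Finset.mem_image_of_mem _ he) (congrArg τ h')
    · intro h e he
      obtain ⟨f, hf, rfl⟩ := Finset.mem_image.1 he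
      exact fun h' => h f hf (hτ h')
  · rw [Finset.forall_mem_image]
    refine forall₂_congr fun e he => ?_
    rw [Prod.map_fst, Prod.map_snd, hex, hex]
  · simp only [List.forall_mem_map, Finset.forall_mem_image, huq]

end OrdGraph

open OrdGraph

open Classical in
/-- The class of the graph with vertices `V` and edges `s`, and zero if there is no such graph. -/
def gv (V : List (Finset ℕ)) (s : Multiset (ℕ × ℕ)) : GC :=
  if h : ∃ E : Finset (ℕ × ℕ), E.val = s ∧ IsGraph V E then (ofIsGraph h.choose_spec.2).cls else 0

theorem gv_val {V : List (Finset ℕ)} {E : Finset (ℕ × ℕ)} (h : IsGraph V E) :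
    gv V E.val = (ofIsGraph h).cls := by
  have h' : ∃ E' : Finset (ℕ × ℕ), E'.val = E.val ∧ IsGraph V E' := ⟨E, rfl, h⟩
  rw [gv, dif_pos h']
  congr 1
  exact ext' rfl (Finset.val_injective h'.choose_spec.1)

theorem gv_cls (X : OrdGraph) : gv X.verts X.edges.val = X.cls := gv_val X.isGraph

theorem gv_eq_zero {V : List (Finset ℕ)} {s : Multiset (ℕ × ℕ)}
    (h : ∀ E : Finset (ℕ × ℕ), E.val = s → ¬ IsGraph V E) : gv V s = 0 :=
  dif_neg fun ⟨E, h1, h2⟩ => h E h1 h2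

theorem gv_loop (V : List (Finset ℕ)) (h : ℕ) (s : Multiset (ℕ × ℕ)) :
    gv V ((h, h) ::ₘ s) = 0 := by
  refine gv_eq_zero fun E hE hg => hg.2.2.1 (h, h) ?_ rfl
  rw [← Finset.mem_val, hE]
  exact Multiset.mem_cons_self _ _

theorem val_flip {V : List (Finset ℕ)} {E : Finset (ℕ × ℕ)} (hg : IsGraph V E) {e : ℕ × ℕ}
    {s : Multiset (ℕ × ℕ)} (hs : E.val = e ::ₘ s) :
    (insert e.swap (E.erase e)).val = e.swap ::ₘ s := by
  have he : e ∈ E := by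
    rw [← Finset.mem_val, hs]
    exact Multiset.mem_cons_self _ _
  have hn : e.swap ∉ E.erase e := by
    intro hm
    obtain ⟨hne, hm⟩ := Finset.mem_erase.1 hm
    obtain ⟨⟨v, hv, hh⟩, -⟩ := hg.2.2.2.1 e he
    exact hne ((hg.2.2.2.2 v hv _ hh).unique ⟨hm, Or.inr rfl⟩ ⟨he, Or.inl rfl⟩)
  rw [Finset.insert_val_of_notMem hn, Finset.erase_val, hs, Multiset.erase_cons_head]

/-- Being a graph is not affected by reversing an edge, so outside of graphs both sides are zero.
The identity thus holds for every multiset and can be extended linearly to polynomials. -/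
theorem gv_flip (V : List (Finset ℕ)) (e : ℕ × ℕ) (s : Multiset (ℕ × ℕ)) :
    gv V (e.swap ::ₘ s) = -gv V (e ::ₘ s) := by
  have key : ∀ (e : ℕ × ℕ) (E : Finset (ℕ × ℕ)), E.val = e ::ₘ s → IsGraph V E →
      gv V (e.swap ::ₘ s) = -gv V (e ::ₘ s) := by
    intro e E hE hg
    have he : e ∈ E := by
      rw [← Finset.mem_val, hE]
      exact Multiset.mem_cons_self _ _
    rw [← hE, ← val_flip hg hE, gv_val hg, gv_val (hg.flip he)]
    exact cls_neg (Or.inr ⟨e, he, rfl, rfl⟩)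
  by_cases h : ∃ E : Finset (ℕ × ℕ), E.val = e ::ₘ s ∧ IsGraph V E
  · obtain ⟨E, hE, hg⟩ := h
    exact key e E hE hg
  · by_cases h' : ∃ E : Finset (ℕ × ℕ), E.val = e.swap ::ₘ s ∧ IsGraph V E
    · obtain ⟨E, hE, hg⟩ := h'
      have := key e.swap E hE hg
      rw [Prod.swap_swap] at this
      rw [this, neg_neg]
    · rw [gv_eq_zero fun E h1 h2 => h ⟨E, h1, h2⟩, gv_eq_zero fun E h1 h2 => h' ⟨E, h1, h2⟩,
        neg_zero]

theorem gv_map {τ : ℕ → ℕ} (hτ : Function.Injective τ) (V : List (Finset ℕ))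
    (s : Multiset (ℕ × ℕ)) :
    gv (V.map (Finset.image τ)) (s.map (Prod.map τ τ)) = gv V s := by
  have hττ := hτ.prodMap hτ
  have hval : ∀ E : Finset (ℕ × ℕ), (E.image (Prod.map τ τ)).val = E.val.map (Prod.map τ τ) :=
    fun E => Finset.image_val_of_injOn hττ.injOn
  by_cases h : ∃ E : Finset (ℕ × ℕ), E.val = s ∧ IsGraph V E
  · obtain ⟨E, rfl, hg⟩ := h
    rw [← hval, gv_val hg, gv_val ((isGraph_map hτ).2 hg)]
    exact (cls_iso ⟨τ, hτ.injOn, rfl, rfl⟩).symm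
  · rw [gv_eq_zero fun E h1 h2 => h ⟨E, h1, h2⟩]
    refine gv_eq_zero fun E hE hg => h ?_
    -- A multiset whose image has no repetitions has none itself, so it is a set of edges.
    have hnd : s.Nodup := by
      have := E.nodup
      rw [hE] at this
      exact this.of_map
    refine ⟨⟨s, hnd⟩, rfl, (isGraph_map hτ).1 ?_⟩
    convert hg
    refine Finset.val_injective ?_
    rw [hval, hE]

theorem gv_swap (A B : List (Finset ℕ)) (v w : Finset ℕ) (s : Multiset (ℕ × ℕ)) :
    gv (A ++ w :: v :: B) s = -gv (A ++ v :: w :: B) s := by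
  have hp : (A ++ v :: w :: B).Perm (A ++ w :: v :: B) :=
    List.Perm.append_left A (List.Perm.swap _ _ _)
  by_cases h : ∃ E : Finset (ℕ × ℕ), E.val = s ∧ IsGraph (A ++ v :: w :: B) E
  · obtain ⟨E, rfl, hg⟩ := h
    rw [gv_val hg, gv_val (hg.perm hp)]
    exact cls_neg (Or.inl ⟨A, B, v, w, rfl, rfl, rfl⟩)
  · rw [gv_eq_zero fun E h1 h2 => h ⟨E, h1, h2⟩,
      gv_eq_zero fun E h1 h2 => h ⟨E, h1, h2.perm hp.symm⟩, neg_zero]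

/-- Polynomials in the oriented edges. -/
abbrev EdgePoly := MvPolynomial (ℕ × ℕ) ℂ

open MvPolynomial

theorem prod_X_eq (s : Multiset (ℕ × ℕ)) :
    (s.map X).prod = (monomial (Multiset.toFinsupp s) 1 : EdgePoly) := by
  induction s using Multiset.induction_on with
  | empty => simp
  | cons e s ih =>
    rw [Multiset.map_cons, Multiset.prod_cons, ih, X, monomial_mul, one_mul,
      ← Multiset.singleton_add, map_add, Multiset.toFinsupp_singleton]

/-- Monomials in the edges form a basis and correspond to multisets of edges. This reduces the
identities for `asm` to those for `gv`. -/
theorem edgePoly_ext {W : Type*} [AddCommGroup W] [Module ℂ W] {f g : EdgePoly →ₗ[ℂ] W}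
    (h : ∀ s : Multiset (ℕ × ℕ), f (s.map X).prod = g (s.map X).prod) : f = g := by
  refine (basisMonomials (ℕ × ℕ) ℂ).ext fun d => ?_
  have := h (Finsupp.toMultiset d)
  rwa [prod_X_eq, Finsupp.toMultiset_toFinsupp] at this

/-- The linear map which sends a monomial `∏ e` to the graph with vertices `V` and edges `e`. -/
def asm (V : List (Finset ℕ)) : EdgePoly →ₗ[ℂ] GC :=
  (basisMonomials (ℕ × ℕ) ℂ).constr ℂ fun d => gv V (Finsupp.toMultiset d)

theorem asm_prod (V : List (Finset ℕ)) (s : Multiset (ℕ × ℕ)) :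
    asm V (s.map X).prod = gv V s := by
  have := (basisMonomials (ℕ × ℕ) ℂ).constr_basis ℂ (fun d => gv V (Finsupp.toMultiset d))
    (Multiset.toFinsupp s)
  rw [coe_basisMonomials, Multiset.toFinsupp_toMultiset] at this
  rw [prod_X_eq]
  exact this

theorem asm_prod_finset (V : List (Finset ℕ)) (E : Finset (ℕ × ℕ)) :
    asm V (∏ e ∈ E, X e) = gv V E.val := asm_prod V E.val

theorem asm_X_swap_mul (V : List (Finset ℕ)) (e : ℕ × ℕ) (r : EdgePoly) :
    asm V (X e.swap * r) = -asm V (X e * r) := by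
  have : (asm V).comp (LinearMap.mulLeft ℂ (X e.swap)) =
      -((asm V).comp (LinearMap.mulLeft ℂ (X e))) := by
    refine edgePoly_ext fun s => ?_
    simp only [LinearMap.comp_apply, LinearMap.neg_apply, LinearMap.mulLeft_apply,
      ← Multiset.prod_cons, ← Multiset.map_cons, asm_prod, gv_flip]
  exact LinearMap.congr_fun this r

theorem asm_X_loop_mul (V : List (Finset ℕ)) (h : ℕ) (r : EdgePoly) :
    asm V (X (h, h) * r) = 0 := by
  have : (asm V).comp (LinearMap.mulLeft ℂ (X (h, h))) = 0 := by
    refine edgePoly_ext fun s => ?_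
    simp only [LinearMap.comp_apply, LinearMap.zero_apply, LinearMap.mulLeft_apply,
      ← Multiset.prod_cons, ← Multiset.map_cons, asm_prod, gv_loop]
  exact LinearMap.congr_fun this r

theorem asm_swap (A B : List (Finset ℕ)) (v w : Finset ℕ) (r : EdgePoly) :
    asm (A ++ w :: v :: B) r = -asm (A ++ v :: w :: B) r := by
  have : asm (A ++ w :: v :: B) = -asm (A ++ v :: w :: B) := by
    refine edgePoly_ext fun s => ?_
    simp only [LinearMap.neg_apply, asm_prod, gv_swap A B v w]
  exact LinearMap.congr_fun this r

/-- The vertex `v` passes the vertices of `A` one at a time, each with a minus sign. -/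
theorem asm_move (A B : List (Finset ℕ)) (v : Finset ℕ) (r : EdgePoly) :
    asm (A ++ v :: B) r = (-1 : ℂ) ^ A.length • asm (v :: A ++ B) r := by
  induction A using List.reverseRecOn generalizing B with
  | nil => simp
  | append_singleton A w ih =>
    rw [List.append_assoc, List.singleton_append, asm_swap, ih]
    simp [pow_succ]

/-! ### Antisymmetric edge variables. -/

/-- The variable of an edge, which changes its sign when the edge is reversed. -/
def edgeVar (h k : ℕ) : EdgePoly := if h < k then X (h, k) else if k < h then -X (k, h) else 0

theorem edgeVar_swap (h k : ℕ) : edgeVar h k = -edgeVar k h := by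
  rcases lt_trichotomy h k with hk | rfl | hk
  · simp [edgeVar, hk, hk.not_gt]
  · simp [edgeVar]
  · simp [edgeVar, hk, hk.not_gt]

/-- The antisymmetry of `edgeVar` imposes nothing new after `asm`: a reversed edge already changes
the sign of a graph, and a loop already makes it zero. -/
theorem asm_edgeVar_mul (V : List (Finset ℕ)) (h k : ℕ) (r : EdgePoly) :
    asm V (edgeVar h k * r) = asm V (X (h, k) * r) := by
  rcases lt_trichotomy h k with hk | rfl | hk
  · rw [edgeVar, if_pos hk]
  · simp [edgeVar, asm_X_loop_mul]
  · rw [edgeVar, if_neg hk.not_gt, if_pos hk, neg_mul, map_neg, ← asm_X_swap_mul]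
    rfl

/-- The substitution of the antisymmetric edge variables. -/
def edgeNorm : EdgePoly →ₐ[ℂ] EdgePoly := aeval fun e => edgeVar e.1 e.2

theorem edgeNorm_X (h k : ℕ) : edgeNorm (X (h, k)) = edgeVar h k := by
  simp [edgeNorm]

theorem asm_edgeNorm (V : List (Finset ℕ)) (r : EdgePoly) : asm V (edgeNorm r) = asm V r := by
  -- The extra factor `q` lets the induction replace the variables one at a time inside a product.
  have key : ∀ (s : Multiset (ℕ × ℕ)) (q : EdgePoly),
      asm V (edgeNorm (s.map X).prod * q) = asm V ((s.map X).prod * q) := by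
    intro s
    induction s using Multiset.induction_on with
    | empty => simp
    | cons e s ih =>
      intro q
      rw [Multiset.map_cons, Multiset.prod_cons, map_mul edgeNorm,
        show edgeNorm (X e) = edgeVar e.1 e.2 from edgeNorm_X e.1 e.2, mul_assoc,
        asm_edgeVar_mul, mul_left_comm, ih, mul_left_comm, mul_assoc]
  have : (asm V).comp edgeNorm.toLinearMap = asm V := by
    refine edgePoly_ext fun s => ?_
    have := key s 1
    rwa [mul_one, mul_one] at this
  exact LinearMap.congr_fun this r

theorem asm_rename {τ : ℕ → ℕ} (hτ : Function.Injective τ) (V : List (Finset ℕ))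
    (r : EdgePoly) :
    asm (V.map (Finset.image τ)) (rename (Prod.map τ τ) r) = asm V r := by
  have : (asm (V.map (Finset.image τ))).comp (rename (Prod.map τ τ)).toLinearMap = asm V := by
    refine edgePoly_ext fun s => ?_
    have h : rename (Prod.map τ τ) (s.map X).prod =
        (((s.map (Prod.map τ τ)).map X).prod : EdgePoly) := by
      rw [map_multiset_prod, Multiset.map_map, Multiset.map_map]
      congr 1
      refine Multiset.map_congr rfl fun e _ => ?_
      simp
    simp only [LinearMap.comp_apply, AlgHom.toLinearMap_apply, h, asm_prod, gv_map hτ]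
  exact LinearMap.congr_fun this r

/-- A relabelling need not preserve the order of the half-edges, so renaming can leave a variable
with the larger half-edge first; `edgeNorm` rewrites it in the antisymmetric variable. -/
theorem edgeNorm_rename_edgeVar (τ : ℕ → ℕ) (h k : ℕ) :
    edgeNorm (rename (Prod.map τ τ) (edgeVar h k)) =
      if h = k then 0 else edgeVar (τ h) (τ k) := by
  rcases lt_trichotomy h k with hk | rfl | hk
  · rw [edgeVar, if_pos hk, rename_X, Prod.map_apply, edgeNorm_X, if_neg hk.ne]
  · simp [edgeVar]
  · rw [edgeVar, if_neg hk.not_gt, if_pos hk, map_neg, map_neg, rename_X, Prod.map_apply,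
      edgeNorm_X, if_neg hk.ne', ← edgeVar_swap]

/-! ### Labelled words -/

variable {n m : ℕ}

/-- A coordinate labelled by a half-edge. -/
abbrev Lab (n m : ℕ) := ℕ × Coord n m

/-- The half-edges of a labelled word. -/
def vset (u : List (Lab n m)) : Finset ℕ := (u.map Prod.fst).toFinset

/-- The Wick functional with values in polynomials in the edges. -/
def wk (t : List (Lab n m)) : EdgePoly := wick cpar (pairing edgeVar) t

theorem wk_swapInv : SwapInv cpar (wk : List (Lab n m) → EdgePoly) :=
  SwapInv.wick (pairing_even _) (pairing_swap edgeVar_swap)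

/-- The linear combination of graphs given by a list of labelled words. -/
def graphSum (hs : List (List (Lab n m))) : GC := asm (hs.map vset) (wk hs.flatten)

/-- Both sides are the Wick functional of `t` for the pairing pulled back along `τ`, by two
applications of naturality: once for the letters and once for the coefficients. -/
theorem wk_map (τ : ℕ → ℕ) (t : List (Lab n m)) :
    wk (t.map (Prod.map τ id)) = edgeNorm (rename (Prod.map τ τ) (wk t)) := by
  have h1 := wick_map (p := cpar) (Q := pairing edgeVar) (R := EdgePoly) (R' := EdgePoly)
    (id : Lab n m → Lab n m) (edgeNorm.comp (rename (Prod.map τ τ)))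
    (q := cpar) (fun _ => rfl) (S := fun c d => pairing edgeVar (Prod.map τ id c)
      (Prod.map τ id d)) ?_ t
  · have h2 := wick_map (p := cpar) (Q := pairing edgeVar) (R := EdgePoly) (R' := EdgePoly)
      (Prod.map τ id : Lab n m → Lab n m) (AlgHom.id ℂ EdgePoly)
      (q := cpar) (fun _ => rfl) (S := fun c d => pairing edgeVar (Prod.map τ id c)
        (Prod.map τ id d)) (fun _ _ => rfl) t
    rw [List.map_id] at h1
    exact h2.trans h1.symm
  · intro c d
    simp only [pairing, id, AlgHom.comp_apply, map_smul, edgeNorm_rename_edgeVar, Prod.map_fst,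
      Prod.map_snd]
    congr 1
    split_ifs with h
    · rw [h]; simp [edgeVar]
    · rfl

theorem vset_map (τ : ℕ → ℕ) (u : List (Lab n m)) :
    vset (u.map (Prod.map τ id)) = (vset u).image τ := by
  ext a
  simp [vset]

/-- Relabelling the half-edges is an isomorphism of each graph in the combination, and `asm` does
not see the normalization `edgeNorm`. -/
theorem graphSum_map {τ : ℕ → ℕ} (hτ : Function.Injective τ) (hs : List (List (Lab n m))) :
    graphSum (hs.map fun u => u.map (Prod.map τ id)) = graphSum hs := by
  have h1 : (hs.map fun u => u.map (Prod.map τ id)).map vset =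
      (hs.map vset).map (Finset.image τ) := by
    rw [List.map_map, List.map_map]
    exact List.map_congr_left fun u _ => vset_map τ u
  have h2 : (hs.map fun u => u.map (Prod.map τ id)).flatten = hs.flatten.map (Prod.map τ id) := by
    rw [List.map_flatten]
  rw [graphSum, h1, h2, wk_map τ, asm_edgeNorm, asm_rename hτ, graphSum]

/-! ### The boundary of a graph as a sum over pairs of vertices -/

section PairSums

variable {κ A : Type*} [AddCommMonoid A]

/-- The sum of `f pre x mid y post` over the elements `y` of a list which follows `pre`, `x` and
`mid`. -/
def followSum (f : List κ → κ → List κ → κ → List κ → A) (pre : List κ) (x : κ) :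
    List κ → List κ → A
  | _, [] => 0
  | mid, y :: W => f pre x mid y W + followSum f pre x (mid ++ [y]) W

/-- The sum of `f pre x mid y post` over all pairs `x`, `y` of elements of a list which follows
`pre`. -/
def pairSum (f : List κ → κ → List κ → κ → List κ → A) : List κ → List κ → A
  | _, [] => 0
  | pre, x :: W => followSum f pre x [] W + pairSum f (pre ++ [x]) W

variable {f : List κ → κ → List κ → κ → List κ → A} {g : κ → κ → A} {V : List κ}

theorem followSum_eq (hf : ∀ pre x mid y post, V = pre ++ x :: (mid ++ y :: post) →
    f pre x mid y post = g x y + g y x) (pre : List κ) (x : κ) (mid W : List κ)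
    (hV : V = pre ++ x :: (mid ++ W)) :
    followSum f pre x mid W = (W.map fun y => g x y + g y x).sum := by
  induction W generalizing mid with
  | nil => rfl
  | cons y W ih =>
    rw [followSum, hf pre x mid y W hV, ih (mid ++ [y]) (by simpa using hV), List.map_cons,
      List.sum_cons]

/-- The terms for `x` before `y` contain both orders, so they make up the full double sum off the
diagonal, and the diagonal is zero. -/
theorem pairSum_eq (hf : ∀ pre x mid y post, V = pre ++ x :: (mid ++ y :: post) →
    f pre x mid y post = g x y + g y x) (hg : ∀ x ∈ V, g x x = 0) (pre W : List κ)
    (hV : V = pre ++ W) :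
    pairSum f pre W = (W.map fun x => (W.map fun y => g x y).sum).sum := by
  induction W generalizing pre with
  | nil => rfl
  | cons x W ih =>
    rw [pairSum, followSum_eq hf pre x [] W hV, ih (pre ++ [x]) (by simpa using hV)]
    simp only [List.map_cons, List.sum_cons, List.sum_map_add, hg x (by simp [hV]), zero_add]
    rw [add_assoc]

end PairSums

open OrdGraph MvPolynomial

/-! ### Contraction of an edge as differentiation. -/

/-- The derivation dual to the antisymmetric variable of an edge. -/
def edgeDer (h k : ℕ) : Derivation ℂ EdgePoly EdgePoly := pderiv (h, k) - pderiv (k, h)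

theorem pderiv_prod (e : ℕ × ℕ) (E : Finset (ℕ × ℕ)) :
    pderiv e (∏ i ∈ E, X i : EdgePoly) = if e ∈ E then ∏ i ∈ E.erase e, X i else 0 := by
  have h0 : ∀ E : Finset (ℕ × ℕ), e ∉ E → pderiv e (∏ i ∈ E, X i : EdgePoly) = 0 := by
    intro E
    induction E using Finset.induction_on with
    | empty => simp
    | insert a E ha ih =>
      intro he
      rw [Finset.mem_insert, not_or] at he
      rw [Finset.prod_insert ha, Derivation.leibniz, ih he.2, pderiv_X_of_ne (Ne.symm he.1)]
      simp
  split_ifs with he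
  · rw [← Finset.mul_prod_erase E _ he, Derivation.leibniz, h0 _ (Finset.notMem_erase _ _),
      pderiv_X_self]
    simp
  · exact h0 E he

/-- The contribution to the boundary of `asm (pre, x, mid, y, post) r` of the edges between `x` and
`y`. -/
def cutTerm {κ : Type*} (vs : κ → Finset ℕ) (r : EdgePoly) (pre : List κ) (x : κ) (mid : List κ)
    (y : κ) (post : List κ) : GC :=
  ∑ h ∈ vs x, ∑ k ∈ vs y, (-1 : ℂ) ^ mid.length •
    asm (((vs x).erase h ∪ (vs y).erase k) :: (pre ++ mid ++ post).map vs) (edgeDer h k r)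

theorem edge_not_swap (X : OrdGraph) {e : ℕ × ℕ} (he : e ∈ X.edges) : e.swap ∉ X.edges := by
  intro hs
  obtain ⟨⟨v, hv, h⟩, -⟩ := X.edges_mem e he
  have := (X.edges_cover v hv _ h).unique ⟨he, Or.inl rfl⟩ ⟨hs, Or.inr rfl⟩
  exact X.edges_ne e he (congrArg Prod.fst this)

theorem contractCls_eq_asm (Y : OrdGraph) {e : ℕ × ℕ} (he : Y.NonLoop e) :
    Y.contractCls e = Y.contractSign e •
      asm (Y.merged e :: Y.others e) (∏ i ∈ Y.edges.erase e, X i) := by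
  rw [contractCls_of he, asm_prod_finset]
  congr 1
  exact (gv_cls (Y.contract e he)).symm

/-- At most one of the two orientations is an edge, and the derivative by its variable removes it.
The sign `(-1) ^ M.length` is that of moving `w` next to `v`; the remaining parity for an edge from
`w` to `v` is the minus sign in `edgeDer`. -/
theorem cut_edge (Y : OrdGraph) {P M S : List (Finset ℕ)} {v w : Finset ℕ}
    (hY : Y.verts = P ++ v :: (M ++ w :: S)) {h k : ℕ} (hh : h ∈ v) (hk : k ∈ w) :
    (-1 : ℂ) ^ M.length • asm ((v.erase h ∪ w.erase k) :: (P ++ M ++ S))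
        (edgeDer h k (∏ i ∈ Y.edges, X i)) =
      (if (h, k) ∈ Y.edges then Y.contractCls (h, k) else 0) +
        if (k, h) ∈ Y.edges then Y.contractCls (k, h) else 0 := by
  have hv : Y.vertexOf h = v := Y.vertexOf_eq (by rw [hY]; simp) hh
  have hw : Y.vertexOf k = w := Y.vertexOf_eq (by rw [hY]; simp) hk
  have hnd := Y.nodup
  rw [hY] at hnd
  have n1 := List.nodup_append.1 hnd
  have n2 := List.nodup_cons.1 n1.2.1
  have n3 := List.nodup_append.1 n2.2
  have n4 := List.nodup_cons.1 n3.2.1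
  have hvP : v ∉ P := fun h => n1.2.2 v h v (by simp) rfl
  have hwP : w ∉ P := fun h => n1.2.2 w h w (by simp) rfl
  have hvM : v ∉ M := fun h => n2.1 (by simp [h])
  have hvS : v ∉ S := fun h => n2.1 (by simp [h])
  have hvw : v ≠ w := fun h => n2.1 (by simp [h])
  have hwM : w ∉ M := fun h => n3.2.2 w h w (by simp) rfl
  have iv : Y.verts.idxOf v = P.length := by
    rw [hY, List.idxOf_append_of_notMem hvP]; simp
  have iw : Y.verts.idxOf w = P.length + (M.length + 1) := by
    rw [hY, List.idxOf_append_of_notMem hwP, List.idxOf_cons_ne _ hvw,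
      List.idxOf_append_of_notMem hwM]
    simp
  have hfil : ∀ L : List (Finset ℕ), v ∉ L → w ∉ L →
      L.filter (fun u => decide (u ≠ v ∧ u ≠ w)) = L := by
    intro L h1 h2
    refine List.filter_eq_self.2 fun u hu => ?_
    simp only [ne_eq, decide_eq_true_eq]
    exact ⟨fun h => h1 (h ▸ hu), fun h => h2 (h ▸ hu)⟩
  have hoth : Y.verts.filter (fun u => decide (u ≠ v ∧ u ≠ w)) = P ++ M ++ S := by
    rw [hY, List.filter_append, List.filter_cons_of_neg (by simp), List.filter_append,
      List.filter_cons_of_neg (by simp), hfil P hvP hwP, hfil M hvM hwM, hfil S hvS n4.1,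
      List.append_assoc]
  have hD : edgeDer h k (∏ i ∈ Y.edges, X i : EdgePoly) =
      (if (h, k) ∈ Y.edges then ∏ i ∈ Y.edges.erase (h, k), X i else 0) -
        if (k, h) ∈ Y.edges then ∏ i ∈ Y.edges.erase (k, h), X i else 0 := by
    rw [edgeDer, Derivation.sub_apply, pderiv_prod, pderiv_prod]
  rw [hD]
  by_cases h1 : (h, k) ∈ Y.edges
  · have h2 : (k, h) ∉ Y.edges := edge_not_swap Y h1
    rw [if_pos h1, if_neg h2, if_pos h1, if_neg h2, sub_zero, add_zero, contractCls_eq_asm Y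
      ⟨h1, by simpa only [hv, hw] using hvw⟩]
    simp only [contractSign, merged, others, hv, hw, iv, iw, hoth]
    congr 1
    -- The exponent in `contractSign` is that of positions `P.length` and `P.length + M.length + 1`,
    -- reduced modulo two.
    rw [if_pos (by omega), show P.length + (P.length + (M.length + 1)) + 1 =
      2 * (P.length + 1) + M.length by ring, pow_add, pow_mul]
    simp
  · by_cases h2 : (k, h) ∈ Y.edges
    · rw [if_neg h1, if_pos h2, if_neg h1, if_pos h2, zero_sub, zero_add, contractCls_eq_asm Y
        ⟨h2, by simpa only [hv, hw] using hvw.symm⟩]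
      have hoth' : Y.verts.filter (fun u => decide (u ≠ w ∧ u ≠ v)) = P ++ M ++ S := by
        rw [← hoth]
        exact List.filter_congr fun u _ => by simp [and_comm]
      simp only [contractSign, merged, others, hv, hw, iv, iw, hoth']
      rw [map_neg, smul_neg, ← neg_smul, Finset.union_comm]
      congr 1
      -- For the opposite orientation the exponent is smaller by one, which accounts for the minus
      -- sign.
      rw [if_neg (by omega), show P.length + (M.length + 1) + P.length =
        2 * P.length + (M.length + 1) by ring, pow_add, pow_mul, pow_succ (-1 : ℂ) M.length]
      simp
    · simp [h1, h2]

/-- The edges are sorted by the pair of vertices that they join; edges inside one vertex are loops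
and contribute nothing. The index type `κ` keeps more than the vertices, because the bracket later
needs the words behind them. -/
theorem graphD_eq_pairSum {κ : Type*} (vs : κ → Finset ℕ) (Y : OrdGraph) (hs : List κ)
    (hY : Y.verts = hs.map vs) :
    graphD Y.cls = pairSum (cutTerm vs (∏ i ∈ Y.edges, X i)) [] hs := by
  have hg : ∀ x ∈ hs, (∑ h ∈ vs x, ∑ k ∈ vs x,
      if (h, k) ∈ Y.edges then Y.contractCls (h, k) else 0) = 0 := by
    intro x hx
    have hm : vs x ∈ Y.verts := hY ▸ List.mem_map_of_mem hx
    refine Finset.sum_eq_zero fun h hh => Finset.sum_eq_zero fun k hk => ?_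
    rw [contractCls_of_not, ite_self]
    rintro ⟨-, hne⟩
    exact hne ((Y.vertexOf_eq hm hh).trans (Y.vertexOf_eq hm hk).symm)
  rw [pairSum_eq (V := hs) (g := fun x y => ∑ h ∈ vs x, ∑ k ∈ vs y,
    if (h, k) ∈ Y.edges then Y.contractCls (h, k) else 0) ?_ hg [] hs rfl]
  · have h1 : ∀ F : Finset ℕ → GC, (hs.map fun x => F (vs x)).sum =
        ∑ v ∈ Y.verts.toFinset, F v := by
      intro F
      rw [List.sum_toFinset _ Y.nodup, hY, List.map_map]
      rfl
    have hdis : Set.PairwiseDisjoint (↑Y.verts.toFinset : Set (Finset ℕ)) id := by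
      intro v hv w hw hne
      exact Y.verts_disjoint.forall (by simpa using hv) (by simpa using hw) hne
    have h2 : ∀ F : ℕ → GC, (∑ v ∈ Y.verts.toFinset, ∑ h ∈ v, F h) =
        ∑ h ∈ Y.verts.toFinset.biUnion id, F h := fun F => (Finset.sum_biUnion hdis).symm
    have e1 : ∀ x, (hs.map fun y => ∑ h ∈ vs x, ∑ k ∈ vs y,
        if (h, k) ∈ Y.edges then Y.contractCls (h, k) else 0).sum =
        ∑ h ∈ vs x, ∑ k ∈ Y.verts.toFinset.biUnion id,
          if (h, k) ∈ Y.edges then Y.contractCls (h, k) else 0 := by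
      intro x
      rw [h1 fun w => ∑ h ∈ vs x, ∑ k ∈ w,
        if (h, k) ∈ Y.edges then Y.contractCls (h, k) else 0, Finset.sum_comm]
      exact Finset.sum_congr rfl fun h _ => h2 _
    simp only [e1]
    rw [h1 fun v => ∑ h ∈ v, ∑ k ∈ Y.verts.toFinset.biUnion id,
      if (h, k) ∈ Y.edges then Y.contractCls (h, k) else 0, h2, ← Finset.sum_product',
      ← Finset.sum_filter, graphD_cls]
    refine Finset.sum_congr ?_ fun _ _ => rfl
    ext e
    simp only [Finset.mem_filter, Finset.mem_product, Finset.mem_biUnion, List.mem_toFinset, id,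
      Prod.mk.eta]
    exact ⟨fun he => ⟨Y.edges_mem e he, he⟩, fun he => he.2⟩
  · intro pre x mid y post hV
    -- Each pair of half-edges contributes its two possible orientations, by `cut_edge`.
    rw [cutTerm, Finset.sum_comm (s := vs y), ← Finset.sum_add_distrib]
    refine Finset.sum_congr rfl fun h hh => ?_
    rw [← Finset.sum_add_distrib]
    refine Finset.sum_congr rfl fun k hk => ?_
    have := cut_edge Y (P := pre.map vs) (M := mid.map vs) (S := post.map vs) (v := vs x)
      (w := vs y) (by rw [hY, hV]; simp) hh hk
    rw [List.length_map] at this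
    rw [List.map_append, List.map_append, this]

/-! ### Linear maps on Hamiltonians and on the exterior superalgebra -/

section Lifts

variable {n m : ℕ} {W : Type*} [AddCommGroup W] [Module ℂ W]

/-- The relations between words in the coordinates which hold for monomials. -/
def wordRel (n m : ℕ) : Submodule ℂ (List (Coord n m) →₀ ℂ) :=
  Submodule.span ℂ {z | ∃ u a b v, z = Finsupp.single (u ++ a :: b :: v) 1 -
    ksign (par a * par b) • Finsupp.single (u ++ b :: a :: v) 1}

theorem wordRel_cons (a : Coord n m) :
    wordRel n m ≤ (wordRel n m).comap (Finsupp.lmapDomain ℂ ℂ (List.cons a)) := by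
  refine Submodule.span_le.2 ?_
  rintro _ ⟨u, b, c, v, rfl⟩
  refine Submodule.subset_span ⟨a :: u, b, c, v, ?_⟩
  rw [map_sub, map_smul, Finsupp.lmapDomain_apply, Finsupp.lmapDomain_apply,
    Finsupp.mapDomain_single, Finsupp.mapDomain_single]
  rfl

/-- Multiplication by a coordinate on words modulo relations. -/
def wordCons (a : Coord n m) : Module.End ℂ ((List (Coord n m) →₀ ℂ) ⧸ wordRel n m) :=
  (wordRel n m).mapQ (wordRel n m) (Finsupp.lmapDomain ℂ ℂ (List.cons a)) (wordRel_cons a)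

theorem wordCons_mkQ (a : Coord n m) (w : List (Coord n m)) :
    wordCons a ((wordRel n m).mkQ (Finsupp.single w 1)) =
      (wordRel n m).mkQ (Finsupp.single (a :: w) 1) := by
  rw [wordCons, Submodule.mkQ_apply, Submodule.mapQ_apply, Finsupp.lmapDomain_apply,
    Finsupp.mapDomain_single]
  rfl

/-- The action of Hamiltonians on words modulo relations. -/
def hamWord (n m : ℕ) : Ham n m →ₐ[ℂ] Module.End ℂ ((List (Coord n m) →₀ ℂ) ⧸ wordRel n m) :=
  Ham.lift (FreeAlgebra.lift ℂ wordCons) <| by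
    rintro _ _ ⟨a, b⟩
    simp only [map_mul, map_smul, FreeAlgebra.lift_ι_apply]
    refine Submodule.linearMap_qext _ (Finsupp.lhom_ext' fun w => LinearMap.ext_ring ?_)
    change wordCons a (wordCons b ((wordRel n m).mkQ (Finsupp.single w 1))) =
      ksign (par a * par b) • wordCons b (wordCons a ((wordRel n m).mkQ (Finsupp.single w 1)))
    rw [wordCons_mkQ, wordCons_mkQ, wordCons_mkQ, wordCons_mkQ, ← map_smul, ← sub_eq_zero,
      ← map_sub, Submodule.mkQ_apply, Submodule.Quotient.mk_eq_zero]
    exact Submodule.subset_span ⟨[], a, b, w, rfl⟩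

/-- The class of the empty word is a cyclic vector from which a monomial recovers its word.
Evaluation there turns a function on words that respects the relations into a linear map on
Hamiltonians. -/
theorem hamWord_mono (w : List (Coord n m)) :
    hamWord n m (mono w) ((wordRel n m).mkQ (Finsupp.single [] 1)) =
      (wordRel n m).mkQ (Finsupp.single w 1) := by
  induction w with
  | nil => simp [mono]
  | cons a w ih =>
    rw [mono_cons, map_mul, Module.End.mul_apply, ih, hamWord, gen, Ham.lift_mk,
      FreeAlgebra.lift_ι_apply, wordCons_mkQ]

/-- A supersymmetric function on words extends to the Hamiltonians. -/
theorem exists_ham_lift (φ : List (Coord n m) → W) (hφ : SwapInv par φ) :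
    ∃ f : Ham n m →ₗ[ℂ] W, ∀ w, f (mono w) = φ w := by
  have h : wordRel n m ≤ LinearMap.ker (Finsupp.linearCombination ℂ φ) := by
    refine Submodule.span_le.2 ?_
    rintro _ ⟨u, a, b, v, rfl⟩
    simp [hφ u a b v]
  refine ⟨((wordRel n m).liftQ (Finsupp.linearCombination ℂ φ) h).comp
    ((LinearMap.applyₗ ((wordRel n m).mkQ (Finsupp.single [] 1))).comp
      (hamWord n m).toLinearMap), fun w => ?_⟩
  rw [LinearMap.comp_apply, LinearMap.comp_apply, LinearMap.applyₗ_apply_apply,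
    AlgHom.toLinearMap_apply, hamWord_mono, Submodule.mkQ_apply, Submodule.liftQ_apply]
  simp

/-! ### The same construction for the exterior superalgebra. -/

/-- The relations between lists of words which hold for wedge products of monomials. -/
def wedgeRel (n m : ℕ) : Submodule ℂ (List (List (Coord n m)) →₀ ℂ) :=
  Submodule.span ℂ ({z | ∃ A B u a b v, z = Finsupp.single (A ++ (u ++ a :: b :: v) :: B) 1 -
      ksign (par a * par b) • Finsupp.single (A ++ (u ++ b :: a :: v) :: B) 1} ∪
    {z | ∃ A B u v, z = Finsupp.single (A ++ u :: v :: B) 1 +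
      ksign (wpar u * wpar v) • Finsupp.single (A ++ v :: u :: B) 1})

theorem wedgeRel_cons (w : List (Coord n m)) :
    wedgeRel n m ≤ (wedgeRel n m).comap (Finsupp.lmapDomain ℂ ℂ (List.cons w)) := by
  refine Submodule.span_le.2 ?_
  rintro _ (⟨A, B, u, a, b, v, rfl⟩ | ⟨A, B, u, v, rfl⟩)
  · refine Submodule.subset_span (Or.inl ⟨w :: A, B, u, a, b, v, ?_⟩)
    rw [map_sub, map_smul, Finsupp.lmapDomain_apply, Finsupp.lmapDomain_apply,
      Finsupp.mapDomain_single, Finsupp.mapDomain_single]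
    rfl
  · refine Submodule.subset_span (Or.inr ⟨w :: A, B, u, v, ?_⟩)
    rw [map_add, map_smul, Finsupp.lmapDomain_apply, Finsupp.lmapDomain_apply,
      Finsupp.mapDomain_single, Finsupp.mapDomain_single]
    rfl

/-- Exterior multiplication by a monomial on lists of words modulo relations. -/
def wedgeCons (w : List (Coord n m)) :
    Module.End ℂ ((List (List (Coord n m)) →₀ ℂ) ⧸ wedgeRel n m) :=
  (wedgeRel n m).mapQ (wedgeRel n m) (Finsupp.lmapDomain ℂ ℂ (List.cons w)) (wedgeRel_cons w)

theorem wedgeCons_mkQ (w : List (Coord n m)) (l : List (List (Coord n m))) :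
    wedgeCons w ((wedgeRel n m).mkQ (Finsupp.single l 1)) =
      (wedgeRel n m).mkQ (Finsupp.single (w :: l) 1) := by
  rw [wedgeCons, Submodule.mkQ_apply, Submodule.mapQ_apply, Finsupp.lmapDomain_apply,
    Finsupp.mapDomain_single]
  rfl

/-- The first family in `wedgeRel` is what allows `wedgeCons` to be extended from words to
Hamiltonians; the second one gives `wedgeCons_mul`, the relation of the exterior superalgebra. -/
theorem wedgeCons_swapInv : SwapInv par (wedgeCons (n := n) (m := m)) := by
  intro u a b v
  refine Submodule.linearMap_qext _ (Finsupp.lhom_ext' fun l => LinearMap.ext_ring ?_)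
  change wedgeCons _ ((wedgeRel n m).mkQ (Finsupp.single l 1)) =
    ksign (par a * par b) • wedgeCons _ ((wedgeRel n m).mkQ (Finsupp.single l 1))
  rw [wedgeCons_mkQ, wedgeCons_mkQ, ← map_smul, ← sub_eq_zero, ← map_sub, Submodule.mkQ_apply,
    Submodule.Quotient.mk_eq_zero]
  exact Submodule.subset_span (Or.inl ⟨[], l, u, a, b, v, rfl⟩)

theorem wedgeCons_mul (u v : List (Coord n m)) :
    wedgeCons u * wedgeCons v = -(ksign (wpar u * wpar v) • (wedgeCons v * wedgeCons u)) := by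
  refine Submodule.linearMap_qext _ (Finsupp.lhom_ext' fun l => LinearMap.ext_ring ?_)
  change wedgeCons u (wedgeCons v ((wedgeRel n m).mkQ (Finsupp.single l 1))) =
    -(ksign (wpar u * wpar v) • wedgeCons v (wedgeCons u ((wedgeRel n m).mkQ
      (Finsupp.single l 1))))
  rw [wedgeCons_mkQ, wedgeCons_mkQ, wedgeCons_mkQ, wedgeCons_mkQ, ← map_smul,
    eq_neg_iff_add_eq_zero, ← map_add, Submodule.mkQ_apply, Submodule.Quotient.mk_eq_zero]
  exact Submodule.subset_span (Or.inr ⟨[], l, u, v, rfl⟩)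

/-- Because of this, the relation of the exterior superalgebra need only be checked on monomials of
the given parities. -/
theorem tgPart_le_span (ε : ZMod 2) : tgPart n m ε ≤
    Submodule.span ℂ {f | ∃ w : Word n m, wpar w.1 = ε ∧ f = monoTg w} := by
  intro f hf
  have h1 : homGe n m 3 ε ≤ (Submodule.span ℂ
      {f | ∃ w : Word n m, wpar w.1 = ε ∧ f = monoTg w}).map (ordGe n m 3).subtype := by
    refine Submodule.span_le.2 ?_
    rintro _ ⟨w, hw, he, rfl⟩
    exact ⟨monoTg ⟨w, hw⟩, Submodule.subset_span ⟨⟨w, hw⟩, he, rfl⟩, rfl⟩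
  obtain ⟨g, hg, hgf⟩ := h1 hf
  rwa [← (Subtype.ext hgf : g = f)]

theorem span_monoTg : Submodule.span ℂ (Set.range (monoTg (n := n) (m := m))) = ⊤ := by
  refine eq_top_iff.2 fun f _ => ?_
  have h1 : ordGe n m 3 ≤ (Submodule.span ℂ (Set.range (monoTg (n := n) (m := m)))).map
      (ordGe n m 3).subtype := by
    refine Submodule.span_le.2 ?_
    rintro _ ⟨w, hw, rfl⟩
    exact ⟨monoTg ⟨w, hw⟩, Submodule.subset_span ⟨⟨w, hw⟩, rfl⟩, rfl⟩
  obtain ⟨g, hg, hgf⟩ := h1 f.2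
  rwa [← (Subtype.ext hgf : g = f)]

/-- A function on lists of words which respects the relations extends to the exterior
superalgebra. -/
theorem exists_ext_lift (F : List (List (Coord n m)) → W)
    (hl : ∀ A B, SwapInv par fun w => F (A ++ w :: B))
    (hw : ∀ A B u v, F (A ++ u :: v :: B) = -(ksign (wpar u * wpar v) • F (A ++ v :: u :: B))) :
    ∃ Ψ : SuperExt (tgPart n m) →ₗ[ℂ] W, ∀ ws : List (Word n m),
      Ψ (wedge (tgPart n m) (ws.map monoTg)) = F (ws.map Subtype.val) := by
  obtain ⟨f, hf⟩ := exists_ham_lift wedgeCons (wedgeCons_swapInv (n := n) (m := m))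
  let f' := f.comp (ordGe n m 3).subtype
  have hf' : ∀ w : Word n m, f' (monoTg w) = wedgeCons w.1 := fun w => hf w.1
  have hrel : ∀ i j a b, a ∈ tgPart n m i → b ∈ tgPart n m j →
      f' a * f' b = -(ksign (i * j) • (f' b * f' a)) := by
    intro i j a b ha hb
    refine Submodule.span_induction
      (p := fun a _ => f' a * f' b = -(ksign (i * j) • (f' b * f' a)))
      ?_ ?_ ?_ ?_ (tgPart_le_span i ha)
    · rintro _ ⟨u, rfl, rfl⟩
      refine Submodule.span_induction
        (p := fun b _ => f' (monoTg u) * f' b = -(ksign (wpar u.1 * j) • (f' b * f' (monoTg u))))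
        ?_ ?_ ?_ ?_ (tgPart_le_span j hb)
      · rintro _ ⟨v, rfl, rfl⟩
        rw [hf', hf', wedgeCons_mul]
      · simp
      · intro x y _ _ hx hy
        rw [map_add, mul_add, hx, hy, add_mul, smul_add, neg_add]
      · intro c x _ hx
        rw [map_smul, mul_smul_comm, hx, smul_mul_assoc, smul_neg, smul_comm]
    · simp
    · intro x y _ _ hx hy
      rw [map_add, add_mul, hx, hy, mul_add, smul_add, neg_add]
    · intro c x _ hx
      rw [map_smul, smul_mul_assoc, hx, mul_smul_comm, smul_neg, smul_comm]
  let e := SuperExt.lift f' hrel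
  -- As for Hamiltonians, the class of the empty list is the vector at which the action is
  -- evaluated.
  have he : ∀ ws : List (Word n m), e (wedge (tgPart n m) (ws.map monoTg))
      ((wedgeRel n m).mkQ (Finsupp.single [] 1)) =
        (wedgeRel n m).mkQ (Finsupp.single (ws.map Subtype.val) 1) := by
    intro ws
    induction ws with
    | nil => simp [wedge]
    | cons w ws ih =>
      rw [List.map_cons, SuperBracket.wedge_cons, map_mul, Module.End.mul_apply, ih,
        SuperExt.lift_ι, hf', wedgeCons_mkQ, List.map_cons]
  have h : wedgeRel n m ≤ LinearMap.ker (Finsupp.linearCombination ℂ F) := by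
    refine Submodule.span_le.2 ?_
    rintro _ (⟨A, B, u, a, b, v, rfl⟩ | ⟨A, B, u, v, rfl⟩)
    · have := hl A B u a b v
      simp only at this
      simp [this]
    · simp [hw A B u v]
  refine ⟨((wedgeRel n m).liftQ (Finsupp.linearCombination ℂ F) h).comp
    ((LinearMap.applyₗ ((wedgeRel n m).mkQ (Finsupp.single [] 1))).comp e.toLinearMap),
    fun ws => ?_⟩
  rw [LinearMap.comp_apply, LinearMap.comp_apply, LinearMap.applyₗ_apply_apply,
    AlgHom.toLinearMap_apply, he, Submodule.mkQ_apply, Submodule.liftQ_apply]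
  simp

/-- The exterior superalgebra is spanned by the wedge products of monomials. -/
theorem span_wedge_monoTg : Submodule.span ℂ
    (Set.range fun ws : List (Word n m) => wedge (tgPart n m) (ws.map monoTg)) = ⊤ := by
  refine eq_top_iff.2 fun w _ => ?_
  refine SuperExt.induction (tgPart_sup (n := n) (m := m)) ?_ ?_ w
  · exact Submodule.subset_span ⟨[], by simp [wedge]⟩
  · intro i a _ w hw
    have ha : a ∈ Submodule.span ℂ (Set.range (monoTg (n := n) (m := m))) :=
      span_monoTg ▸ Submodule.mem_top
    have h : ∀ x : Word n m, SuperExt.ι (tgPart n m) (monoTg x) * w ∈ Submodule.span ℂ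
        (Set.range fun ws : List (Word n m) => wedge (tgPart n m) (ws.map monoTg)) := by
      intro x
      refine Submodule.span_induction (p := fun w _ =>
        SuperExt.ι (tgPart n m) (monoTg x) * w ∈ Submodule.span ℂ
        (Set.range fun ws : List (Word n m) => wedge (tgPart n m) (ws.map monoTg))) ?_ ?_ ?_ ?_ hw
      · rintro _ ⟨ws, rfl⟩
        exact Submodule.subset_span ⟨x :: ws, by simp [SuperBracket.wedge_cons]⟩
      · simp
      · intro y z _ _ hy hz
        rw [mul_add]; exact Submodule.add_mem _ hy hz
      · intro c y _ hy
        rw [mul_smul_comm]; exact Submodule.smul_mem _ c hy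
    refine Submodule.span_induction (p := fun a _ =>
        SuperExt.ι (tgPart n m) a * w ∈ Submodule.span ℂ
        (Set.range fun ws : List (Word n m) => wedge (tgPart n m) (ws.map monoTg))) ?_ ?_ ?_ ?_ ha
    · rintro _ ⟨x, rfl⟩
      exact h x
    · simp
    · intro y z _ _ hy hz
      rw [map_add, add_mul]; exact Submodule.add_mem _ hy hz
    · intro c y _ hy
      rw [map_smul, smul_mul_assoc]; exact Submodule.smul_mem _ c hy

end Lifts

/-! ### The linear combination of graphs of a list of words -/

section Labelling

variable {n m : ℕ}

/-- The word `w` with its letters labelled by `s, s + 1, …`. -/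
def lab : ℕ → List (Coord n m) → List (Lab n m)
  | _, [] => []
  | s, a :: w => (s, a) :: lab (s + 1) w

/-- The list of words `ws` with its letters labelled by `s, s + 1, …`. -/
def std : ℕ → List (List (Coord n m)) → List (List (Lab n m))
  | _, [] => []
  | s, w :: ws => lab s w :: std (s + w.length) ws

theorem lab_append (s : ℕ) (u v : List (Coord n m)) :
    lab s (u ++ v) = lab s u ++ lab (s + u.length) v := by
  induction u generalizing s with
  | nil => rfl
  | cons a u ih => simp [lab, ih, add_assoc, add_comm 1]

theorem std_append (s : ℕ) (A B : List (List (Coord n m))) :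
    std s (A ++ B) = std s A ++ std (s + A.flatten.length) B := by
  induction A generalizing s with
  | nil => rfl
  | cons a A ih => simp only [List.cons_append, std, ih, List.flatten_cons, List.length_append,
      add_assoc]

theorem std_flatten (s : ℕ) (ws : List (List (Coord n m))) :
    (std s ws).flatten = lab s ws.flatten := by
  induction ws generalizing s with
  | nil => rfl
  | cons w ws ih => rw [std, List.flatten_cons, ih, List.flatten_cons, lab_append]

theorem lab_fst (s : ℕ) (w : List (Coord n m)) :
    (lab s w).map Prod.fst = List.range' s w.length := by
  induction w generalizing s with
  | nil => rfl
  | cons a w ih => simp [lab, ih, List.range'_succ]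

theorem lab_snd (s : ℕ) (w : List (Coord n m)) : (lab s w).map Prod.snd = w := by
  induction w generalizing s with
  | nil => rfl
  | cons a w ih => simp [lab, ih]

theorem std_snd (s : ℕ) (ws : List (List (Coord n m))) :
    (std s ws).map (List.map Prod.snd) = ws := by
  induction ws generalizing s with
  | nil => rfl
  | cons w ws ih => rw [std, List.map_cons, lab_snd, ih]

theorem vset_lab (s : ℕ) (w : List (Coord n m)) : vset (lab s w) = Finset.Ico s (s + w.length) := by
  ext a
  rw [vset, lab_fst, List.mem_toFinset, List.mem_range'_1, Finset.mem_Ico]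

theorem std_vset (s : ℕ) (ws : List (List (Coord n m))) :
    (std s ws).map vset = intervals s (ws.map List.length) := by
  induction ws generalizing s with
  | nil => rfl
  | cons w ws ih => rw [std, List.map_cons, ih, vset_lab, List.map_cons, intervals]

theorem std_nodup (ws : List (List (Coord n m))) : ((std 0 ws).flatten.map Prod.fst).Nodup := by
  rw [std_flatten, lab_fst]
  exact List.nodup_range'

theorem exists_injective_extending {L : List ℕ} (hL : L.Nodup) :
    ∃ τ : ℕ → ℕ, Function.Injective τ ∧ (List.range' 0 L.length).map τ = L := by
  have hB : ∀ a ∈ L, a < L.sum + 1 := fun a ha => Nat.lt_succ_of_le (List.le_sum_of_mem ha)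
  -- Beyond the list, the shift by `L.sum + 1` exceeds every entry, so no value is repeated.
  refine ⟨fun i => if h : i < L.length then L[i] else i + (L.sum + 1), ?_, ?_⟩
  · intro i j h
    simp only at h
    split_ifs at h with h1 h2 h2
    · exact (hL.getElem_inj_iff).1 h
    · have := hB _ (List.getElem_mem h1); omega
    · have := hB _ (List.getElem_mem h2); omega
    · omega
  · refine List.ext_getElem (by simp) fun i h1 h2 => ?_
    simp [h2]

theorem lab_relabel {τ : ℕ → ℕ} (u : List (Lab n m)) (s : ℕ)
    (h : (List.range' s u.length).map τ = u.map Prod.fst) :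
    (lab s (u.map Prod.snd)).map (Prod.map τ id) = u := by
  induction u generalizing s with
  | nil => rfl
  | cons a u ih =>
    rw [List.length_cons, List.range'_succ, List.map_cons, List.map_cons, List.cons.injEq] at h
    rw [List.map_cons, lab, List.map_cons, ih _ h.2, Prod.map_apply, h.1]
    rfl

/-- A labelled list of words is the standard one transported along any map that sends the standard
labels to the given ones in order. -/
theorem std_relabel {τ : ℕ → ℕ} (hs : List (List (Lab n m))) (s : ℕ)
    (h : (List.range' s hs.flatten.length).map τ = hs.flatten.map Prod.fst) :
    (std s (hs.map (List.map Prod.snd))).map (List.map (Prod.map τ id)) = hs := by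
  induction hs generalizing s with
  | nil => rfl
  | cons u hs ih =>
    rw [List.flatten_cons, List.length_append, ← List.range'_append_1, List.map_append,
      List.map_append] at h
    obtain ⟨h1, h2⟩ := List.append_inj h (by simp)
    rw [List.map_cons, std, List.map_cons, lab_relabel u s h1, List.length_map, ih _ h2]

/-- The linear combination of graphs given by a list of words. -/
def wordSum (ws : List (List (Coord n m))) : GC := graphSum (std 0 ws)

/-- The labels do not matter as long as they are distinct. Letters can therefore be moved or removed
with their labels, and no renumbering is needed afterwards. -/
theorem wordSum_eq_graphSum {hs : List (List (Lab n m))} (h : (hs.flatten.map Prod.fst).Nodup) :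
    wordSum (hs.map (List.map Prod.snd)) = graphSum hs := by
  obtain ⟨τ, hτ, hτ'⟩ := exists_injective_extending h
  rw [List.length_map] at hτ'
  conv_rhs => rw [← std_relabel hs 0 hτ']
  rw [wordSum]
  exact (graphSum_map hτ _).symm

theorem vset_perm {u v : List (Lab n m)} (h : u.Perm v) : vset u = vset v := by
  ext a
  simp only [vset, List.mem_toFinset]
  exact (h.map _).mem_iff

/-- A vertex is the set of its half-edges and does not notice the exchange, so only the
supersymmetry of `wk` matters. -/
theorem graphSum_swap_letters (A B : List (List (Lab n m))) (u v : List (Lab n m))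
    (a b : Lab n m) : graphSum (A ++ (u ++ a :: b :: v) :: B) =
      ksign (cpar a * cpar b) • graphSum (A ++ (u ++ b :: a :: v) :: B) := by
  have hv : vset (u ++ a :: b :: v) = vset (u ++ b :: a :: v) :=
    vset_perm (List.Perm.append_left u (List.Perm.swap _ _ _))
  have hw := wk_swapInv (A.flatten ++ u) a b (v ++ B.flatten)
  simp only [graphSum, List.map_append, List.map_cons, hv, List.flatten_append, List.flatten_cons,
    List.append_assoc, List.cons_append] at hw ⊢
  rw [hw, map_smul]

/-- Moving one block of letters past another gives the Koszul sign, and exchanging the two vertices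
gives the minus sign. -/
theorem graphSum_swap_words (A B : List (List (Lab n m))) (u v : List (Lab n m)) :
    graphSum (A ++ u :: v :: B) =
      -(ksign (lpar cpar u * lpar cpar v) • graphSum (A ++ v :: u :: B)) := by
  have hw := wk_swapInv.block A.flatten u v B.flatten
  simp only [graphSum, List.map_append, List.map_cons, List.flatten_append, List.flatten_cons,
    List.append_assoc] at hw ⊢
  rw [hw, map_smul, asm_swap, smul_neg]

theorem lpar_lab (s : ℕ) (w : List (Coord n m)) : lpar cpar (lab s w) = wpar w := by
  induction w generalizing s with
  | nil => rfl
  | cons a w ih => rw [lab, lpar_cons, ih, wpar_cons]; rfl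

theorem wordSum_swapInv (A B : List (List (Coord n m))) :
    SwapInv par fun w => wordSum (A ++ w :: B) := by
  intro u a b v
  have hl : ∀ a b : Coord n m, std 0 (A ++ (u ++ a :: b :: v) :: B) =
      std 0 A ++ (lab (A.flatten.length) u ++ (A.flatten.length + u.length, a) ::
        (A.flatten.length + u.length + 1, b) :: lab (A.flatten.length + u.length + 1 + 1) v) ::
        std (A.flatten.length + (u.length + (v.length + 1 + 1))) B := by
    intro a b
    simp only [std_append, std, lab_append, lab, List.length_append, List.length_cons, zero_add]
  have hn := std_nodup (A ++ (u ++ a :: b :: v) :: B)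
  simp only [wordSum]
  rw [hl] at hn
  -- The letters are exchanged together with their labels; the nonstandard labelling that results is
  -- then forgotten.
  rw [hl, graphSum_swap_letters, ← wordSum_eq_graphSum]
  · simp only [List.map_append, List.map_cons, std_snd, lab_snd]
    rfl
  · refine List.Perm.nodup (List.Perm.map _ ?_) hn
    simp only [List.flatten_append, List.flatten_cons, List.append_assoc, List.cons_append]
    exact List.Perm.append_left _ (List.Perm.append_left _ (List.Perm.swap _ _ _))

theorem wordSum_swap (A B : List (List (Coord n m))) (u v : List (Coord n m)) :
    wordSum (A ++ u :: v :: B) =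
      -(ksign (wpar u * wpar v) • wordSum (A ++ v :: u :: B)) := by
  have hn := std_nodup (A ++ u :: v :: B)
  rw [wordSum]
  simp only [std_append, std] at hn ⊢
  rw [graphSum_swap_words, ← wordSum_eq_graphSum, lpar_lab, lpar_lab]
  · simp only [List.map_append, List.map_cons, std_snd, lab_snd]
  · refine List.Perm.nodup (List.Perm.map _ ?_) hn
    refine List.Perm.flatten ?_
    exact List.Perm.append_left _ (List.Perm.swap _ _ _)

theorem lab_eq_map_finRange (s : ℕ) (w : List (Coord n m)) {N : ℕ} (h : w.length = N) :
    lab s w = (List.finRange N).map fun i => (s + i.val, w.get (i.cast h.symm)) := by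
  subst h
  induction w generalizing s with
  | nil => rfl
  | cons a w ih =>
    change _ = List.map (fun i : Fin (w.length + 1) => (s + i.val, (a :: w).get i))
      (List.finRange (w.length + 1))
    rw [lab, ih, List.finRange_succ, List.map_cons, List.map_map]
    congr 1
    refine List.map_congr_left fun i _ => ?_
    simp [add_assoc, add_comm 1]

/-- The set of edges of a chord diagram. -/
def chordEdges {N : ℕ} (c : Finset (Fin N × Fin N)) : Finset (ℕ × ℕ) :=
  c.image fun e => (e.1.val, e.2.val)

/-- In a canonically oriented chord the smaller half-edge comes first, where `edgeVar` is the plain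
variable; the product over the chords is then the monomial of the edges. -/
theorem wk_finRange {N : ℕ} (x : Fin N → Coord n m) :
    wk ((List.finRange N).map fun i => (i.val, x i)) =
      ∑ c ∈ chordDiagrams N, beta c x • ∏ e ∈ chordEdges c, (MvPolynomial.X e : EdgePoly) := by
  have h1 := wick_map (p := cpar) (Q := pairing edgeVar) (R := EdgePoly) (R' := EdgePoly)
    (fun i : Fin N => (i.val, x i)) (AlgHom.id ℂ EdgePoly) (q := fun i => par (x i))
    (fun _ => rfl) (S := fun i j => form (x i) (x j) • edgeVar i j) (fun _ _ => rfl)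
    (List.finRange N)
  have h2 := wick_eq_sum_chords (p := fun i => par (x i)) (R := EdgePoly)
    (Q := fun i j : Fin N => form (x i) (x j) • edgeVar i j)
    (fun s t h => by simp only [form_eq_zero h, zero_smul]) N (List.finRange N)
    (List.length_finRange) (List.pairwise_lt_finRange N)
  rw [h2, List.toFinset_finRange, ← chordDiagrams_eq] at h1
  refine h1.trans (Finset.sum_congr rfl fun c hc => ?_)
  rw [chordDiagrams_eq, mem_chords] at hc
  have h3 : ∏ e ∈ chordEdges c, (MvPolynomial.X e : EdgePoly) =
      ∏ e ∈ c, edgeVar e.1.val e.2.val := by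
    rw [chordEdges, Finset.prod_image]
    · refine Finset.prod_congr rfl fun e he => ?_
      rw [edgeVar, if_pos (Fin.lt_def.1 (hc.2.1 e he))]
    · intro e _ f _ h
      exact Prod.ext (Fin.ext (congrArg Prod.fst h)) (Fin.ext (congrArg Prod.snd h))
  rw [chordTerm, Finset.prod_smul, smul_smul, h3, beta, koszul_eq_kz]
  rfl

theorem wk_std (ws : List (Word n m)) :
    wk (std 0 (ws.map Subtype.val)).flatten =
      ∑ c ∈ (chordDiagrams (lengths ws).sum).attach, beta c.1 (letters ws) •
        ∏ e ∈ (chordGraph (lengths ws) (three_le_lengths ws) c.1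
            (chordDiagrams_oriented c.2)).edges, (MvPolynomial.X e : EdgePoly) := by
  rw [std_flatten, ← List.flatMap_def, lab_eq_map_finRange 0 _ (length_flatMap ws)]
  simp only [zero_add]
  refine (wk_finRange (letters ws)).trans ?_
  rw [← Finset.sum_attach]
  rfl

theorem std_vset_lengths (ws : List (Word n m)) :
    (std 0 (ws.map Subtype.val)).map vset = intervals 0 (lengths ws) := by
  rw [std_vset, List.map_map]
  rfl

theorem wordSum_eq_sum (ws : List (Word n m)) : wordSum (ws.map Subtype.val) =
    ∑ c ∈ (chordDiagrams (lengths ws).sum).attach, beta c.1 (letters ws) •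
      (chordGraph (lengths ws) (three_le_lengths ws) c.1 (chordDiagrams_oriented c.2)).cls := by
  rw [wordSum, graphSum, wk_std, map_sum]
  refine Finset.sum_congr rfl fun c _ => ?_
  rw [map_smul, asm_prod_finset, ← gv_cls, std_vset_lengths]
  rfl

theorem cutTerm_sum {κ ι : Type*} (vs : κ → Finset ℕ) (S : Finset ι) (c : ι → ℂ)
    (r : ι → EdgePoly) : cutTerm vs (∑ i ∈ S, c i • r i) =
      fun pre x mid y post => ∑ i ∈ S, c i • cutTerm vs (r i) pre x mid y post := by
  funext pre x mid y post
  simp only [cutTerm, map_sum, Derivation.map_smul, map_smul, Finset.smul_sum]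
  symm
  rw [Finset.sum_comm]
  refine Finset.sum_congr rfl fun h _ => ?_
  rw [Finset.sum_comm]
  refine Finset.sum_congr rfl fun k _ => Finset.sum_congr rfl fun i _ => ?_
  rw [smul_comm]

theorem followSum_sum {κ ι : Type*} (S : Finset ι) (c : ι → ℂ)
    (f : ι → List κ → κ → List κ → κ → List κ → GC) (pre : List κ) (x : κ) (mid W : List κ) :
    followSum (fun pre x mid y post => ∑ i ∈ S, c i • f i pre x mid y post) pre x mid W =
      ∑ i ∈ S, c i • followSum (f i) pre x mid W := by
  induction W generalizing mid with
  | nil => simp [followSum]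
  | cons y W ih => simp only [followSum, ih, smul_add, Finset.sum_add_distrib]

theorem pairSum_sum {κ ι : Type*} (S : Finset ι) (c : ι → ℂ)
    (f : ι → List κ → κ → List κ → κ → List κ → GC) (pre W : List κ) :
    pairSum (fun pre x mid y post => ∑ i ∈ S, c i • f i pre x mid y post) pre W =
      ∑ i ∈ S, c i • pairSum (f i) pre W := by
  induction W generalizing pre with
  | nil => simp [pairSum]
  | cons x W ih => simp only [pairSum, followSum_sum, ih, smul_add, Finset.sum_add_distrib]

/-- All graphs in the combination have the same vertices, and the cut terms are linear in the
polynomial, so the boundaries can be added up inside. -/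
theorem graphD_wordSum (ws : List (Word n m)) : graphD (wordSum (ws.map Subtype.val)) =
    pairSum (cutTerm vset (wk (std 0 (ws.map Subtype.val)).flatten)) []
      (std 0 (ws.map Subtype.val)) := by
  rw [wordSum_eq_sum, map_sum, wk_std, cutTerm_sum, pairSum_sum]
  refine Finset.sum_congr rfl fun c _ => ?_
  rw [map_smul, graphD_eq_pairSum vset _ _ (std_vset_lengths ws).symm]

theorem exists_wordSum_lift : ∃ Ψ : SuperExt (tgPart n m) →ₗ[ℂ] GC, ∀ ws : List (Word n m),
    Ψ (wedge (tgPart n m) (ws.map monoTg)) = wordSum (ws.map Subtype.val) :=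
  exists_ext_lift wordSum wordSum_swapInv wordSum_swap

end Labelling

/-! ### Invariance under the orthosymplectic Lie superalgebra -/

section Invariance

variable {n m : ℕ}

/-- The monomial of the letters of a labelled word of length at least three (zero for shorter
words). -/
def tgMono (u : List (Lab n m)) : tg n m :=
  if h : 3 ≤ u.length then monoTg ⟨u.map Prod.snd, by simpa using h⟩ else 0

theorem tgMono_val {u : List (Lab n m)} (h : 3 ≤ u.length) :
    (tgMono u).1 = mono (u.map Prod.snd) := by
  rw [tgMono, dif_pos h]
  rfl

theorem wpar_map_snd (u : List (Lab n m)) : wpar (u.map Prod.snd) = lpar cpar u := by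
  rw [wpar, List.map_map]
  rfl

theorem tgMono_mem (u : List (Lab n m)) : tgMono u ∈ tgPart n m (lpar cpar u) := by
  by_cases h : 3 ≤ u.length
  · change (tgMono u).1 ∈ homGe n m 3 _
    rw [tgMono_val h, ← wpar_map_snd]
    exact homGe_anti (by simpa using h) (mono_mem_homGe le_rfl)
  · rw [tgMono, dif_neg h]
    exact Submodule.zero_mem _

/-- The wedge product of the monomials of labelled words. -/
def lwedge (hs : List (List (Lab n m))) : SuperExt (tgPart n m) :=
  wedge (tgPart n m) (hs.map tgMono)

theorem lwedge_cons (u : List (Lab n m)) (hs : List (List (Lab n m))) :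
    lwedge (u :: hs) = SuperExt.ι (tgPart n m) (tgMono u) * lwedge hs := by
  rw [lwedge, List.map_cons, SuperBracket.wedge_cons, lwedge]

theorem lwedge_nil : lwedge ([] : List (List (Lab n m))) = 1 := by simp [lwedge, wedge]

theorem lwedge_append (A B : List (List (Lab n m))) :
    lwedge (A ++ B) = lwedge A * lwedge B := by
  simp [lwedge, wedge]

/-- The labelled words in `hs` have length at least three and the labels are distinct. -/
def Labelled (hs : List (List (Lab n m))) : Prop :=
  (∀ u ∈ hs, 3 ≤ u.length) ∧ (hs.flatten.map Prod.fst).Nodup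

theorem lwedge_std (ws : List (Word n m)) :
    lwedge (std 0 (ws.map Subtype.val)) = wedge (tgPart n m) (ws.map monoTg) := by
  have h : ∀ s, (std s (ws.map Subtype.val)).map tgMono = ws.map monoTg := by
    induction ws with
    | nil => intro s; rfl
    | cons w ws ih =>
      intro s
      rw [List.map_cons, std, List.map_cons, ih, List.map_cons]
      congr 1
      have hl := congrArg List.length (lab_snd s w.1)
      rw [List.length_map] at hl
      refine Subtype.ext ?_
      rw [tgMono_val (hl ▸ w.2), lab_snd]
      rfl
  rw [lwedge, h]

theorem labelled_std (ws : List (Word n m)) : Labelled (std 0 (ws.map Subtype.val)) := by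
  refine ⟨?_, std_nodup _⟩
  have h : ∀ s, ∀ u ∈ std s (ws.map Subtype.val), 3 ≤ u.length := by
    induction ws with
    | nil => intro s u hu; cases hu
    | cons w ws ih =>
      intro s u hu
      rcases List.mem_cons.1 hu with rfl | hu
      · have hl := congrArg List.length (lab_snd s w.1)
        rw [List.length_map] at hl
        exact hl ▸ w.2
      · exact ih _ u hu
  exact h 0

/-- The linear map `Ψ` sends a wedge product of monomials to its combination of graphs. -/
def IsWordLift (Ψ : SuperExt (tgPart n m) →ₗ[ℂ] GC) : Prop :=
  ∀ ws : List (Word n m), Ψ (wedge (tgPart n m) (ws.map monoTg)) = wordSum (ws.map Subtype.val)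

variable {Ψ : SuperExt (tgPart n m) →ₗ[ℂ] GC}

/-- This passes from the standard labels, for which `Ψ` is specified, to arbitrary distinct ones. -/
theorem lift_lwedge (hΨ : IsWordLift Ψ) {hs : List (List (Lab n m))} (h : Labelled hs) :
    Ψ (lwedge hs) = graphSum hs := by
  obtain ⟨h3, hn⟩ := h
  have h1 : ∃ ws : List (Word n m), ws.map monoTg = hs.map tgMono ∧
      ws.map Subtype.val = hs.map (List.map Prod.snd) := by
    clear hn
    induction hs with
    | nil => exact ⟨[], rfl, rfl⟩
    | cons u hs ih =>
      obtain ⟨ws, h1, h2⟩ := ih fun v hv => h3 v (List.mem_cons_of_mem _ hv)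
      have hu := h3 u List.mem_cons_self
      refine ⟨⟨u.map Prod.snd, by simpa using hu⟩ :: ws, ?_, ?_⟩
      · rw [List.map_cons, List.map_cons, h1, tgMono, dif_pos hu]
      · rw [List.map_cons, List.map_cons, h2]
  obtain ⟨ws, h1, h2⟩ := h1
  rw [lwedge, ← h1, hΨ, h2, wordSum_eq_graphSum hn]

variable {δ : ZMod 2} {ξ : Matrix (Coord n m) (Coord n m) ℂ}

theorem actHam_mono (hξ : ξ ∈ osp n m δ) (u : List (Lab n m)) :
    actHam ξ (mono (u.map Prod.snd)) = xl δ ξ (fun t => mono (t.map Prod.snd)) u := by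
  induction u with
  | nil => simp [mono, actHam_one, xl]
  | cons a u ih =>
    have h := map_xl (δ := δ) (ξ := ξ) (LinearMap.mulLeft ℂ (gen a.2))
      (fun t : List (Lab n m) => mono (t.map Prod.snd)) u
    rw [List.map_cons, mono_cons, actHam_mul hξ (gen_mem_homGe a.2) (mono_mem_homGe le_rfl), ih,
      actHam_gen, xl, img, Finset.sum_mul]
    simp only [List.map_cons, mono_cons, smul_mul_assoc]
    rw [LinearMap.mulLeft_apply] at h
    rw [h]
    rfl

theorem actTg_tgMono (hξ : ξ ∈ osp n m δ) {u : List (Lab n m)} (hu : 3 ≤ u.length) :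
    actTg ξ (tgMono u) = xl δ ξ tgMono u := by
  refine Subtype.ext ?_
  change actHam ξ (tgMono u).1 = (ordGe n m 3).subtype (xl δ ξ tgMono u)
  rw [map_xl, tgMono_val hu, actHam_mono hξ]
  refine xl_congr fun t ht => ?_
  have hl := congrArg List.length ht
  rw [List.length_map, List.length_map] at hl
  exact (tgMono_val (hl ▸ hu)).symm

theorem Labelled.replace {A B : List (List (Lab n m))} {u u' : List (Lab n m)}
    (h : Labelled (A ++ u :: B)) (hu : u'.map Prod.fst = u.map Prod.fst) :
    Labelled (A ++ u' :: B) := by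
  obtain ⟨h1, h2⟩ := h
  have hl := congrArg List.length hu
  rw [List.length_map, List.length_map] at hl
  refine ⟨fun v hv => ?_, ?_⟩
  · rw [List.mem_append, List.mem_cons] at hv
    rcases hv with hv | rfl | hv
    · exact h1 v (by simp [hv])
    · rw [hl]; exact h1 u (by simp)
    · exact h1 v (by simp [hv])
  · simpa [hu] using h2

/-- The map `Ψ` is not multiplicative, so the factors already passed by the derivation are carried
along as `A`. The action changes letters but not labels, hence the vertices stay fixed and the
action can be performed inside `asm`. -/
theorem lift_der (hΨ : IsWordLift Ψ) (hξ : ξ ∈ osp n m δ) (A B : List (List (Lab n m)))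
    (h : Labelled (A ++ B)) :
    Ψ (lwedge A * (tgSuper n m).der δ (actTg ξ) (fun _ _ ha => actTg_mem hξ ha) (lwedge B)) =
      asm ((A ++ B).map vset) (xl δ ξ (fun t => wk (A.flatten ++ t)) B.flatten) := by
  induction B generalizing A with
  | nil =>
    rw [lwedge_nil, SuperBracket.der_one, mul_zero, map_zero, List.flatten_nil, xl, map_zero]
  | cons u B ih =>
    have h1 := ih (A ++ [u]) (by simpa using h)
    have h2 : Ψ (lwedge A * (SuperExt.ι (tgPart n m) (actTg ξ (tgMono u)) * lwedge B)) =
        asm ((A ++ u :: B).map vset)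
          (xl δ ξ (fun t => wk (A.flatten ++ (t ++ B.flatten))) u) := by
      rw [actTg_tgMono hξ (h.1 u (by simp))]
      have e := map_xl (δ := δ) (ξ := ξ) (Ψ ∘ₗ LinearMap.mulLeft ℂ (lwedge A) ∘ₗ
        LinearMap.mulRight ℂ (lwedge B) ∘ₗ SuperExt.ι (tgPart n m)) tgMono u
      refine e.trans ?_
      rw [map_xl]
      refine xl_congr fun t ht => ?_
      have ht' : vset t = vset u := by rw [vset, ht, vset]
      have e2 := lift_lwedge hΨ (h.replace ht)
      rw [lwedge_append, lwedge_cons] at e2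
      refine e2.trans ?_
      rw [graphSum, List.map_append, List.map_cons, ht', List.map_append, List.map_cons,
        List.flatten_append, List.flatten_cons]
    rw [lwedge_append, lwedge_cons, lwedge_nil, mul_one, mul_assoc] at h1
    rw [lwedge_cons, SuperBracket.der_ι_mul _ _ (tgMono_mem u), mul_add, mul_smul_comm, map_add,
      map_smul, h1, h2, List.flatten_cons, xl_append, map_add, map_smul]
    simp only [List.append_assoc, List.flatten_append, List.flatten_cons, List.flatten_nil,
      List.append_nil, List.cons_append, List.nil_append]

theorem ospSub_le_ker (hΨ : IsWordLift Ψ) : ospSub n m ≤ LinearMap.ker Ψ := by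
  refine Submodule.span_le.2 ?_
  rintro _ ⟨δ, ξ, p, a, ε, hξ, ha, rfl⟩
  -- Vanishing is shown on wedge products of monomials, where `xl_wick` applies; by linearity it
  -- extends to the homogeneous elements that define `ospSub`.
  have hz : Ψ ∘ₗ (tgSuper n m).der δ (actTg ξ) (fun _ _ ha => actTg_mem hξ ha) = 0 := by
    refine LinearMap.ext_on span_wedge_monoTg ?_
    rintro _ ⟨ws, rfl⟩
    have h := lift_der hΨ hξ [] _ (labelled_std ws)
    rw [lwedge_nil, one_mul, lwedge_std] at h
    rw [LinearMap.comp_apply, h]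
    have h0 : xl δ ξ (fun t : List (Lab n m) => wk (([] : List (List (Lab n m))).flatten ++ t))
        (std 0 (ws.map Subtype.val)).flatten = 0 := xl_wick hξ edgeVar _
    rw [h0, map_zero, LinearMap.zero_apply]
  have h := LinearMap.congr_fun hz (wedge (tgPart n m) (List.ofFn a))
  rw [LinearMap.comp_apply, SuperBracket.der_wedge _ _ a ε ha] at h
  exact h

end Invariance

/-! ### The Poisson bracket of two monomials -/

section Bilinear

variable {M : Type*} [AddCommGroup M] [Module ℂ M] {β : Type*} {p : β → ZMod 2}
  {Q : β → β → ℂ}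

theorem map_dl {M' : Type*} [AddCommGroup M'] [Module ℂ M'] (φ : M →ₗ[ℂ] M') (s : β)
    (f : List β → M) (t : List β) : φ (dl p Q s f t) = dl p Q s (fun u => φ (f u)) t := by
  induction t generalizing f with
  | nil => simp [dl]
  | cons k t ih => simp only [dl, map_add, map_smul, ih]

/-- The functional which contracts a letter of `u` with a letter of `v` in all possible ways and
applies `f` to the remaining letters of `u ++ v`. -/
def bl (p : β → ZMod 2) (Q : β → β → ℂ) : (List β → M) → List β → List β → M
  | _, [], _ => 0
  | f, a :: u, v => bl p Q (fun t => f (a :: t)) u v +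
      ksign (p a * lpar p u) • dl p Q a (fun t => f (u ++ t)) v

theorem map_bl {M' : Type*} [AddCommGroup M'] [Module ℂ M'] (φ : M →ₗ[ℂ] M')
    (f : List β → M) (u v : List β) : φ (bl p Q f u v) = bl p Q (fun t => φ (f t)) u v := by
  induction u generalizing f with
  | nil => simp [bl]
  | cons a u ih => simp only [bl, map_add, map_smul, ih, map_dl]

theorem bl_congr {f g : List β → M} {u v : List β}
    (h : ∀ t : List β, t.length + 2 = u.length + v.length → f t = g t) :
    bl p Q f u v = bl p Q g u v := by
  induction u generalizing f g with
  | nil => rfl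
  | cons a u ih =>
    simp only [bl]
    rw [ih fun t ht => h (a :: t) (by simp only [List.length_cons]; omega),
      dl_congr a fun t ht => h (u ++ t) (by simp only [List.length_append, List.length_cons]; omega)]

/-- The sign is that of moving `a` past the letters between `a` and `b` in `u ++ v`. As in
`dl_eq_sum`, `g` must not depend on positions. -/
theorem bl_eq_sum (f : List β → M) (u v : List β) (g : β → β → M)
    (h : ∀ u₁ a u₂ v₁ b v₂, u = u₁ ++ a :: u₂ → v = v₁ ++ b :: v₂ →
      g a b = ksign (p a * (lpar p u₂ + lpar p v₁)) • Q a b • f (u₁ ++ u₂ ++ v₁ ++ v₂)) :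
    bl p Q f u v = (u.map fun a => (v.map (g a)).sum).sum := by
  induction u generalizing f with
  | nil => rfl
  | cons a u ih =>
    rw [bl, List.map_cons, List.sum_cons, add_comm]
    congr 1
    · rw [dl_eq_sum a _ v (fun b => ksign (p a * lpar p u) • g a b)]
      · rw [List.smul_sum, List.map_map]
        simp only [Function.comp_def, smul_smul, ksign_mul_self, one_smul]
      · rintro v₁ b v₂ rfl
        rw [h [] a u v₁ b v₂ rfl rfl, mul_add, ksign_add, smul_smul, ← mul_assoc, ksign_mul_self,
          one_mul]
        simp
    · refine ih _ fun u₁ a' u₂ v₁ b v₂ hu hv => ?_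
      rw [h (a :: u₁) a' u₂ v₁ b v₂ (by rw [hu]; rfl) hv]
      rfl

end Bilinear

section Bracket

variable {n m : ℕ}

/-- The symplectic form on labelled coordinates. -/
def lform (a b : Lab n m) : ℂ := form a.2 b.2

/-- The Leibniz rule in the first argument, from the one in the second by super-antisymmetry; the
signs that involve the parity of `h` cancel. -/
theorem poisson_gen_mul {k l : ℕ} {η θ : ZMod 2} (a : Coord n m) {g h : Ham n m}
    (hg : g ∈ homGe n m k η) (hh : h ∈ homGe n m l θ) : poisson n m (gen a * g) h =
      gen a * poisson n m g h + ksign (par a * η) • (g * poisson n m (gen a) h) := by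
  have ha := gen_mem_homGe a
  have e1 := mul_comm_homGe (poisson_homGe ha hh) hg
  rw [poisson_swap (mul_mem_homGe ha hg) hh, poisson_mul hh ha hg, poisson_swap hh ha,
    poisson_swap hh hg, neg_mul, smul_mul_assoc, e1, mul_neg, mul_smul_comm]
  generalize gen a * poisson n m g h = X
  generalize g * poisson n m (gen a) h = Y
  generalize par a = s
  rcases zmod2_cases s with rfl | rfl <;> rcases zmod2_cases η with rfl | rfl <;>
    rcases zmod2_cases θ with rfl | rfl <;> simp [ksign, zmod2_one_add_one]

theorem poisson_gen_mono (a : Lab n m) (v : List (Lab n m)) :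
    poisson n m (gen a.2) (mono (v.map Prod.snd)) =
      dl cpar lform a (fun t => mono (t.map Prod.snd)) v := by
  induction v with
  | nil => exact poisson_one
  | cons b v ih =>
    have h := map_dl (p := cpar) (Q := lform) (LinearMap.mulLeft ℂ (gen b.2)) a
      (fun t : List (Lab n m) => mono (t.map Prod.snd)) v
    rw [LinearMap.mulLeft_apply] at h
    rw [List.map_cons, mono_cons, poisson_mul (gen_mem_homGe a.2) (gen_mem_homGe b.2)
      (mono_mem_homGe le_rfl), ih, poisson_gen, h, dl, ← Algebra.smul_def]
    simp only [List.map_cons, mono_cons]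
    rfl

/-- The bracket is a biderivation with the symplectic form as its value on coordinates, and `bl`
satisfies the same recursion in `u`. -/
theorem poisson_mono (u v : List (Lab n m)) :
    poisson n m (mono (u.map Prod.snd)) (mono (v.map Prod.snd)) =
      bl cpar lform (fun t => mono (t.map Prod.snd)) u v := by
  induction u with
  | nil =>
    have h1 : (1 : Ham n m) ∈ homGe n m 0 0 := Submodule.subset_span ⟨[], by simp, by simp [wpar],
      by simp [mono]⟩
    have h2 : mono (v.map Prod.snd) ∈ homGe n m _ _ := mono_mem_homGe le_rfl
    rw [bl, List.map_nil, show mono ([] : List (Coord n m)) = 1 by simp [mono],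
      poisson_swap h1 h2, poisson_one, smul_zero, neg_zero]
  | cons a u ih =>
    have h1 := map_bl (p := cpar) (Q := lform) (LinearMap.mulLeft ℂ (gen a.2))
      (fun t : List (Lab n m) => mono (t.map Prod.snd)) u v
    have h2 := map_dl (p := cpar) (Q := lform) (LinearMap.mulLeft ℂ (mono (u.map Prod.snd))) a
      (fun t : List (Lab n m) => mono (t.map Prod.snd)) v
    rw [LinearMap.mulLeft_apply] at h1 h2
    rw [List.map_cons, mono_cons, poisson_gen_mul a.2 (mono_mem_homGe le_rfl)
      (mono_mem_homGe le_rfl), ih, poisson_gen_mono, h1, h2, bl, wpar_map_snd]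
    have h3 : ∀ t : List (Lab n m), mono ((u ++ t).map Prod.snd) =
        mono (u.map Prod.snd) * mono (t.map Prod.snd) := fun t => by simp [mono]
    simp only [h3, List.map_cons, mono_cons]
    rfl

theorem tgBracket_tgMono {u v : List (Lab n m)} (hu : 3 ≤ u.length) (hv : 3 ≤ v.length) :
    tgBracket n m (tgMono u) (tgMono v) = bl cpar lform tgMono u v := by
  refine Subtype.ext ?_
  change poisson n m (tgMono u).1 (tgMono v).1 = (ordGe n m 3).subtype (bl cpar lform tgMono u v)
  rw [map_bl, tgMono_val hu, tgMono_val hv, poisson_mono]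
  -- The words that remain have at least four letters, so the value zero of `tgMono` on short words
  -- is not used.
  exact bl_congr fun t ht => (tgMono_val (by omega)).symm

/-! ### The chain map property -/

/-- The labels are distinct, so the variable of the edge between `a` and `b` occurs only in the
pairing of these two letters. In `derivation_wick` a single contraction survives, with the sign for
moving `a` past `v`. -/
theorem edgeDer_wk {u v w : List (Lab n m)} {a b : Lab n m}
    (hnd : ((u ++ a :: v ++ b :: w).map Prod.fst).Nodup) :
    edgeDer a.1 b.1 (wk (u ++ a :: v ++ b :: w)) =
      ksign (cpar a * lpar cpar v) • lform a b • wk (u ++ v ++ w) := by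
  have hinj : ∀ s ∈ u ++ a :: v ++ b :: w, ∀ k ∈ u ++ a :: v ++ b :: w, s.1 = k.1 → s = k :=
    fun s hs k hk h => List.inj_on_of_nodup_map hnd hs hk h
  have ha : a ∈ u ++ a :: v ++ b :: w := by simp
  have hb : b ∈ u ++ a :: v ++ b :: w := by simp
  have hab : a.1 ≠ b.1 := by
    intro h
    rw [List.append_assoc, List.map_append, List.cons_append, List.map_cons] at hnd
    have := (List.nodup_cons.1 (List.nodup_append.1 hnd).2.1).1
    exact this (by simp [h])
  have hX : ∀ e f : ℕ × ℕ, MvPolynomial.pderiv e (MvPolynomial.X f : EdgePoly) =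
      if f = e then 1 else 0 := by
    intro e f
    rw [MvPolynomial.pderiv_X, Pi.single_apply]
  -- The derivation takes the value `1` on the variable of its own edge, `-1` on the reversed one
  -- and `0` on all others; this uses that the two labels differ.
  have hder : ∀ h k, edgeDer a.1 b.1 (edgeVar h k) =
      (if h = a.1 ∧ k = b.1 then 1 else 0) - (if h = b.1 ∧ k = a.1 then 1 else 0) := by
    intro h k
    rcases lt_trichotomy h k with hk | rfl | hk
    · rw [edgeVar, if_pos hk, edgeDer, Derivation.sub_apply, hX, hX]
      simp only [Prod.mk.injEq]
    · have e1 : ¬ (h = a.1 ∧ h = b.1) := fun hh => hab (hh.1.symm.trans hh.2)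
      have e2 : ¬ (h = b.1 ∧ h = a.1) := fun hh => hab (hh.2.symm.trans hh.1)
      rw [if_neg e1, if_neg e2]
      simp [edgeVar]
    · rw [edgeVar, if_neg hk.not_gt, if_pos hk, map_neg, edgeDer, Derivation.sub_apply, hX, hX,
        neg_sub]
      simp only [Prod.mk.injEq, and_comm]
  rw [wk, derivation_wick (pairing_even _), pe_single _ hnd.of_map]
  · rw [pairing, Derivation.map_smul, hder, if_pos ⟨rfl, rfl⟩, if_neg fun h => hab h.1, sub_zero,
      smul_one_smul]
    rfl
  · intro s hs k hk h1 h2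
    rw [pairing, Derivation.map_smul, hder,
      if_neg fun h => h1 ⟨hinj _ hs _ ha h.1, hinj _ hk _ hb h.2⟩,
      if_neg fun h => h2 ⟨hinj _ hs _ hb h.1, hinj _ hk _ ha h.2⟩, sub_zero, smul_zero]

theorem vset_append (u v : List (Lab n m)) : vset (u ++ v) = vset u ∪ vset v := by
  simp [vset]

theorem vset_erase {u v : List (Lab n m)} {a : Lab n m}
    (h : ((u ++ a :: v).map Prod.fst).Nodup) : (vset (u ++ a :: v)).erase a.1 = vset (u ++ v) := by
  have hn : a.1 ∉ (u ++ v).map Prod.fst := by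
    have := (List.perm_middle (l₁ := u) (a := a) (l₂ := v)).map Prod.fst
    exact (List.nodup_cons.1 (this.nodup_iff.1 h)).1
  ext i
  rw [Finset.mem_erase]
  simp only [vset, List.mem_toFinset, List.map_append, List.map_cons, List.mem_append,
    List.mem_cons] at hn ⊢
  constructor
  · rintro ⟨h1, h2 | h2 | h2⟩
    exacts [Or.inl h2, absurd h2 h1, Or.inr h2]
  · intro h'
    exact ⟨fun e => hn (e ▸ h'), h'.imp id Or.inr⟩

theorem sum_vset {A : Type*} [AddCommMonoid A] {u : List (Lab n m)} (h : (u.map Prod.fst).Nodup)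
    (f : ℕ → A) : ∑ i ∈ vset u, f i = (u.map fun a => f a.1).sum := by
  rw [vset, List.sum_toFinset _ h, List.map_map]
  rfl

end Bracket

section ChainMap

variable {n m : ℕ} {Ψ : SuperExt (tgPart n m) →ₗ[ℂ] GC}

/-- Each pair of letters, one in `x` and one in `y`, contributes one contraction on both sides, so
only signs are compared. Returning the merged vertex from the front to the place of `y` gives `(-1)
^ (pre.length + mid.length)`, of which the sign in `cutTerm` cancels the second part. The Koszul
sign for moving `a` to `b`, combined with that for moving the rest of `x` past `mid`, is the sign of
the bracket times that of moving all of `x` past `mid`. -/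
theorem cutTerm_eq (hΨ : IsWordLift Ψ) {pre mid post : List (List (Lab n m))}
    {x y : List (Lab n m)} (h : Labelled (pre ++ x :: (mid ++ y :: post))) :
    cutTerm vset (wk (pre ++ x :: (mid ++ y :: post)).flatten) pre x mid y post =
      ((-1 : ℂ) ^ pre.length * ksign (lpar cpar x * lpar cpar mid.flatten)) •
        Ψ (lwedge pre * (lwedge mid * (SuperExt.ι (tgPart n m)
          (tgBracket n m (tgMono x) (tgMono y)) * lwedge post))) := by
  obtain ⟨h3, hn⟩ := h
  have hx := h3 x (by simp)
  have hy := h3 y (by simp)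
  have hn' := hn
  simp only [List.flatten_append, List.flatten_cons, List.map_append] at hn'
  obtain ⟨-, hn1, -⟩ := List.nodup_append.1 hn'
  obtain ⟨hnx, hn2, -⟩ := List.nodup_append.1 hn1
  obtain ⟨-, hn3, -⟩ := List.nodup_append.1 hn2
  obtain ⟨hny, -, -⟩ := List.nodup_append.1 hn3
  -- The bracket is a `bl`, and everything around it is linear, so both sides become sums over pairs
  -- of letters.
  have e := map_bl (p := cpar) (Q := lform) (((-1 : ℂ) ^ pre.length *
    ksign (lpar cpar x * lpar cpar mid.flatten)) • (Ψ ∘ₗ LinearMap.mulLeft ℂ (lwedge pre) ∘ₗ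
    LinearMap.mulLeft ℂ (lwedge mid) ∘ₗ LinearMap.mulRight ℂ (lwedge post) ∘ₗ
    SuperExt.ι (tgPart n m))) tgMono x y
  rw [← tgBracket_tgMono hx hy] at e
  refine Eq.trans ?_ e.symm
  have hsum : ∀ f : ℕ → ℕ → GC, ∑ i ∈ vset x, ∑ j ∈ vset y, f i j =
      (x.map fun a => (y.map fun b => f a.1 b.1).sum).sum := by
    intro f
    simp only [sum_vset hny]
    exact sum_vset hnx _
  rw [cutTerm, hsum]
  refine (bl_eq_sum _ x y (fun a b => (-1 : ℂ) ^ mid.length •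
    asm (((vset x).erase a.1 ∪ (vset y).erase b.1) :: (pre ++ mid ++ post).map vset)
      (edgeDer a.1 b.1 (wk (pre ++ x :: (mid ++ y :: post)).flatten))) ?_).symm
  rintro x₁ a x₂ y₁ b y₂ rfl rfl
  have hl : Labelled ((pre ++ mid) ++ (x₁ ++ x₂ ++ y₁ ++ y₂) :: post) := by
    refine ⟨fun u hu => ?_, ?_⟩
    · rw [List.mem_append, List.mem_append, List.mem_cons] at hu
      rcases hu with (hu | hu) | rfl | hu
      · exact h3 u (by simp [hu])
      · exact h3 u (by simp [hu])
      · simp only [List.length_append, List.length_cons] at hx hy ⊢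
        omega
      · exact h3 u (by simp [hu])
    · have hp : ((pre ++ (x₁ ++ a :: x₂) :: (mid ++ (y₁ ++ b :: y₂) :: post)).flatten.map
          Prod.fst).Perm (a.1 :: b.1 ::
            ((pre ++ mid) ++ (x₁ ++ x₂ ++ y₁ ++ y₂) :: post).flatten.map Prod.fst) := by
        rw [List.perm_iff_count]
        intro c
        simp only [List.flatten_append, List.flatten_cons, List.map_append, List.map_cons,
          List.count_append, List.count_cons]
        omega
      exact (List.nodup_cons.1 (List.nodup_cons.1 (hp.nodup_iff.1 hn)).2).2
  have e1 := lift_lwedge hΨ hl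
  have hflat : (pre ++ (x₁ ++ a :: x₂) :: (mid ++ (y₁ ++ b :: y₂) :: post)).flatten =
      (pre.flatten ++ x₁) ++ a :: (x₂ ++ mid.flatten ++ y₁) ++ b :: (y₂ ++ post.flatten) := by
    simp
  have e2 := edgeDer_wk (hflat ▸ hn)
  have e3 := wk_swapInv.block pre.flatten (x₁ ++ x₂) mid.flatten (y₁ ++ y₂ ++ post.flatten)
  have hv : (vset (x₁ ++ a :: x₂)).erase a.1 ∪ (vset (y₁ ++ b :: y₂)).erase b.1 =
      vset (x₁ ++ x₂ ++ y₁ ++ y₂) := by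
    rw [vset_erase hnx, vset_erase hny, ← vset_append, List.append_assoc (x₁ ++ x₂)]
  rw [lwedge_append, lwedge_append, lwedge_cons, mul_assoc] at e1
  have e4 : ((((-1 : ℂ) ^ pre.length *
    ksign (lpar cpar (x₁ ++ a :: x₂) * lpar cpar mid.flatten)) • (Ψ ∘ₗ
      LinearMap.mulLeft ℂ (lwedge pre) ∘ₗ LinearMap.mulLeft ℂ (lwedge mid) ∘ₗ
      LinearMap.mulRight ℂ (lwedge post) ∘ₗ SuperExt.ι (tgPart n m)))
      (tgMono (x₁ ++ x₂ ++ y₁ ++ y₂))) = ((-1 : ℂ) ^ pre.length *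
    ksign (lpar cpar (x₁ ++ a :: x₂) * lpar cpar mid.flatten)) •
      graphSum (pre ++ mid ++ (x₁ ++ x₂ ++ y₁ ++ y₂) :: post) := by
    rw [← e1]; rfl
  -- The merged vertex is brought to the front, where `cutTerm` puts it.
  have e5 : graphSum (pre ++ mid ++ (x₁ ++ x₂ ++ y₁ ++ y₂) :: post) =
      (-1 : ℂ) ^ (pre.length + mid.length) • asm (vset (x₁ ++ x₂ ++ y₁ ++ y₂) ::
        (pre ++ mid ++ post).map vset) (wk (pre.flatten ++ mid.flatten ++ (x₁ ++ x₂) ++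
          (y₁ ++ y₂ ++ post.flatten))) := by
    rw [graphSum, List.map_append, List.map_cons, asm_move, List.length_map, List.length_append]
    simp only [List.map_append, List.flatten_append, List.flatten_cons, List.append_assoc,
      List.cons_append]
  have e6 : pre.flatten ++ x₁ ++ (x₂ ++ mid.flatten ++ y₁) ++ (y₂ ++ post.flatten) =
      pre.flatten ++ (x₁ ++ x₂) ++ mid.flatten ++ (y₁ ++ y₂ ++ post.flatten) := by
    simp
  rw [hv, hflat, e2, e6, e3, e4, e5]
  simp only [map_smul, smul_smul]
  congr 1
  simp only [lpar_append, lpar_cons, mul_add, add_mul, ksign_add, pow_add]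
  have hm : ((-1 : ℂ) ^ pre.length) * (-1 : ℂ) ^ pre.length = 1 := by
    rw [← mul_pow]; simp
  linear_combination (-(-1 : ℂ) ^ mid.length * lform a b * ksign (cpar a * lpar cpar x₂) *
    ksign (cpar a * lpar cpar mid.flatten) * ksign (cpar a * lpar cpar y₁) *
    ksign (lpar cpar x₁ * lpar cpar mid.flatten) * ksign (lpar cpar x₂ * lpar cpar mid.flatten)) * hm

/-- The adjoint action of `x` is a super derivation: it brackets `x` with each later factor in
place, with the sign for passing the factors in `mid`. The terms of `cutTerm_eq` have exactly this
form. -/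
theorem followSum_eq_lift (hΨ : IsWordLift Ψ) {hs : List (List (Lab n m))} (h : Labelled hs)
    {pre : List (List (Lab n m))} {x : List (Lab n m)} (mid W : List (List (Lab n m)))
    (hW : hs = pre ++ x :: (mid ++ W)) :
    followSum (cutTerm vset (wk hs.flatten)) pre x mid W =
      ((-1 : ℂ) ^ pre.length * ksign (lpar cpar x * lpar cpar mid.flatten)) •
        Ψ (lwedge pre * (lwedge mid * (tgSuper n m).ad (tgMono x) (lwedge W))) := by
  induction W generalizing mid with
  | nil => simp [followSum, lwedge_nil, SuperBracket.ad_one]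
  | cons y W ih =>
    have h1 := ih (mid ++ [y]) (by simpa using hW)
    subst hW
    rw [followSum, cutTerm_eq hΨ h, h1, lwedge_cons y W,
      (tgSuper n m).ad_ι_mul (tgMono_mem x) (tgMono_mem y), lwedge_append, lwedge_cons y [],
      lwedge_nil, mul_one, mul_add, mul_add, map_add, smul_add, mul_smul_comm, mul_smul_comm,
      map_smul, smul_smul, mul_assoc, List.flatten_append, lpar_append, List.flatten_cons,
      List.flatten_nil, List.append_nil, mul_add, ksign_add, mul_assoc]

/-- This unfolds the rule `SuperBracket.ce_ι_mul`: the first term is the sum over the partners of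
`x`, and the minus sign of the second one accounts for one more vertex in `pre`. -/
theorem pairSum_eq_lift (hΨ : IsWordLift Ψ) {hs : List (List (Lab n m))} (h : Labelled hs)
    (pre W : List (List (Lab n m))) (hW : hs = pre ++ W) :
    pairSum (cutTerm vset (wk hs.flatten)) pre W =
      (-1 : ℂ) ^ pre.length • Ψ (lwedge pre * (tgSuper n m).ce (lwedge W)) := by
  induction W generalizing pre with
  | nil => simp [pairSum, lwedge_nil, SuperBracket.ce_one]
  | cons x W ih =>
    rw [pairSum, followSum_eq_lift hΨ h [] W (by simpa using hW),
      ih (pre ++ [x]) (by simpa using hW), lwedge_cons x W, SuperBracket.ce_ι_mul, lwedge_append,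
      lwedge_cons x [], lwedge_nil, mul_one, mul_sub, map_sub, smul_sub, one_mul,
      List.length_append, List.length_singleton, pow_succ, mul_assoc, mul_neg_one, neg_smul,
      List.flatten_nil, lpar_nil, mul_zero, ksign_zero, mul_one, sub_eq_add_neg]

theorem graphD_comp_lift (hΨ : IsWordLift Ψ) : graphD ∘ₗ Ψ = Ψ ∘ₗ (tgSuper n m).ce := by
  refine LinearMap.ext_on span_wedge_monoTg ?_
  rintro _ ⟨ws, rfl⟩
  have h := pairSum_eq_lift hΨ (labelled_std ws) [] _ rfl
  rw [List.length_nil, pow_zero, one_smul, lwedge_nil, one_mul, lwedge_std] at h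
  rw [LinearMap.comp_apply, LinearMap.comp_apply, hΨ, graphD_wordSum, h]

end ChainMap

end SuperGraph

end

/-! ### The proposition: existence, uniqueness and the chain map property. -/

open SuperGraph in
theorem mainTheorem3 (n m : ℕ) :
    ∃ Φ : RelCE n m →ₗ[ℂ] GC, (IsPhi Φ ∧ ∀ Φ' : RelCE n m →ₗ[ℂ] GC, IsPhi Φ' → Φ' = Φ) ∧
      Φ ∘ₗ relD n m = graphD ∘ₗ Φ := by
  obtain ⟨Ψ, hΨ⟩ := exists_wordSum_lift (n := n) (m := m)
  have hk := ospSub_le_ker hΨ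
  have hΦ : ∀ w, (ospSub n m).liftQ Ψ hk (relCls n m w) = Ψ w :=
    fun w => Submodule.liftQ_apply _ _ w
  -- The lift descends to the coinvariants. Each of the remaining claims is checked upstairs on the
  -- exterior superalgebra, uniqueness on the spanning wedge products of monomials.
  refine ⟨(ospSub n m).liftQ Ψ hk, ⟨fun ws => ?_, fun Φ' hΦ' => ?_⟩, ?_⟩
  · rw [hΦ, hΨ, wordSum_eq_sum]
  · refine Submodule.linearMap_qext _ (LinearMap.ext_on span_wedge_monoTg ?_)
    rintro _ ⟨ws, rfl⟩
    refine (hΦ' ws).trans ?_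
    rw [← wordSum_eq_sum, ← hΨ]
    exact (hΦ _).symm
  · refine Submodule.linearMap_qext _ (LinearMap.ext fun w => ?_)
    have h := LinearMap.congr_fun (graphD_comp_lift hΨ) w
    change (ospSub n m).liftQ Ψ hk (relCls n m ((tgSuper n m).ce w)) =
      graphD ((ospSub n m).liftQ Ψ hk (relCls n m w))
    rw [hΦ, hΦ]
    exact h.symm
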